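/- Let $\Gamma\subset \mathrm{SL}_2(\mathbb R)$ be a discrete subgroup and $\rho\colon\Gamma\to \mathrm{SU}_2$ a homomorphism such that $\gamma(x,z)=(\gamma x,\rho(\gamma)z)$ defines a free action of $\Gamma$ on $\mathbb H^2\times\mathbb S^3$, where $\mathbb S^3\subset\mathbb C^2$ is the unit sphere. (For example, $\Gamma$ is a congruence subgroup of the norm-one units of an $\mathbb R$-split quaternion algebra over a totally real field $L\ne\mathbb Q$ that is definite at all other real places, and $\rho$ comes from a nonidentity real place of $L$; then $\Gamma$ is cocompact.) Put $$\mathscr M=\Gamma\backslash(\mathbb H^2\times\mathbb S^3),\qquad \pi^*\mathscr M=\Gamma\backslash(\mathrm{SL}_2(\mathbb R)\times\mathbb S^3),$$ where $\Gamma$ acts on $\mathrm{SL}_2(\mathbb R)\times\mathbb S^3$ by $\gamma(y,z)=(\gamma y,\rho(\gamma)z)$, with the projection $\pi[(y,z)]=[(y\cdot i,z)]$. Let $dv_{\mathscr M}$ and $dv_{\pi^*\mathscr M}$ be the measures induced locally by $\frac{dx_1dx_2}{x_2^2}\,dv_{\mathbb S^3}$ and $dv_{\mathrm{SL}_2(\mathbb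 R)}\,dv_{\mathbb S^3}$, where $dv_{\mathbb S^3}$ is the surface measure and $dv_{\mathrm{SL}_2(\mathbb R)}$ is the Haar measure whose image under $y\mapsto y\cdot i$ is $\frac{dx_1dx_2}{x_2^2}$. The horizontal geodesic flow on $\pi^*\mathscr M$ is $\boldsymbol g_t[(y,z)]=[(yg_t,z)]$, $g_t=\mathrm{diag}(e^{t/2},e^{-t/2})$. A Maass form with eigenvalue $\lambda\in\mathbb R$ is a function $u_\lambda\in\mathscr C^\infty(\mathscr M)$ (equivalently, a smooth section of the flat bundle $\mathscr F=\Gamma\backslash(\mathbb H^2\times\mathscr C^\infty(\mathbb S^3))$ over $\Gamma\backslash\mathbb H^2$) whose lift to $\mathbb H^2\times\mathbb S^3$ satisfies $-x_2^2\big(\partial_{x_1}^2+\partial_{x_2}^2\big)u_\lambda=\lambda u_\lambda$, and such that $\int_{\mathscr M}|u_\lambda|^2dv_{\mathscr M}=1$. Write $\lambda=r^2+\frac14$ with $r>0$ (for $\lambda>\frac14$; only large $\lambda$ matter). Let $$E^{\pm}=\tfrac12\begin{pmatrix}1&\pm i\\ \pm i&-1\end{pmatrix}\in\mathfrak{sl}_2(\mathbb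 C)$$ act on functions on $\pi^*\mathscr M$ by complex-linear extension of $(Ys)[(y,z)]=\frac{d}{dt}\big|_{t=0}s[(ye^{tY},z)]$, $Y\in\mathfrak{sl}_2(\mathbb R)$. Define $s_{\lambda,2n}$, $n\in\mathbb Z$, by $s_{\lambda,0}=u_\lambda\circ\pi$ and $$s_{\lambda,2n+2}=\big(ir+\tfrac12+n\big)^{-1}E^+s_{\lambda,2n}\ (n\ge 0),\qquad s_{\lambda,2n-2}=\big(ir+\tfrac12-n\big)^{-1}E^-s_{\lambda,2n}\ (n\le 0),$$ and the lift of $u_\lambda$ by $$s_\lambda=\frac1{\sqrt{2\lceil r^{1/2}\rceil+1}}\sum_{|n|\le\lceil r^{1/2}\rceil}s_{\lambda,2n}.$$ Measures are finite on compact sets, and weak-$*$ convergence is tested on continuous functions with compact support (if $\Gamma$ is cocompact: on all continuous functions). **Theorem.** Let $(u_{\lambda_i})_{i\in\mathbb N}$ be a sequence of Maass forms with $\lambda_i\to\infty$ such that the measures $|u_{\lambda_i}|^2dv_{\mathscr M}$ converge weak-$*$ to a measure $\mu_{\mathscr M}$ on $\mathscr M$. Let $\mu_{\pi^*\mathscr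 M}$ be the weak-$*$ limit of any subsequence of $|s_{\lambda_i}|^2dv_{\pi^*\mathscr M}$ on $\pi^*\mathscr M$. Then $\pi_*\mu_{\pi^*\mathscr M}=\mu_{\mathscr M}$, and $\mu_{\pi^*\mathscr M}$ is invariant under the horizontal geodesic flow: $(\boldsymbol g_t)_*\mu_{\pi^*\mathscr M}=\mu_{\pi^*\mathscr M}$ for all $t\in\mathbb R$. -/

import Mathlib

open MeasureTheory Filter Topology UpperHalfPlane
open scoped MatrixGroups Manifold ContDiff

noncomputable section

namespace MicrolocalLift

/-! ### The 3-sphere and the group `SU(2)` -/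

/-- The unit sphere `S³` of the Hermitian plane `ℂ²`. -/
abbrev S3 : Type := Metric.sphere (0 : EuclideanSpace ℂ (Fin 2)) 1

/-- The compact group `SU(2)`. -/
abbrev SU2 : Type := Matrix.specialUnitaryGroup (Fin 2) ℂ

instance finrank_C2 : Fact (Module.finrank ℝ (EuclideanSpace ℂ (Fin 2)) = 3 + 1) :=
  ⟨by rw [finrank_real_of_complex, finrank_euclideanSpace_fin]⟩

lemma norm_SU2_mulVec (A : SU2) (z : EuclideanSpace ℂ (Fin 2)) :
    ‖WithLp.toLp 2 ((A : Matrix (Fin 2) (Fin 2) ℂ).mulVec z.ofLp)‖ = ‖z‖ := by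
  have h : star (A : Matrix (Fin 2) (Fin 2) ℂ) * (A : Matrix (Fin 2) (Fin 2) ℂ) = 1 :=
    (Unitary.mem_iff.1 (Matrix.mem_specialUnitaryGroup_iff.1 A.2).1).1
  have key : inner ℂ (WithLp.toLp 2 ((A : Matrix (Fin 2) (Fin 2) ℂ).mulVec z.ofLp))
      (WithLp.toLp 2 ((A : Matrix (Fin 2) (Fin 2) ℂ).mulVec z.ofLp)) = inner ℂ z z := by
    rw [EuclideanSpace.inner_eq_star_dotProduct, EuclideanSpace.inner_eq_star_dotProduct,
      dotProduct_comm, dotProduct_comm z.ofLp, Matrix.star_mulVec, ← Matrix.dotProduct_mulVec,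
      Matrix.mulVec_mulVec, ← Matrix.star_eq_conjTranspose, h, Matrix.one_mulVec]
  have h2 : ‖WithLp.toLp 2 ((A : Matrix (Fin 2) (Fin 2) ℂ).mulVec z.ofLp)‖ ^ 2 = ‖z‖ ^ 2 := by
    rw [inner_self_eq_norm_sq_to_K, inner_self_eq_norm_sq_to_K] at key
    exact_mod_cast key
  exact (sq_eq_sq₀ (norm_nonneg _) (norm_nonneg _)).1 h2

/-- The standard (linear) action of `SU(2)` on `S³`. -/
instance actionS3 : MulAction SU2 S3 where
  smul A z := ⟨WithLp.toLp 2 ((A : Matrix (Fin 2) (Fin 2) ℂ).mulVec z.1.ofLp), by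
    rw [mem_sphere_zero_iff_norm, norm_SU2_mulVec]
    exact mem_sphere_zero_iff_norm.1 z.2⟩
  one_smul z := by
    apply Subtype.ext
    change WithLp.toLp 2 ((1 : Matrix (Fin 2) (Fin 2) ℂ).mulVec z.1.ofLp) = z.1
    rw [Matrix.one_mulVec]
  mul_smul A B z := by
    apply Subtype.ext
    change WithLp.toLp 2 (((A : Matrix (Fin 2) (Fin 2) ℂ) * (B : Matrix (Fin 2) (Fin 2) ℂ)).mulVec
      z.1.ofLp) = WithLp.toLp 2 ((A : Matrix (Fin 2) (Fin 2) ℂ).mulVec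
        ((B : Matrix (Fin 2) (Fin 2) ℂ).mulVec z.1.ofLp))
    rw [Matrix.mulVec_mulVec]

/-- The rotation-invariant (Haar) measure of `S³`: its surface measure. -/
def volS3 : Measure S3 := (volume : Measure (EuclideanSpace ℂ (Fin 2))).toSphere

/-! ### The group `SL(2, ℝ)` -/

instance measurableSpaceSL2 : MeasurableSpace SL(2, ℝ) := borel _

instance borelSpaceSL2 : BorelSpace SL(2, ℝ) := ⟨rfl⟩

/-- The rotation `k_θ`. -/
def rot (θ : ℝ) : SL(2, ℝ) :=
  ⟨!![Real.cos θ, -Real.sin θ; Real.sin θ, Real.cos θ], by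
    rw [Matrix.det_fin_two_of]; linarith [Real.cos_sq_add_sin_sq θ]⟩

/-- The one-parameter group `g_t = diag(e^{t/2}, e^{-t/2})`, that is `exp(tH)` with
`H = (1/2) [[1, 0], [0, -1]]`. -/
def geo (t : ℝ) : SL(2, ℝ) :=
  ⟨!![Real.exp (t / 2), 0; 0, Real.exp (-(t / 2))], by
    rw [Matrix.det_fin_two_of, ← Real.exp_add]; simp⟩

/-- The one-parameter group `exp(tV)` with `V = (1/2) [[0, 1], [1, 0]]`. -/
def hyp (t : ℝ) : SL(2, ℝ) :=
  ⟨!![Real.cosh (t / 2), Real.sinh (t / 2); Real.sinh (t / 2), Real.cosh (t / 2)], by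
    rw [Matrix.det_fin_two_of]; linarith [Real.cosh_sq_sub_sinh_sq (t / 2)]⟩

/-- The Haar measure of `SL(2, ℝ)` in Iwasawa coordinates `g = n(x) a(y) k_θ`, namely
`dx dy / y² · dθ / 2π`. The maximal compact subgroup has mass one, so that the image of this
measure under `g ↦ g • i` is the hyperbolic area `dx dy / y²` (the `volume` of `ℍ`).
Here X and sends `i` to `x + iy`. -/
def haarSL2 : Measure SL(2, ℝ) :=
  Measure.map (fun p : ℍ × ℝ => toSL2R p.1 * rot p.2)
    ((volume : Measure ℍ).prod
      (ENNReal.ofReal (1 / (2 * Real.pi)) • volume.restrict (Set.Ioc 0 (2 * Real.pi))))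

/-! ### Quotient measures -/

/-- The measure to which `μ` descends along a quotient map `q`: the least measure on the target that
dominates the image of `μ` restricted to any measurable set on which `q` is injective. If `q` is the
quotient by a free, properly discontinuous, measure preserving action of a countable group, this is
the measure locally given by `μ`, equivalently the image of the restriction of `μ` to a
fundamental domain. -/
def quotientMeasure {α β : Type*} [MeasurableSpace α] [MeasurableSpace β]
    (μ : Measure α) (q : α → β) : Measure β :=
  ⨆ B ∈ {B : Set α | MeasurableSet B ∧ Set.InjOn q B}, Measure.map q (μ.restrict B)

/-! ### The flat `S³`-bundles -/

variable {Γ : Subgroup SL(2, ℝ)}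

/-- `(x, z) ∼ (γ x, ρ(γ) z)` on `ℍ × S³`. -/
def baseSetoid (ρ : Γ →* SU2) : Setoid (ℍ × S3) where
  r p q := ∃ γ : Γ, (γ • p.1, ρ γ • p.2) = q
  iseqv :=
    { refl := fun p => ⟨1, by rw [map_one, one_smul, one_smul]⟩
      symm := by
        rintro p q ⟨γ, rfl⟩
        exact ⟨γ⁻¹, by simp only [smul_smul, ← map_mul, inv_mul_cancel, map_one, one_smul]⟩
      trans := by
        rintro p q r ⟨γ, rfl⟩ ⟨δ, rfl⟩
        exact ⟨δ * γ, by simp only [smul_smul, ← map_mul]⟩ }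

/-- `(g, z) ∼ (γ g, ρ(γ) z)` on `SL(2, ℝ) × S³`. -/
def liftSetoid (ρ : Γ →* SU2) : Setoid (SL(2, ℝ) × S3) where
  r p q := ∃ γ : Γ, ((γ : SL(2, ℝ)) * p.1, ρ γ • p.2) = q
  iseqv :=
    { refl := fun p => ⟨1, by rw [map_one, one_smul, Subgroup.coe_one, one_mul]⟩
      symm := by
        rintro p q ⟨γ, rfl⟩
        exact ⟨γ⁻¹, by simp only [smul_smul, ← map_mul, inv_mul_cancel, map_one, one_smul,
          Subgroup.coe_inv, inv_mul_cancel_left]⟩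
      trans := by
        rintro p q r ⟨γ, rfl⟩ ⟨δ, rfl⟩
        exact ⟨δ * γ, by simp only [smul_smul, ← map_mul, Subgroup.coe_mul, mul_assoc]⟩ }

/-- The flat `S³`-bundle `𝓜 = Γ \ (ℍ × S³)` over `X = Γ \ ℍ` with holonomy `ρ`. -/
def Base (ρ : Γ →* SU2) : Type := Quotient (baseSetoid ρ)

/-- Its pull-back `π^*𝓜 = Γ \ (SL(2, ℝ) × S³)` to `Γ \ SL(2, ℝ)`. -/
def Lift (ρ : Γ →* SU2) : Type := Quotient (liftSetoid ρ)

instance (ρ : Γ →* SU2) : TopologicalSpace (Base ρ) :=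
  inferInstanceAs (TopologicalSpace (Quotient (baseSetoid ρ)))

instance (ρ : Γ →* SU2) : MeasurableSpace (Base ρ) := borel _

instance (ρ : Γ →* SU2) : BorelSpace (Base ρ) := ⟨rfl⟩

instance (ρ : Γ →* SU2) : TopologicalSpace (Lift ρ) :=
  inferInstanceAs (TopologicalSpace (Quotient (liftSetoid ρ)))

instance (ρ : Γ →* SU2) : MeasurableSpace (Lift ρ) := borel _

instance (ρ : Γ →* SU2) : BorelSpace (Lift ρ) := ⟨rfl⟩

/-- The quotient map `ℍ × S³ → 𝓜`. -/
def Base.mk (ρ : Γ →* SU2) (p : ℍ × S3) : Base ρ := Quotient.mk (baseSetoid ρ) p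

/-- The quotient map `SL(2, ℝ) × S³ → π^*𝓜`. -/
def Lift.mk (ρ : Γ →* SU2) (p : SL(2, ℝ) × S3) : Lift ρ := Quotient.mk (liftSetoid ρ) p

/-- The volume `dv_𝓜`, locally hyperbolic area times the volume of `S³`. -/
def volBase (ρ : Γ →* SU2) : Measure (Base ρ) :=
  quotientMeasure ((volume : Measure ℍ).prod volS3) (Base.mk ρ)

/-- The volume `dv_{π^*𝓜}`, locally Haar measure times the volume of `S³`. -/
def volLift (ρ : Γ →* SU2) : Measure (Lift ρ) :=
  quotientMeasure (haarSL2.prod volS3) (Lift.mk ρ)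

/-- The projection `π : π^*𝓜 → 𝓜`, `[(g, z)] ↦ [(g • i, z)]`. -/
def proj (ρ : Γ →* SU2) : Lift ρ → Base ρ :=
  Quotient.map (sa := liftSetoid ρ) (sb := baseSetoid ρ) (fun p => (p.1 • I, p.2)) (by
    rintro p q ⟨γ, rfl⟩
    exact ⟨γ, Prod.ext (smul_smul (γ : SL(2, ℝ)) p.1 I) rfl⟩)

/-- The right translation `[(g, z)] ↦ [(g h, z)]` of `π^*𝓜`. -/
def rightMul (ρ : Γ →* SU2) (h : SL(2, ℝ)) : Lift ρ → Lift ρ :=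
  Quotient.map (sa := liftSetoid ρ) (sb := liftSetoid ρ) (fun p => (p.1 * h, p.2)) (by
    rintro p q ⟨γ, rfl⟩
    exact ⟨γ, Prod.ext (mul_assoc (γ : SL(2, ℝ)) p.1 h).symm rfl⟩)

/-- The horizontal geodesic flow of `π^*𝓜`. -/
def flow (ρ : Γ →* SU2) (t : ℝ) : Lift ρ → Lift ρ := rightMul ρ (geo t)

/-! ### Maass forms -/

/-- The Laplacian `-y² (∂²/∂x² + ∂²/∂y²)` of a function on the upper half-plane. -/
def hypLaplacian (f : ℍ → ℂ) (τ : ℍ) : ℂ :=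
  -((τ.im : ℂ) ^ 2) * Laplacian.laplacian (fun w : ℂ => f (ofComplex w)) (τ : ℂ)

/-- `u` is a Maass form with eigenvalue `lam`: a normalized smooth eigensection of the Laplacian of
the bundle with fibre `C^∞(S³)`, regarded as a function on `𝓜`. It lifts to a smooth
`Γ`-invariant function on `ℍ × S³`, and the Laplacian acts in the variable of `ℍ`. -/
structure IsMaassForm (ρ : Γ →* SU2) (lam : ℝ) (u : Base ρ → ℂ) : Prop where
  smooth : ContMDiff (𝓘(ℝ, ℂ).prod (𝓡 3)) 𝓘(ℝ, ℂ) ∞ (fun p : ℍ × S3 => u (Base.mk ρ p))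
  eigen : ∀ (τ : ℍ) (z : S3),
    hypLaplacian (fun σ => u (Base.mk ρ (σ, z))) τ = (lam : ℂ) * u (Base.mk ρ (τ, z))
  normalized : ∫⁻ p, ‖u p‖ₑ ^ 2 ∂(volBase ρ) = 1

/-! ### The microlocal lift -/

/-- The derivative of `s` along the one-parameter group `c`, acting by right translation. -/
def derivAlong {ρ : Γ →* SU2} (c : ℝ → SL(2, ℝ)) (s : Lift ρ → ℂ) (p : Lift ρ) : ℂ :=
  deriv (fun t : ℝ => s (rightMul ρ (c t) p)) 0

/-- The raising operator `E⁺ = (1/2) [[1, i], [i, -1]] = H + iV`. -/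
def raise {ρ : Γ →* SU2} (s : Lift ρ → ℂ) (p : Lift ρ) : ℂ :=
  derivAlong geo s p + Complex.I * derivAlong hyp s p

/-- The lowering operator `E⁻ = (1/2) [[1, -i], [-i, -1]] = H - iV`. -/
def lower {ρ : Γ →* SU2} (s : Lift ρ → ℂ) (p : Lift ρ) : ℂ :=
  derivAlong geo s p - Complex.I * derivAlong hyp s p

/-- `s_{2n}` for `n ≥ 0`: `s_0 = u ∘ π` and `s_{2n+2} = (ir + 1/2 + n)⁻¹ E⁺ s_{2n}`. -/
def ladderUp {ρ : Γ →* SU2} (r : ℝ) (u : Base ρ → ℂ) : ℕ → Lift ρ → ℂ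
  | 0 => fun p => u (proj ρ p)
  | n + 1 => fun p => (Complex.I * r + 1 / 2 + n)⁻¹ * raise (ladderUp r u n) p

/-- `s_{-2n}` for `n ≥ 0`: `s_0 = u ∘ π` and `s_{-2n-2} = (ir + 1/2 - (-n))⁻¹ E⁻ s_{-2n}`. -/
def ladderDown {ρ : Γ →* SU2} (r : ℝ) (u : Base ρ → ℂ) : ℕ → Lift ρ → ℂ
  | 0 => fun p => u (proj ρ p)
  | n + 1 => fun p => (Complex.I * r + 1 / 2 - (-(n : ℂ)))⁻¹ * lower (ladderDown r u n) p

/-- `s_{2n}` for `n ∈ ℤ`. -/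
def ladder {ρ : Γ →* SU2} (r : ℝ) (u : Base ρ → ℂ) (n : ℤ) : Lift ρ → ℂ :=
  if 0 ≤ n then ladderUp r u n.toNat else ladderDown r u (-n).toNat

/-- The spectral parameter `r ≥ 0` with `lam = r² + 1/4` (for `lam ≥ 1/4`). -/
def specParam (lam : ℝ) : ℝ := √(lam - 1 / 4)

/-- The microlocal lift
`s = (2N + 1)^{-1/2} ∑_{|n| ≤ N} s_{2n}`, `N = ⌈r^{1/2}⌉`, of a Maass form `u` with eigenvalue
`lam = r² + 1/4`. -/
def microlocalLift {ρ : Γ →* SU2} (lam : ℝ) (u : Base ρ → ℂ) (p : Lift ρ) : ℂ :=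
  ((√(2 * (⌈√(specParam lam)⌉₊ : ℝ) + 1) : ℝ) : ℂ)⁻¹ *
    ∑ n ∈ Finset.Icc (-(⌈√(specParam lam)⌉₊ : ℤ)) (⌈√(specParam lam)⌉₊ : ℤ),
      ladder (specParam lam) u n p

/-! ### Measures and weak-star convergence -/

/-- The measure `|f|² dv`. -/
def sqMeasure {α : Type*} [MeasurableSpace α] (f : α → ℂ) (v : Measure α) : Measure α :=
  v.withDensity (fun x => ‖f x‖ₑ ^ 2)

/-- Weak-star convergence of measures, tested on continuous functions with compact support (on a
compact space: on all continuous functions). -/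
def WeakStarTendsto {α : Type*} [TopologicalSpace α] [MeasurableSpace α]
    (ν : ℕ → Measure α) (μ : Measure α) : Prop :=
  ∀ f : α → ℝ, Continuous f → HasCompactSupport f →
    Tendsto (fun i => ∫ x, f x ∂(ν i)) atTop (𝓝 (∫ x, f x ∂μ))

end MicrolocalLift

end

open MicrolocalLift

/-!
The invariance of the limit comes from an identity in the principal series. With
`A_a(n, m) = ∫ a s_{2n} \bar s_{2m}` for a test function `a` upstairs on `SL(2, ℝ) × S³`,
integration by parts along `E⁺`, `E⁻` and the rotations `W` (`coef_opE`, `coef_opF`, `coef_opW`)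
has three consequences. The coefficients decay like `(1 + (n - m)²)⁻¹` (`one_add_sq_mul_coef`). They
vary by `O(1/r)` along the diagonals (`mul_coef_succ_sub`). And the leading terms, of size `r`, cancel
in `A_{E⁺a}(n, m + 1) + A_{E⁻a}(n, m - 1)`, which is therefore `O(N/r)` for indices of size `N`
(`coef_opE_add_coef_opF`). Since `2H = E⁺ + E⁻`, the sum of the coefficients of `Ha` over
`|n|, |m| ≤ N` is, up to boundary terms of bounded size, the sum of these quantities, hence
`O(1 + N²/r)`. Divided by `2N + 1`, with `N ∼ r^{1/2}`, it tends to zero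
(`IsTest.exists_norm_integral_lieD_mul_le`), so a weak limit annihilates the derivatives of test
functions along the geodesic flow and is invariant under it. If `a` is a function on `ℍ × S³`, only
diagonal coefficients survive and they are all close to `A_a(0, 0) = ∫ a |u|²`, which gives the
projection (`IsTest.exists_norm_integral_mul_sub_le`).

The group `Γ` need not be cocompact, so the constants must not depend on mass that may escape to
infinity. This is the reason for the weights `ω_R`, cut-offs of `‖g‖⁻⁶` that satisfy
`|E⁺ ω_R| ≤ C ω_{2R}`: the energies `∫ ω_R² |s_{2n}|²` grow by a factor `1 + O(1/r)` from `n` to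
`n + 1`, uniformly in `R`, so those with `|n| ≤ r` are bounded by the one of `u` (`exists_energy_le`).
The latter is bounded because the Poincaré series `∑ ‖γ g‖⁻¹²` of a discrete group is bounded
(`exists_tsum_norm_vec_le`) and `u` has mass one.

All analysis takes place in the vector space `Amb = ℂ × ℂ × ℂ²` containing `SL(2, ℝ) × S³`, where the
generators `H`, `V`, `W` of right translation are linear vector fields. The passage to the quotients
is by averaging over `Γ`: every compactly supported continuous function on an orbit space is an
average (`exists_avg_eq`), integrals of averages against `|u|² dv` unfold (`integral_avg_sqMeasure`),
and a measure on the orbit space is determined by the integrals of averages of smooth functions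
(`measure_ext_of_integral_avg`).
-/

noncomputable section

namespace MicrolocalLift

/-! ### Averaging over a properly discontinuous action -/

/-- `q : Y → Z` presents `Z` as the topological quotient of `Y` by the action of `Γ`. -/
structure IsOrbitMap (Γ : Type*) {Y Z : Type*} [Group Γ] [MulAction Γ Y] [TopologicalSpace Y]
    [TopologicalSpace Z] (q : Y → Z) : Prop where
  isOpenQuotientMap : IsOpenQuotientMap q
  eq_iff : ∀ x y, q x = q y ↔ ∃ γ : Γ, γ • x = y

/-- The function on the orbit space induced by `y ↦ ∑ γ, F (γ • y)`. -/
def avg (Γ : Type*) {Y Z : Type*} [SMul Γ Y] (q : Y → Z) (F : Y → ℝ) : Z → ℝ :=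
  Function.extend q (fun y => ∑' γ : Γ, F (γ • y)) 0

section Averaging

variable {Γ Y Z : Type*} [Group Γ] [MulAction Γ Y] [TopologicalSpace Y] [TopologicalSpace Z]
  {q : Y → Z}

lemma IsOrbitMap.smul_eq (hq : IsOrbitMap Γ q) (γ : Γ) (y : Y) : q (γ • y) = q y :=
  ((hq.eq_iff _ _).2 ⟨γ, rfl⟩).symm

lemma tsum_smul_smul {Γ Y M : Type*} [Group Γ] [MulAction Γ Y] [AddCommMonoid M] [TopologicalSpace M]
    (F : Y → M) (γ : Γ) (y : Y) : ∑' δ : Γ, F (δ • γ • y) = ∑' δ : Γ, F (δ • y) := by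
  simp_rw [smul_smul]
  exact (Equiv.mulRight γ).tsum_eq (fun δ => F (δ • y))

lemma avg_apply (hq : IsOrbitMap Γ q) (F : Y → ℝ) (y : Y) :
    avg Γ q F (q y) = ∑' γ : Γ, F (γ • y) := by
  refine Function.FactorsThrough.extend_apply ?_ _ _
  intro a b hab
  obtain ⟨γ, rfl⟩ := (hq.eq_iff _ _).1 hab
  exact (tsum_smul_smul F γ a).symm

lemma avg_smul (hq : IsOrbitMap Γ q) (c : ℝ) (F : Y → ℝ) :
    avg Γ q (c • F) = c • avg Γ q F := by
  funext z
  obtain ⟨y, rfl⟩ := hq.isOpenQuotientMap.surjective z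
  simp only [Pi.smul_apply, avg_apply hq, smul_eq_mul, tsum_mul_left]

lemma avg_nonneg (hq : IsOrbitMap Γ q) {F : Y → ℝ} (h : 0 ≤ F) : 0 ≤ avg Γ q F := by
  intro z
  obtain ⟨y, rfl⟩ := hq.isOpenQuotientMap.surjective z
  simp only [avg_apply hq, Pi.zero_apply]
  exact tsum_nonneg fun γ => h _

lemma avg_hasCompactSupport [T2Space Z] (hq : IsOrbitMap Γ q)
    {F : Y → ℝ} (hF : HasCompactSupport F) : HasCompactSupport (avg Γ q F) := by
  refine HasCompactSupport.intro (hF.isCompact.image hq.isOpenQuotientMap.continuous) ?_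
  intro z hz
  obtain ⟨y, rfl⟩ := hq.isOpenQuotientMap.surjective z
  rw [avg_apply hq]
  convert tsum_zero with γ
  by_contra h
  exact hz ⟨γ • y, subset_tsupport _ h, hq.smul_eq γ y⟩

/-- Compact sets of the orbit space are covered by compact sets upstairs. -/
lemma IsOrbitMap.exists_compact_subset_image [LocallyCompactSpace Y] (hq : IsOrbitMap Γ q)
    {L : Set Z} (hL : IsCompact L) : ∃ K : Set Y, IsCompact K ∧ L ⊆ q '' K := by
  choose s hs using hq.isOpenQuotientMap.surjective
  choose K hK hKn using fun z => exists_compact_mem_nhds (s z)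
  obtain ⟨t, -, ht⟩ := hL.elim_nhds_subcover (fun z => q '' K z) fun z _ => by
    have := hq.isOpenQuotientMap.isOpenMap.image_mem_nhds (hKn z)
    rwa [hs] at this
  refine ⟨⋃ z ∈ t, K z, t.isCompact_biUnion fun z _ => hK z, ht.trans ?_⟩
  rw [Set.image_iUnion₂]

variable [ProperlyDiscontinuousSMul Γ Y]

lemma exists_finset_smul_eq_zero {M : Type*} [Zero M] {F : Y → M} (hF : HasCompactSupport F)
    {L : Set Y} (hL : IsCompact L) : ∃ s : Finset Γ, ∀ y ∈ L, ∀ γ ∉ s, F (γ • y) = 0 := by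
  have hfin := ProperlyDiscontinuousSMul.finite_disjoint_inter_image (Γ := Γ) hL hF
  refine ⟨hfin.toFinset, fun y hy γ hγ => ?_⟩
  by_contra h
  exact hγ (hfin.mem_toFinset.2 ⟨γ • y, ⟨y, hy, rfl⟩, subset_tsupport _ h⟩)

lemma summable_smul {F : Y → ℝ} (hF : HasCompactSupport F) (y : Y) :
    Summable fun γ : Γ => F (γ • y) := by
  obtain ⟨s, hs⟩ := exists_finset_smul_eq_zero (Γ := Γ) hF (isCompact_singleton (x := y))
  exact summable_of_ne_finset_zero fun γ hγ => hs y rfl γ hγ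

lemma avg_sub (hq : IsOrbitMap Γ q) {F G : Y → ℝ} (hF : HasCompactSupport F)
    (hG : HasCompactSupport G) : avg Γ q (F - G) = avg Γ q F - avg Γ q G := by
  funext z
  obtain ⟨y, rfl⟩ := hq.isOpenQuotientMap.surjective z
  simp only [Pi.sub_apply, avg_apply hq]
  exact (summable_smul hF y).tsum_sub (summable_smul hG y)

lemma avg_add (hq : IsOrbitMap Γ q) {F G : Y → ℝ} (hF : HasCompactSupport F)
    (hG : HasCompactSupport G) : avg Γ q (F + G) = avg Γ q F + avg Γ q G := by
  funext z
  obtain ⟨y, rfl⟩ := hq.isOpenQuotientMap.surjective z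
  simp only [Pi.add_apply, avg_apply hq]
  exact (summable_smul hF y).tsum_add (summable_smul hG y)

lemma avg_mono (hq : IsOrbitMap Γ q) {F G : Y → ℝ} (hF : HasCompactSupport F)
    (hG : HasCompactSupport G) (h : F ≤ G) : avg Γ q F ≤ avg Γ q G := by
  intro z
  obtain ⟨y, rfl⟩ := hq.isOpenQuotientMap.surjective z
  simp only [avg_apply hq]
  exact (summable_smul hF y).tsum_le_tsum (fun γ => h _) (summable_smul hG y)

lemma continuous_tsum_smul [ContinuousConstSMul Γ Y] [LocallyCompactSpace Y] {F : Y → ℝ}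
    (hF : HasCompactSupport F) (hc : Continuous F) :
    Continuous fun y => ∑' γ : Γ, F (γ • y) := by
  rw [continuous_iff_continuousAt]
  intro y
  obtain ⟨L, hL, hLy⟩ := exists_compact_mem_nhds y
  obtain ⟨s, hs⟩ := exists_finset_smul_eq_zero (Γ := Γ) hF hL
  have h : (fun y => ∑ γ ∈ s, F (γ • y)) =ᶠ[𝓝 y] fun y => ∑' γ : Γ, F (γ • y) := by
    filter_upwards [hLy] with x hx
    exact (tsum_eq_sum fun γ hγ => hs x hx γ hγ).symm
  refine ContinuousAt.congr ?_ h
  fun_prop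

lemma avg_continuous [ContinuousConstSMul Γ Y] [LocallyCompactSpace Y] (hq : IsOrbitMap Γ q)
    {F : Y → ℝ} (hF : HasCompactSupport F) (hc : Continuous F) : Continuous (avg Γ q F) := by
  rw [← hq.isOpenQuotientMap.continuous_comp_iff]
  have : avg Γ q F ∘ q = fun y => ∑' γ : Γ, F (γ • y) := funext fun y => avg_apply hq F y
  rw [this]
  exact continuous_tsum_smul hF hc

/-- Every compactly supported continuous function on the orbit space is an average. -/
lemma exists_avg_eq [ContinuousConstSMul Γ Y] [LocallyCompactSpace Y] [T2Space Y]
    (hq : IsOrbitMap Γ q) {f : Z → ℝ} (hc : Continuous f) (hf : HasCompactSupport f) :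
    ∃ F : Y → ℝ, Continuous F ∧ HasCompactSupport F ∧ avg Γ q F = f := by
  obtain ⟨K, hK, hfK⟩ := hq.exists_compact_subset_image hf.isCompact
  obtain ⟨χ, hχ1, -, hχc, hχ⟩ := exists_continuous_one_zero_of_isCompact hK isClosed_empty
    (Set.disjoint_empty K)
  have hχ0 : ∀ y, 0 ≤ χ y := fun y => (hχ y).1
  set S : Y → ℝ := fun y => ∑' γ : Γ, χ (γ • y) with hS
  have hSc : Continuous S := continuous_tsum_smul hχc χ.continuous
  refine ⟨fun y => f (q y) * χ y / max (S y) 1, ?_, ?_, ?_⟩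
  · refine ((hc.comp hq.isOpenQuotientMap.continuous).mul χ.continuous).div
      (hSc.max continuous_const) fun y => ?_
    exact (lt_of_lt_of_le one_pos (le_max_right _ _)).ne'
  · refine hχc.mono fun y hy => ?_
    rw [Function.mem_support] at hy ⊢
    contrapose! hy
    simp [hy]
  · funext z
    obtain ⟨y, rfl⟩ := hq.isOpenQuotientMap.surjective z
    rw [avg_apply hq]
    have h1 : ∀ γ : Γ, S (γ • y) = S y := fun γ => tsum_smul_smul (fun y => χ y) γ y
    simp only [h1, hq.smul_eq, mul_div_right_comm, tsum_mul_left]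
    by_cases hy : f (q y) = 0
    · simp [hy]
    · obtain ⟨k, hk, hky⟩ := hfK (subset_tsupport _ hy)
      obtain ⟨γ, hγ⟩ := (hq.eq_iff _ _).1 hky.symm
      have hge : 1 ≤ S y := by
        have h2 := (summable_smul (Γ := Γ) hχc y).le_tsum γ fun δ _ => hχ0 _
        have h3 : χ (γ • y) = 1 := by rw [hγ]; exact hχ1 hk
        rw [h3] at h2
        exact h2
      rw [max_eq_left hge, div_mul_cancel₀ _ (by linarith)]

end Averaging

/-! ### Measures on an orbit space -/

section OrbitMeasure

variable {Γ Y Z : Type*} [Group Γ] [MulAction Γ Y] [TopologicalSpace Y] [TopologicalSpace Z]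
  {q : Y → Z} [ProperlyDiscontinuousSMul Γ Y] [ContinuousConstSMul Γ Y] [LocallyCompactSpace Y]
  [T2Space Z] [MeasurableSpace Z] [BorelSpace Z]

lemma integrable_avg (hq : IsOrbitMap Γ q) (μ : Measure Z) [IsFiniteMeasureOnCompacts μ]
    {F : Y → ℝ} (hc : Continuous F) (hF : HasCompactSupport F) : Integrable (avg Γ q F) μ :=
  (avg_continuous hq hF hc).integrable_of_hasCompactSupport (avg_hasCompactSupport hq hF)

variable [T2Space Y]

/-- The lift of a measure on the orbit space to an invariant measure upstairs. -/
lemma exists_measure_integral_eq_integral_avg [MeasurableSpace Y] [BorelSpace Y]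
    (hq : IsOrbitMap Γ q) (μ : Measure Z)
    [IsFiniteMeasureOnCompacts μ] :
    ∃ m : Measure Y, IsFiniteMeasureOnCompacts m ∧ ∀ F : Y → ℝ, Continuous F →
      HasCompactSupport F → ∫ y, F y ∂m = ∫ z, avg Γ q F z ∂μ := by
  let Λ₀ : CompactlySupportedContinuousMap Y ℝ →ₗ[ℝ] ℝ :=
    { toFun := fun F => ∫ z, avg Γ q F z ∂μ
      map_add' := fun F G => by
        have h : avg Γ q (⇑(F + G)) = avg Γ q F + avg Γ q G :=
          avg_add hq F.hasCompactSupport G.hasCompactSupport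
        rw [h]
        exact integral_add (integrable_avg hq μ F.continuous F.hasCompactSupport)
          (integrable_avg hq μ G.continuous G.hasCompactSupport)
      map_smul' := fun c F => by
        have h : avg Γ q (⇑(c • F)) = c • avg Γ q F := avg_smul hq c F
        rw [h]
        exact integral_smul c _ }
  let Λ : CompactlySupportedContinuousMap Y ℝ →ₚ[ℝ] ℝ := PositiveLinearMap.mk₀ Λ₀ fun F hF =>
    integral_nonneg (avg_nonneg hq hF)
  refine ⟨RealRMK.rieszMeasure Λ, inferInstance, fun F hc hF => ?_⟩
  exact RealRMK.integral_rieszMeasure Λ ⟨⟨F, hc⟩, hF⟩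

/-- Measures on the orbit space are determined by the integrals of averages of any class of
functions that is uniformly dense, with control of supports, in the compactly supported continuous
functions upstairs. -/
lemma measure_ext_of_integral_avg [SecondCountableTopology Z] [LocallyCompactSpace Z]
    (hq : IsOrbitMap Γ q) (μ ν : Measure Z) [IsFiniteMeasureOnCompacts μ]
    [IsFiniteMeasureOnCompacts ν] (D : (Y → ℝ) → Prop)
    (hD : ∀ F : Y → ℝ, Continuous F → HasCompactSupport F → ∀ ε > 0, ∃ G : Y → ℝ, D G ∧
      Continuous G ∧ (∀ y, |G y - F y| ≤ ε) ∧ Function.support G ⊆ Function.support F)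
    (h : ∀ G : Y → ℝ, D G → Continuous G → HasCompactSupport G →
      ∫ z, avg Γ q G z ∂μ = ∫ z, avg Γ q G z ∂ν) : μ = ν := by
  have : TopologicalSpace.PseudoMetrizableSpace Z := inferInstance
  have : IsLocallyFiniteMeasure μ := inferInstance
  have : IsLocallyFiniteMeasure ν := inferInstance
  have : μ.Regular := inferInstance
  have : ν.Regular := inferInstance
  refine Measure.ext_of_integral_eq_on_compactlySupported fun f => ?_
  obtain ⟨F, hFc, hF, hFf⟩ := exists_avg_eq hq f.continuous f.hasCompactSupport
  obtain ⟨χ, hχ1, -, hχc, hχ⟩ := exists_continuous_one_zero_of_isCompact hF.isCompact isClosed_empty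
    (Set.disjoint_empty _)
  have key : ∀ (m : Measure Z) [IsFiniteMeasureOnCompacts m] (ε : ℝ) (G : Y → ℝ), Continuous G →
      (∀ y, |G y - F y| ≤ ε) → Function.support G ⊆ Function.support F →
      |∫ z, avg Γ q G z ∂m - ∫ z, avg Γ q F z ∂m| ≤ ε * ∫ z, avg Γ q χ z ∂m := by
    intro m _ ε G hGc hGF hsupp
    have hG : HasCompactSupport G := hF.mono hsupp
    have hle : ∀ y, |G y - F y| ≤ ε * χ y := by
      intro y
      by_cases hy : F y = 0
      · have hy' : G y = 0 := by
          by_contra hne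
          exact hsupp hne hy
        rw [hy, hy', sub_zero, abs_zero]
        exact mul_nonneg ((abs_nonneg _).trans (hGF y)) (hχ y).1
      · rw [hχ1 (subset_tsupport _ hy), Pi.one_apply, mul_one]
        exact hGF y
    rw [← integral_sub (integrable_avg hq m hGc hG) (integrable_avg hq m hFc hF),
      ← integral_const_mul]
    have hχ' : HasCompactSupport (ε • (χ : Y → ℝ)) := hχc.smul_left
    have h1 := avg_mono hq (hG.sub hF) hχ' fun y => (abs_le.1 (hle y)).2
    have h2 := avg_mono hq (hF.sub hG) hχ' fun y => by
      have := (abs_le.1 (hle y)).1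
      simp only [Pi.sub_apply, Pi.smul_apply, smul_eq_mul]
      linarith
    rw [avg_sub hq hG hF, avg_smul hq] at h1
    rw [avg_sub hq hF hG, avg_smul hq] at h2
    refine (abs_integral_le_integral_abs).trans (integral_mono ?_ ?_ fun z => abs_le.2 ⟨?_, ?_⟩)
    · exact ((integrable_avg hq m hGc hG).sub (integrable_avg hq m hFc hF)).abs
    · exact (integrable_avg hq m χ.continuous hχc).const_mul ε
    · have := h2 z
      simp only [Pi.sub_apply, Pi.smul_apply, smul_eq_mul] at this
      linarith
    · exact h1 z
  change ∫ z, f.toContinuousMap z ∂μ = ∫ z, f.toContinuousMap z ∂ν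
  rw [← hFf]
  refine eq_of_forall_dist_le fun ε hε => ?_
  rw [Real.dist_eq]
  set a := ∫ z, avg Γ q χ z ∂μ with ha
  set b := ∫ z, avg Γ q χ z ∂ν with hb
  have ha0 : 0 ≤ a := integral_nonneg (avg_nonneg hq fun y => (hχ y).1)
  have hb0 : 0 ≤ b := integral_nonneg (avg_nonneg hq fun y => (hχ y).1)
  obtain ⟨G, hDG, hGc, hGF, hsupp⟩ := hD F hFc hF (ε / (a + b + 1)) (by positivity)
  have k1 := key μ _ G hGc hGF hsupp
  have k2 := key ν _ G hGc hGF hsupp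
  rw [h G hDG hGc (hF.mono hsupp)] at k1
  have k3 : ε / (a + b + 1) * a + ε / (a + b + 1) * b ≤ ε := by
    rw [← mul_add, div_mul_eq_mul_div, div_le_iff₀ (by positivity)]
    nlinarith
  rw [abs_sub_comm] at k1
  calc _ ≤ _ := abs_sub_le _ (∫ z, avg Γ q G z ∂ν) _
    _ ≤ _ := (add_le_add k1 k2).trans k3

end OrbitMeasure

section Unfolding

variable {Γ Y Z : Type*} [Group Γ] [MulAction Γ Y] [TopologicalSpace Y] [TopologicalSpace Z]
  {q : Y → Z} [ContinuousConstSMul Γ Y] [MeasurableSpace Y] [BorelSpace Y]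

/-- A free properly discontinuous action has a Borel set of representatives. -/
lemma exists_measurableSet_existsUnique_smul_mem
    [ProperlyDiscontinuousSMul Γ Y] [LocallyCompactSpace Y] [T2Space Y]
    [SecondCountableTopology Y] (hq : IsOrbitMap Γ q)
    (hfree : ∀ (γ : Γ) (y : Y), γ • y = y → γ = 1) :
    ∃ D : Set Y, MeasurableSet D ∧ ∀ y, ∃! γ : Γ, γ • y ∈ D := by
  choose V hV hVd using fun y : Y => ProperlyDiscontinuousSMul.exists_nhds_image_smul_eq_self Γ y
  obtain ⟨t, htc, ht⟩ := TopologicalSpace.countable_cover_nhds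
    (f := fun y => interior (V y)) (fun y => interior_mem_nhds.2 (hV y))
  have hinj : ∀ y (γ : Γ) (a : Y), a ∈ interior (V y) → γ • a ∈ interior (V y) → γ = 1 :=
    fun y γ a ha hγa => hfree γ y (hVd y γ ⟨γ • a, ⟨a, interior_subset ha, rfl⟩,
      interior_subset hγa⟩)
  rcases isEmpty_or_nonempty Y with hY | ⟨⟨y₀⟩⟩
  · exact ⟨∅, MeasurableSet.empty, fun y => (hY.false y).elim⟩
  have htne : t.Nonempty := by
    by_contra hne
    rw [Set.not_nonempty_iff_eq_empty] at hne
    have : y₀ ∈ (⋃ y ∈ t, interior (V y)) := ht ▸ Set.mem_univ y₀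
    simp [hne] at this
  obtain ⟨e, he⟩ := htc.exists_eq_range htne
  let U : ℕ → Set Y := fun n => interior (V (e n))
  have hUo : ∀ n, IsOpen (U n) := fun n => isOpen_interior
  have hcov : ∀ y, ∃ n, y ∈ U n := by
    intro y
    have : y ∈ (⋃ y ∈ t, interior (V y)) := ht ▸ Set.mem_univ y
    rw [he, Set.biUnion_range] at this
    exact Set.mem_iUnion.1 this
  let W : ℕ → Set Y := fun n => q ⁻¹' (q '' U n)
  have hWo : ∀ n, IsOpen (W n) := fun n =>
    (hq.isOpenQuotientMap.isOpenMap _ (hUo n)).preimage hq.isOpenQuotientMap.continuous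
  have hWs : ∀ n (γ : Γ) y, γ • y ∈ W n ↔ y ∈ W n := fun n γ y => by
    change q (γ • y) ∈ q '' U n ↔ q y ∈ q '' U n
    rw [hq.smul_eq]
  refine ⟨⋃ n, U n \ ⋃ m < n, W m, ?_, fun y => ?_⟩
  · exact MeasurableSet.iUnion fun n => (hUo n).measurableSet.diff
      (MeasurableSet.iUnion fun m => MeasurableSet.iUnion fun _ => (hWo m).measurableSet)
  classical
  have hex : ∃ n, y ∈ W n := by
    obtain ⟨n, hn⟩ := hcov y
    exact ⟨n, y, hn, rfl⟩
  have hmem : ∀ γ : Γ, γ • y ∈ (⋃ n, U n \ ⋃ m < n, W m) ↔ γ • y ∈ U (Nat.find hex) := by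
    intro γ
    simp only [Set.mem_iUnion, Set.mem_sdiff, not_exists, hWs]
    constructor
    · rintro ⟨n, hn, hmn⟩
      have hyn : y ∈ W n := (hWs n γ y).1 ⟨_, hn, rfl⟩
      have : n = Nat.find hex := by
        refine le_antisymm ?_ (Nat.find_min' hex hyn)
        by_contra hlt
        exact hmn _ (not_le.1 hlt) (Nat.find_spec hex)
      rwa [← this]
    · intro hγ
      exact ⟨_, hγ, fun m hm hym => Nat.find_min hex hm hym⟩
  simp only [hmem]
  obtain ⟨x, hx, hxy⟩ := Nat.find_spec hex
  obtain ⟨γ, hγ⟩ := (hq.eq_iff _ _).1 hxy.symm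
  refine ⟨γ, by simpa only [hγ] using hx, fun δ hδ => ?_⟩
  have h1 := hinj (e (Nat.find hex)) (δ * γ⁻¹) (γ • y) (by rw [hγ]; exact hx)
    (by rw [smul_smul, inv_mul_cancel_right]; exact hδ)
  exact mul_inv_eq_one.1 h1

variable [MeasurableSpace Z] [BorelSpace Z] [Countable Γ]

/-- The quotient measure is the image of the restriction to a fundamental domain. -/
lemma quotientMeasure_eq_map_restrict (hq : IsOrbitMap Γ q)
    (hfree : ∀ (γ : Γ) (y : Y), γ • y = y → γ = 1) (ν : Measure Y) [SMulInvariantMeasure Γ Y ν]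
    {D : Set Y} (hDm : MeasurableSet D) (hD : ∀ y, ∃! γ : Γ, γ • y ∈ D) :
    quotientMeasure ν q = (ν.restrict D).map q := by
  have hqm : Measurable q := hq.isOpenQuotientMap.continuous.measurable
  refine le_antisymm (iSup₂_le fun B hB => ?_) (le_iSup₂_of_le D ⟨hDm, ?_⟩ le_rfl)
  · refine Measure.le_iff.2 fun A hA => ?_
    rw [Measure.map_apply hqm hA, Measure.map_apply hqm hA, Measure.restrict_apply (hqm hA),
      Measure.restrict_apply (hqm hA), Set.inter_comm, Set.inter_comm _ D,
      ← Measure.restrict_apply hB.1, ← Measure.restrict_apply hDm]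
    have hinv : SMulInvariantMeasure Γ Y (ν.restrict (q ⁻¹' A)) := by
      refine ⟨fun γ s hs => ?_⟩
      have hms : MeasurableSet ((fun x => γ • x) ⁻¹' s) :=
        (continuous_const_smul γ).measurable hs
      rw [Measure.restrict_apply hms, Measure.restrict_apply hs,
        ← measure_preimage_smul_of_nullMeasurableSet (s := s ∩ q ⁻¹' A) (μ := ν)
          (hs.inter (hqm hA)).nullMeasurableSet γ]
      congr 1
      ext y
      simp only [Set.mem_inter_iff, Set.mem_preimage, hq.smul_eq]
    have hfd : IsFundamentalDomain Γ D (ν.restrict (q ⁻¹' A)) :=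
      IsFundamentalDomain.mk' hDm.nullMeasurableSet hD
    refine hfd.measure_le_of_pairwise_disjoint hB.1.nullMeasurableSet fun γ δ hγδ => ?_
    refine Disjoint.aedisjoint (Set.disjoint_left.2 ?_)
    rintro _ ⟨⟨a, ha, rfl⟩, -⟩ ⟨⟨b, hb, hab⟩, -⟩
    simp only at hab
    have h1 : q b = q a := by rw [← hq.smul_eq δ b, hab, hq.smul_eq]
    have h2 : b = a := hB.2 hb ha h1
    rw [h2, eq_comm, ← inv_smul_eq_iff, smul_smul] at hab
    exact hγδ (inv_mul_eq_one.1 (hfree _ _ hab)).symm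
  · intro a ha b hb hab
    obtain ⟨γ, rfl⟩ := (hq.eq_iff _ _).1 hab
    have := (hD a).unique (y₁ := 1) (y₂ := γ) (by simpa using ha) hb
    rw [← this, one_smul]

variable [ProperlyDiscontinuousSMul Γ Y] [LocallyCompactSpace Y] [T2Space Y]
  [SecondCountableTopology Y]

/-- Unfolding: the integral of an average over the orbit space is the integral upstairs. -/
lemma lintegral_quotientMeasure (hq : IsOrbitMap Γ q)
    (hfree : ∀ (γ : Γ) (y : Y), γ • y = y → γ = 1) (ν : Measure Y) [SMulInvariantMeasure Γ Y ν]
    {f : Y → ENNReal} (hf : Measurable f) {g : Z → ENNReal} (hg : Measurable g)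
    (hfg : ∀ y, g (q y) = ∑' γ : Γ, f (γ • y)) :
    ∫⁻ z, g z ∂(quotientMeasure ν q) = ∫⁻ y, f y ∂ν := by
  obtain ⟨D, hDm, hD⟩ := exists_measurableSet_existsUnique_smul_mem hq hfree
  have hqm : Measurable q := hq.isOpenQuotientMap.continuous.measurable
  have hfd : IsFundamentalDomain Γ D ν := IsFundamentalDomain.mk' hDm.nullMeasurableSet hD
  rw [quotientMeasure_eq_map_restrict hq hfree ν hDm hD, lintegral_map hg hqm,
    hfd.lintegral_eq_tsum'', ← lintegral_tsum]
  · simp only [hfg]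
  · intro γ
    exact (hf.comp (continuous_const_smul γ).measurable).aemeasurable

/-- Unfolding for the measure `|u|² dv` on the orbit space, against compactly supported continuous
functions. -/
lemma integral_avg_sqMeasure [T2Space Z] (hq : IsOrbitMap Γ q)
    (hfree : ∀ (γ : Γ) (y : Y), γ • y = y → γ = 1) (ν : Measure Y) [SMulInvariantMeasure Γ Y ν]
    [IsFiniteMeasureOnCompacts ν] {u : Z → ℂ} (hu : Continuous fun y => u (q y)) {F : Y → ℝ}
    (hc : Continuous F) (hF : HasCompactSupport F) :
    ∫ z, avg Γ q F z ∂(sqMeasure u (quotientMeasure ν q)) = ∫ y, F y * ‖u (q y)‖ ^ 2 ∂ν := by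
  have huc : Continuous u := hq.isOpenQuotientMap.continuous_comp_iff.1 hu
  have hum : Measurable fun z => ‖u z‖ₑ ^ 2 := huc.measurable.enorm.pow_const 2
  have hqm : Measurable q := hq.isOpenQuotientMap.continuous.measurable
  -- the case of nonnegative functions, in terms of the lower Lebesgue integral
  have key : ∀ G : Y → ℝ, Continuous G → HasCompactSupport G → 0 ≤ G →
      ∫⁻ z, ENNReal.ofReal (avg Γ q G z) ∂(sqMeasure u (quotientMeasure ν q)) =
        ENNReal.ofReal (∫ y, G y * ‖u (q y)‖ ^ 2 ∂ν) := by
    intro G hGc hG hG0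
    have hint : Integrable (fun y => G y * ‖u (q y)‖ ^ 2) ν :=
      (hGc.mul (hu.norm.pow 2)).integrable_of_hasCompactSupport hG.mul_right
    rw [ofReal_integral_eq_lintegral_ofReal hint
      (ae_of_all _ fun y => mul_nonneg (hG0 y) (sq_nonneg _)), sqMeasure,
      lintegral_withDensity_eq_lintegral_mul _ hum
        (avg_continuous hq hG hGc).measurable.ennreal_ofReal]
    refine lintegral_quotientMeasure hq hfree ν ?_ ?_ fun y => ?_
    · exact (hGc.mul (hu.norm.pow 2)).measurable.ennreal_ofReal
    · exact hum.mul (avg_continuous hq hG hGc).measurable.ennreal_ofReal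
    · simp only [Pi.mul_apply, hq.smul_eq]
      rw [avg_apply hq, ENNReal.ofReal_tsum_of_nonneg (fun γ => hG0 _) (summable_smul hG y),
        ← ENNReal.tsum_mul_left]
      refine tsum_congr fun γ => ?_
      rw [ENNReal.ofReal_mul (hG0 _), mul_comm, ENNReal.ofReal_pow (norm_nonneg _), ofReal_norm]
  have hintZ : ∀ G : Y → ℝ, Continuous G → HasCompactSupport G → 0 ≤ G →
      Integrable (avg Γ q G) (sqMeasure u (quotientMeasure ν q)) := by
    intro G hGc hG hG0
    refine ⟨(avg_continuous hq hG hGc).aestronglyMeasurable, ?_⟩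
    rw [hasFiniteIntegral_iff_ofReal (ae_of_all _ (avg_nonneg hq hG0)), key G hGc hG hG0]
    exact ENNReal.ofReal_lt_top
  have hval : ∀ G : Y → ℝ, Continuous G → HasCompactSupport G → 0 ≤ G →
      ∫ z, avg Γ q G z ∂(sqMeasure u (quotientMeasure ν q)) = ∫ y, G y * ‖u (q y)‖ ^ 2 ∂ν := by
    intro G hGc hG hG0
    rw [integral_eq_lintegral_of_nonneg_ae (ae_of_all _ (avg_nonneg hq hG0))
      (avg_continuous hq hG hGc).aestronglyMeasurable, key G hGc hG hG0, ENNReal.toReal_ofReal]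
    exact integral_nonneg fun y => mul_nonneg (hG0 y) (sq_nonneg _)
  set P : Y → ℝ := fun y => max (F y) 0 with hP
  set N : Y → ℝ := fun y => max (-F y) 0 with hN
  have hPc : Continuous P := hc.max continuous_const
  have hNc : Continuous N := hc.neg.max continuous_const
  have hPs : HasCompactSupport P := hF.mono fun y hy hy' => hy (by simp [hP, hy'])
  have hNs : HasCompactSupport N := hF.mono fun y hy hy' => hy (by simp [hN, hy'])
  have hP0 : 0 ≤ P := fun y => le_max_right _ _
  have hN0 : 0 ≤ N := fun y => le_max_right _ _
  have hFPN : F = P - N := by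
    funext y
    simp only [hP, hN, Pi.sub_apply]
    rcases le_total (F y) 0 with h | h
    · rw [max_eq_right h, max_eq_left (by linarith)]; ring
    · rw [max_eq_left h, max_eq_right (by linarith)]; ring
  rw [hFPN, avg_sub hq hPs hNs]
  simp only [Pi.sub_apply, sub_mul]
  rw [integral_sub (hintZ P hPc hPs hP0) (hintZ N hNc hNs hN0), hval P hPc hPs hP0,
    hval N hNc hNs hN0, integral_sub]
  · exact (hPc.mul (hu.norm.pow 2)).integrable_of_hasCompactSupport hPs.mul_right
  · exact (hNc.mul (hu.norm.pow 2)).integrable_of_hasCompactSupport hNs.mul_right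

end Unfolding

/-! ### The Haar measure of `SL(2, ℝ)` -/

lemma matrix_fin_two_congr {R : Type*} {a b c d a' b' c' d' : R} (ha : a = a') (hb : b = b')
    (hc : c = c') (hd : d = d') : !![a, b; c, d] = !![a', b'; c', d'] := by
  rw [ha, hb, hc, hd]

lemma coe_rot (t : ℝ) : (rot t : Matrix (Fin 2) (Fin 2) ℝ) =
    !![Real.cos t, -Real.sin t; Real.sin t, Real.cos t] := rfl

lemma coe_geo (t : ℝ) : (geo t : Matrix (Fin 2) (Fin 2) ℝ) =
    !![Real.exp (t / 2), 0; 0, Real.exp (-(t / 2))] := rfl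

lemma coe_hyp (t : ℝ) : (hyp t : Matrix (Fin 2) (Fin 2) ℝ) =
    !![Real.cosh (t / 2), Real.sinh (t / 2); Real.sinh (t / 2), Real.cosh (t / 2)] := rfl

lemma rot_mul_rot (s t : ℝ) : rot s * rot t = rot (s + t) := by
  apply Subtype.ext
  rw [Matrix.SpecialLinearGroup.coe_mul]
  simp only [coe_rot, Matrix.mul_fin_two, Real.cos_add, Real.sin_add]
  refine matrix_fin_two_congr ?_ ?_ ?_ ?_ <;> ring

lemma geo_mul_geo (s t : ℝ) : geo s * geo t = geo (s + t) := by
  apply Subtype.ext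
  rw [Matrix.SpecialLinearGroup.coe_mul]
  simp only [coe_geo, Matrix.mul_fin_two, add_div, neg_add, Real.exp_add]
  refine matrix_fin_two_congr ?_ ?_ ?_ ?_ <;> ring

lemma hyp_mul_hyp (s t : ℝ) : hyp s * hyp t = hyp (s + t) := by
  apply Subtype.ext
  rw [Matrix.SpecialLinearGroup.coe_mul]
  simp only [coe_hyp, Matrix.mul_fin_two, add_div, Real.cosh_add, Real.sinh_add]
  refine matrix_fin_two_congr ?_ ?_ ?_ ?_ <;> ring

@[simp] lemma rot_zero : rot 0 = 1 := by
  ext i j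
  fin_cases i <;> fin_cases j <;> simp [rot]

@[simp] lemma geo_zero : geo 0 = 1 := by
  ext i j
  fin_cases i <;> fin_cases j <;> simp [geo]

@[simp] lemma hyp_zero : hyp 0 = 1 := by
  ext i j
  fin_cases i <;> fin_cases j <;> simp [hyp]

lemma rot_add_two_pi (t : ℝ) : rot (t + 2 * Real.pi) = rot t := by
  ext i j
  fin_cases i <;> fin_cases j <;> simp [rot]

lemma rot_smul_I (t : ℝ) : rot t • I = I := by
  ext
  rw [coe_specialLinearGroup_apply, div_eq_iff (mod_cast denom_ne_zero (rot t) I)]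
  simp only [rot, Matrix.SpecialLinearGroup.coe_mk, Matrix.of_apply, Matrix.cons_val', coe_I,
    Matrix.cons_val_zero, Matrix.cons_val_one, Matrix.cons_val_fin_one, Algebra.algebraMap_self,
    RingHom.id_apply, Complex.ofReal_neg]
  linear_combination (-(Real.sin t : ℂ)) * Complex.I_sq

lemma exists_eq_rot_of_smul_I {g : SL(2, ℝ)} (h : g • I = I) : ∃ t, g = rot t := by
  have h1 : ((g • I : ℍ) : ℂ) = Complex.I := by rw [h]; rfl
  rw [coe_specialLinearGroup_apply, div_eq_iff (mod_cast denom_ne_zero g I)] at h1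
  simp only [Algebra.algebraMap_self, RingHom.id_apply, coe_I] at h1
  have hre := congrArg Complex.re h1
  have him := congrArg Complex.im h1
  simp at hre him
  have hdet := g.det_coe
  rw [Matrix.det_fin_two] at hdet
  rw [hre, him] at hdet
  set z : ℂ := ⟨g 1 1, g 1 0⟩ with hz
  have hn : ‖z‖ = 1 := by
    have : ‖z‖ ^ 2 = 1 := by
      rw [Complex.sq_norm, Complex.normSq_mk]
      linarith
    nlinarith [norm_nonneg z]
  have hz0 : z ≠ 0 := by
    intro h0
    rw [h0, norm_zero] at hn
    exact zero_ne_one hn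
  have hc : Real.cos z.arg = g 1 1 := by rw [Complex.cos_arg hz0, hn, div_one]
  have hs : Real.sin z.arg = g 1 0 := by rw [Complex.sin_arg, hn, div_one]
  refine ⟨z.arg, ?_⟩
  ext i j
  fin_cases i <;> fin_cases j <;> simp [coe_rot, hc, hs, hre, him]

/-- Conjugation by a quarter turn inverts the geodesic flow. -/
lemma rot_mul_geo_mul_rot (t : ℝ) :
    rot (Real.pi / 2) * geo t * rot (-(Real.pi / 2)) = geo (-t) := by
  apply Subtype.ext
  rw [Matrix.SpecialLinearGroup.coe_mul, Matrix.SpecialLinearGroup.coe_mul]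
  simp [coe_rot, coe_geo, neg_div]

lemma hyp_eq_conj_geo (t : ℝ) :
    rot (Real.pi / 4) * geo t * rot (-(Real.pi / 4)) = hyp t := by
  have h2 : √2 * √2 = 2 := Real.mul_self_sqrt (by norm_num)
  apply Subtype.ext
  rw [Matrix.SpecialLinearGroup.coe_mul, Matrix.SpecialLinearGroup.coe_mul]
  simp only [coe_rot, coe_geo, coe_hyp, Matrix.mul_fin_two, Real.cosh_eq, Real.sinh_eq,
    Real.cos_neg, Real.sin_neg, Real.cos_pi_div_four, Real.sin_pi_div_four]
  refine matrix_fin_two_congr ?_ ?_ ?_ ?_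
  · linear_combination (Real.exp (t / 2) + Real.exp (-(t / 2))) * h2 / 4
  · linear_combination (Real.exp (t / 2) - Real.exp (-(t / 2))) * h2 / 4
  · linear_combination (Real.exp (t / 2) - Real.exp (-(t / 2))) * h2 / 4
  · linear_combination (Real.exp (t / 2) + Real.exp (-(t / 2))) * h2 / 4

lemma continuous_rot : Continuous rot := by
  refine continuous_induced_rng.2 ?_
  refine continuous_matrix fun i j => ?_
  fin_cases i <;> fin_cases j <;> simp <;> fun_prop

lemma continuous_geo : Continuous geo := by
  refine continuous_induced_rng.2 ?_
  refine continuous_matrix fun i j => ?_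
  fin_cases i <;> fin_cases j <;> simp <;> fun_prop

lemma continuous_hyp : Continuous hyp := by
  refine continuous_induced_rng.2 ?_
  refine continuous_matrix fun i j => ?_
  fin_cases i <;> fin_cases j <;> simp <;> fun_prop

instance : SecondCountableTopology SL(2, ℝ) :=
  have : SecondCountableTopology (Matrix (Fin 2) (Fin 2) ℝ) :=
    inferInstanceAs (SecondCountableTopology (Fin 2 → Fin 2 → ℝ))
  Matrix.SpecialLinearGroup.isClosedEmbedding_val.isEmbedding.secondCountableTopology

instance : LocallyCompactSpace SL(2, ℝ) :=
  have : LocallyCompactSpace (Matrix (Fin 2) (Fin 2) ℝ) :=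
    inferInstanceAs (LocallyCompactSpace (Fin 2 → Fin 2 → ℝ))
  Matrix.SpecialLinearGroup.isClosedEmbedding_val.locallyCompactSpace

instance : SMulInvariantMeasure SL(2, ℝ) ℍ volume :=
  ⟨fun g s hs => by
    exact SMulInvariantMeasure.measure_preimage_smul (μ := (volume : Measure ℍ))
      (g : GL (Fin 2) ℝ) hs⟩

lemma setLIntegral_Ioc_add_of_periodic {f : ℝ → ENNReal} {T : ℝ} (hT : 0 < T)
    (hf : Function.Periodic f T) (a : ℝ) :
    ∫⁻ x in Set.Ioc 0 T, f (x + a) = ∫⁻ x in Set.Ioc 0 T, f x := by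
  have h1 : ∫⁻ x in Set.Ioc 0 T, f (x + a) = ∫⁻ x in Set.Ioc a (a + T), f x := by
    have h := (measurePreserving_add_right volume a).setLIntegral_comp_emb
      (measurableEmbedding_addRight a) f (Set.Ioc 0 T)
    rw [h]
    congr 2
    rw [Set.image_add_const_Ioc, zero_add, add_comm]
  rw [h1]
  have h2 := (isAddFundamentalDomain_Ioc hT a).setLIntegral_eq (isAddFundamentalDomain_Ioc hT 0) f
    (fun g x => hf.map_vadd_zmultiples g x)
  rwa [zero_add] at h2

instance : SFinite haarSL2 := by
  unfold haarSL2
  infer_instance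

lemma continuous_iwasawa : Continuous fun p : ℍ × ℝ => toSL2R p.1 * rot p.2 :=
  (continuous_toSL2R.comp continuous_fst).mul (continuous_rot.comp continuous_snd)

lemma lintegral_haarSL2 {f : SL(2, ℝ) → ENNReal} (hf : Measurable f) :
    ∫⁻ g, f g ∂haarSL2 = ∫⁻ τ : ℍ, ENNReal.ofReal (1 / (2 * Real.pi)) *
      ∫⁻ θ in Set.Ioc 0 (2 * Real.pi), f (toSL2R τ * rot θ) := by
  have hm : Measurable fun p : ℍ × ℝ => toSL2R p.1 * rot p.2 := continuous_iwasawa.measurable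
  rw [haarSL2, lintegral_map hf hm,
    lintegral_prod (fun p : ℍ × ℝ => f (toSL2R p.1 * rot p.2)) (hf.comp hm).aemeasurable]
  simp only [lintegral_smul_measure, smul_eq_mul]

lemma periodic_mul_rot (f : SL(2, ℝ) → ENNReal) (g : SL(2, ℝ)) :
    Function.Periodic (fun θ => f (g * rot θ)) (2 * Real.pi) := fun θ => by
  simp only [rot_add_two_pi]

instance : haarSL2.IsMulLeftInvariant := by
  refine ⟨fun g => Measure.ext_of_lintegral _ fun f hf => ?_⟩
  rw [lintegral_map hf (measurable_const_mul g), lintegral_haarSL2 hf,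
    lintegral_haarSL2 (f := fun h => f (g * h)) (hf.comp (measurable_const_mul g))]
  -- the fibre integral of `f` only depends on the coset `h K`, that is on `h • i`
  have key : ∀ τ : ℍ, ∫⁻ θ in Set.Ioc 0 (2 * Real.pi), f (g * (toSL2R τ * rot θ)) =
      ∫⁻ θ in Set.Ioc 0 (2 * Real.pi), f (toSL2R (g • τ) * rot θ) := by
    intro τ
    obtain ⟨α, hα⟩ := exists_eq_rot_of_smul_I (g := (toSL2R (g • τ))⁻¹ * (g * toSL2R τ)) (by
      rw [mul_smul, mul_smul, toSL2R_smul_I, inv_smul_eq_iff, toSL2R_smul_I])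
    rw [inv_mul_eq_iff_eq_mul] at hα
    have h1 : ∀ θ, f (g * (toSL2R τ * rot θ)) = f (toSL2R (g • τ) * rot (θ + α)) := fun θ => by
      rw [← mul_assoc, hα, mul_assoc, rot_mul_rot, add_comm]
    simp only [h1]
    exact setLIntegral_Ioc_add_of_periodic Real.two_pi_pos (periodic_mul_rot f _) α
  simp only [key]
  exact (measurePreserving_smul g (volume : Measure ℍ)).lintegral_comp_emb
    (measurableEmbedding_const_smul g) (fun τ => ENNReal.ofReal (1 / (2 * Real.pi)) *
      ∫⁻ θ in Set.Ioc 0 (2 * Real.pi), f (toSL2R τ * rot θ))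

lemma lintegral_haarSL2_smul_I {f : ℍ → ENNReal} (hf : Measurable f) :
    ∫⁻ g, f (g • I) ∂haarSL2 = ∫⁻ τ : ℍ, f τ := by
  have hs : Measurable fun g : SL(2, ℝ) => g • I := by
    have : Continuous fun g : SL(2, ℝ) => g • I := by fun_prop
    exact this.measurable
  rw [lintegral_haarSL2 (f := fun g => f (g • I)) (hf.comp hs)]
  refine lintegral_congr fun τ => ?_
  simp only [mul_smul, rot_smul_I, toSL2R_smul_I, lintegral_const,
    Measure.restrict_apply MeasurableSet.univ, Set.univ_inter, Real.volume_Ioc, sub_zero]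
  rw [mul_comm, mul_assoc, ← ENNReal.ofReal_mul (by positivity),
    mul_one_div_cancel Real.two_pi_pos.ne', ENNReal.ofReal_one, mul_one]

/-- The image of the Haar measure under `g ↦ g • i` is the hyperbolic area. -/
lemma map_smul_I_haarSL2 : haarSL2.map (fun g : SL(2, ℝ) => g • I) = volume := by
  have hs : Measurable fun g : SL(2, ℝ) => g • I := by
    have : Continuous fun g : SL(2, ℝ) => g • I := by fun_prop
    exact this.measurable
  refine Measure.ext_of_lintegral _ fun f hf => ?_
  rw [lintegral_map hf hs, lintegral_haarSL2_smul_I hf]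

instance : IsFiniteMeasureOnCompacts haarSL2 := by
  refine ⟨fun K hK => ?_⟩
  have hs : Continuous fun g : SL(2, ℝ) => g • I := by fun_prop
  have hK' := hK.image hs
  calc haarSL2 K ≤ haarSL2 ((fun g : SL(2, ℝ) => g • I) ⁻¹' ((fun g => g • I) '' K)) :=
        measure_mono (Set.subset_preimage_image _ _)
    _ = volume ((fun g : SL(2, ℝ) => g • I) '' K) := by
        rw [← map_smul_I_haarSL2, Measure.map_apply hs.measurable hK'.measurableSet]
    _ < ⊤ := hK'.measure_lt_top

instance : (volume : Measure ℍ).IsOpenPosMeasure := by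
  refine ⟨fun U hU ⟨τ, hτ⟩ h0 => ?_⟩
  rw [volume_eq_lintegral] at h0
  have hV : IsOpen ((↑) '' U : Set ℂ) := isOpenEmbedding_coe.isOpenMap U hU
  rw [setLIntegral_eq_zero_iff hV.measurableSet (by fun_prop)] at h0
  have h1 : (volume : Measure ℂ) ((↑) '' U) = 0 := by
    refine measure_mono_null (fun z hz => ?_) h0
    obtain ⟨σ, hσ, rfl⟩ := hz
    intro h2
    have := h2 ⟨σ, hσ, rfl⟩
    simp [σ.im_pos.ne'] at this
  exact hV.measure_ne_zero volume ⟨τ, τ, hτ, rfl⟩ h1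

instance : haarSL2.IsHaarMeasure := by
  obtain ⟨K, hK, hK1⟩ := exists_compact_mem_nhds I
  refine Measure.isHaarMeasure_of_isCompact_nonempty_interior haarSL2
    ((fun g : SL(2, ℝ) => g • I) ⁻¹' K) (isProperMap_smul_I.isCompact_preimage hK) ?_ ?_ ?_
  · refine ⟨1, mem_interior_iff_mem_nhds.2 ?_⟩
    have hs : Continuous fun g : SL(2, ℝ) => g • I := by fun_prop
    refine hs.continuousAt.preimage_mem_nhds ?_
    rwa [one_smul]
  · have hs : Continuous fun g : SL(2, ℝ) => g • I := by fun_prop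
    rw [← Measure.map_apply hs.measurable hK.measurableSet, map_smul_I_haarSL2]
    exact (Measure.measure_pos_of_mem_nhds volume hK1).ne'
  · exact (isProperMap_smul_I.isCompact_preimage hK).measure_lt_top.ne

lemma map_mul_rot_haarSL2 (t : ℝ) : haarSL2.map (fun g => g * rot t) = haarSL2 := by
  refine Measure.ext_of_lintegral _ fun f hf => ?_
  rw [lintegral_map hf (measurable_mul_const _), lintegral_haarSL2 hf,
    lintegral_haarSL2 (f := fun h => f (h * rot t)) (hf.comp (measurable_mul_const _))]
  simp only [mul_assoc, rot_mul_rot]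
  refine lintegral_congr fun τ => ?_
  rw [setLIntegral_Ioc_add_of_periodic Real.two_pi_pos (periodic_mul_rot f (toSL2R τ)) t]

open Measure in
lemma modularCharacter_rot (t : ℝ) : modularCharacter (rot t) = 1 := by
  have h1 := map_right_mul_eq_modularCharacterFun_smul haarSL2 (rot t)
  rw [map_mul_rot_haarSL2] at h1
  obtain ⟨K, hK, hK1⟩ := exists_compact_mem_nhds (1 : SL(2, ℝ))
  have h2 := congrArg (fun m => m K) h1
  simp only [Measure.smul_apply] at h2
  have h3 : (modularCharacterFun (rot t) : ENNReal) * haarSL2 K = 1 * haarSL2 K := by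
    rw [one_mul]; exact h2.symm
  have h4 := (ENNReal.mul_left_inj (measure_pos_of_mem_nhds haarSL2 hK1).ne'
    hK.measure_lt_top.ne).1 h3
  exact_mod_cast h4

open Measure in
lemma modularCharacter_geo (t : ℝ) : modularCharacter (geo t) = 1 := by
  have h1 : modularCharacter (geo (-t)) = modularCharacter (geo t) := by
    rw [← rot_mul_geo_mul_rot, map_mul, map_mul, modularCharacter_rot, modularCharacter_rot]
    simp
  have h2 : modularCharacter (geo t) * modularCharacter (geo (-t)) = 1 := by
    rw [← map_mul, geo_mul_geo, add_neg_cancel, geo_zero, map_one]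
  rw [h1] at h2
  exact (pow_eq_one_iff_of_nonneg (zero_le) two_ne_zero).1 (by rw [sq]; exact h2)

open Measure in
lemma map_mul_eq_of_modularCharacter {h : SL(2, ℝ)} (hh : modularCharacter h = 1) :
    haarSL2.map (fun g => g * h) = haarSL2 := by
  have h1 := map_right_mul_eq_modularCharacterFun_smul haarSL2 h
  rw [h1, show modularCharacterFun h = 1 from hh, one_smul]

lemma map_mul_geo_haarSL2 (t : ℝ) : haarSL2.map (fun g => g * geo t) = haarSL2 :=
  map_mul_eq_of_modularCharacter (modularCharacter_geo t)

lemma map_mul_hyp_haarSL2 (t : ℝ) : haarSL2.map (fun g => g * hyp t) = haarSL2 := by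
  refine map_mul_eq_of_modularCharacter ?_
  rw [← hyp_eq_conj_geo, map_mul, map_mul, modularCharacter_rot, modularCharacter_rot,
    modularCharacter_geo]
  simp

/-! ### The invariant measure of the sphere -/

section Sphere

open scoped Pointwise

instance : IsFiniteMeasure volS3 := by
  unfold volS3
  infer_instance

instance : ContinuousConstSMul SU2 S3 := by
  refine ⟨fun A => continuous_induced_rng.2 ?_⟩
  have : Continuous fun z : S3 => WithLp.toLp 2 ((A : Matrix (Fin 2) (Fin 2) ℂ).mulVec z.1.ofLp) := by
    refine (PiLp.continuous_toLp 2 _).comp ?_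
    refine Continuous.matrix_mulVec continuous_const ?_
    exact (PiLp.continuous_ofLp 2 _).comp continuous_subtype_val
  exact this

/-- A special unitary matrix as a linear isometric equivalence of `ℂ²`. -/
def SU2.isometry (A : SU2) : EuclideanSpace ℂ (Fin 2) ≃ₗᵢ[ℝ] EuclideanSpace ℂ (Fin 2) :=
  LinearIsometryEquiv.mk
    { toFun := fun z => WithLp.toLp 2 ((A : Matrix (Fin 2) (Fin 2) ℂ).mulVec z.ofLp)
      invFun := fun z => WithLp.toLp 2 (((A⁻¹ : SU2) : Matrix (Fin 2) (Fin 2) ℂ).mulVec z.ofLp)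
      map_add' := fun x y => by
        rw [WithLp.ofLp_add, Matrix.mulVec_add, WithLp.toLp_add]
      map_smul' := fun c x => by
        rw [WithLp.ofLp_smul, Matrix.mulVec_smul, WithLp.toLp_smul, RingHom.id_apply]
      left_inv := fun x => by
        simp only [Matrix.mulVec_mulVec]
        rw [← Submonoid.coe_mul, inv_mul_cancel, Submonoid.coe_one, Matrix.one_mulVec]
      right_inv := fun x => by
        simp only [Matrix.mulVec_mulVec]
        rw [← Submonoid.coe_mul, mul_inv_cancel, Submonoid.coe_one, Matrix.one_mulVec] }
    (norm_SU2_mulVec A)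

instance : SMulInvariantMeasure SU2 S3 volS3 := by
  refine ⟨fun A s hs => ?_⟩
  have hm : MeasurableSet ((fun z : S3 => A • z) ⁻¹' s) := (continuous_const_smul A).measurable hs
  rw [volS3, Measure.toSphere_apply' _ hm, Measure.toSphere_apply' _ hs]
  congr 1
  have h := (LinearIsometryEquiv.measurePreserving (SU2.isometry A)).measure_preimage_emb
    (SU2.isometry A).toHomeomorph.measurableEmbedding
    (Set.Ioo (0 : ℝ) 1 • ((↑) '' s : Set (EuclideanSpace ℂ (Fin 2))))
  rw [← h]
  congr 1
  ext w
  simp only [Set.mem_smul, Set.mem_image, Set.mem_preimage, exists_exists_and_eq_and]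
  constructor
  · rintro ⟨r, hr, z, hz, rfl⟩
    exact ⟨r, hr, A • z, hz, ((SU2.isometry A).map_smul r _).symm⟩
  · rintro ⟨r, hr, z, hz, hw⟩
    refine ⟨r, hr, A⁻¹ • z, by rwa [smul_inv_smul], (SU2.isometry A).injective ?_⟩
    rw [← hw, map_smul]
    congr 1
    change ((A • A⁻¹ • z : S3) : EuclideanSpace ℂ (Fin 2)) = z
    rw [smul_inv_smul]

end Sphere

/-! ### The twisted actions on `ℍ × S³` and `SL(2, ℝ) × S³` -/

section TwistedAction

variable {Γ : Subgroup SL(2, ℝ)}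

/-- A copy of `X × S³` carrying the diagonal action `γ • (x, z) = (γ • x, ρ γ • z)` of `Γ`. -/
def Twist (_ρ : Γ →* SU2) (X : Type) : Type := X × S3

namespace Twist

variable (ρ : Γ →* SU2) (X : Type)

instance [TopologicalSpace X] : TopologicalSpace (Twist ρ X) :=
  inferInstanceAs (TopologicalSpace (X × S3))

instance [TopologicalSpace X] [T2Space X] : T2Space (Twist ρ X) :=
  inferInstanceAs (T2Space (X × S3))

instance [TopologicalSpace X] [LocallyCompactSpace X] : LocallyCompactSpace (Twist ρ X) :=
  inferInstanceAs (LocallyCompactSpace (X × S3))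

instance [TopologicalSpace X] [SecondCountableTopology X] : SecondCountableTopology (Twist ρ X) :=
  inferInstanceAs (SecondCountableTopology (X × S3))

instance [MeasurableSpace X] : MeasurableSpace (Twist ρ X) :=
  inferInstanceAs (MeasurableSpace (X × S3))

instance [TopologicalSpace X] [SecondCountableTopology X] [MeasurableSpace X] [BorelSpace X] :
    BorelSpace (Twist ρ X) :=
  inferInstanceAs (BorelSpace (X × S3))

instance [MulAction Γ X] : MulAction Γ (Twist ρ X) where
  smul γ p := (γ • p.1, ρ γ • p.2)
  one_smul p := Prod.ext (one_smul Γ p.1) (by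
    change ρ 1 • p.2 = p.2
    rw [map_one, one_smul])
  mul_smul γ δ p := Prod.ext (mul_smul γ δ p.1) (by
    change ρ (γ * δ) • p.2 = ρ γ • ρ δ • p.2
    rw [map_mul, mul_smul])

variable {ρ X}

instance [MulAction Γ X] [TopologicalSpace X] [ContinuousConstSMul Γ X] :
    ContinuousConstSMul Γ (Twist ρ X) := by
  refine ⟨fun γ => ?_⟩
  have : Continuous fun p : X × S3 => (γ • p.1, ρ γ • p.2) :=
    (continuous_fst.const_smul γ).prodMk (continuous_snd.const_smul (ρ γ))
  exact this

instance [MulAction Γ X] [TopologicalSpace X] [ProperlyDiscontinuousSMul Γ X] :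
    ProperlyDiscontinuousSMul Γ (Twist ρ X) := by
  refine ⟨fun {K L} hK hL => ?_⟩
  have hf : Continuous fun p : Twist ρ X => p.1 := (continuous_fst : Continuous (Prod.fst : X × S3 → X))
  refine (ProperlyDiscontinuousSMul.finite_disjoint_inter_image (Γ := Γ) (hK.image hf)
    (hL.image hf)).subset ?_
  rintro γ ⟨_, ⟨p, hp, rfl⟩, hp'⟩
  exact ⟨γ • p.1, ⟨p.1, ⟨p, hp, rfl⟩, rfl⟩, ⟨γ • p, hp', rfl⟩⟩

/-- The product of a measure on `X` with the invariant measure of the sphere. -/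
def measure (ρ : Γ →* SU2) [MeasurableSpace X] (μ : Measure X) : Measure (Twist ρ X) :=
  (μ.prod volS3 : Measure (X × S3))

instance [MulAction Γ X] [MeasurableSpace X] [MeasurableConstSMul Γ X] (μ : Measure X) [SFinite μ]
    [SMulInvariantMeasure Γ X μ] :
    SMulInvariantMeasure Γ (Twist ρ X) (measure ρ μ) := by
  refine ⟨fun γ s hs => ?_⟩
  exact ((measurePreserving_smul γ μ).prod
    (measurePreserving_smul (ρ γ) volS3)).measure_preimage hs.nullMeasurableSet

instance [TopologicalSpace X] [MeasurableSpace X] (μ : Measure X)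
    [SFinite μ] [IsFiniteMeasureOnCompacts μ] : IsFiniteMeasureOnCompacts (measure ρ μ) :=
  inferInstanceAs (IsFiniteMeasureOnCompacts (μ.prod volS3))

end Twist

section

variable {T : Type*} {G : Type*} [TopologicalSpace T] [Group G] [MulAction G T]

lemma isOrbitMap_quotientMk [ContinuousConstSMul G T] {s : Setoid T} (hs : s = MulAction.orbitRel G T) :
    IsOrbitMap G (Quotient.mk s) := by
  subst hs
  refine ⟨MulAction.isOpenQuotientMap_quotientMk, fun x y => ?_⟩
  rw [Quotient.eq, MulAction.orbitRel_apply, MulAction.mem_orbit_symm]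
  rfl

lemma t2Space_quotient [ContinuousConstSMul G T] {s : Setoid T} (hs : s = MulAction.orbitRel G T) [T2Space T]
    [LocallyCompactSpace T] [ProperlyDiscontinuousSMul G T] : T2Space (Quotient s) := by
  subst hs
  infer_instance

lemma IsOrbitMap.secondCountableTopology [SecondCountableTopology T] {Z : Type*}
    [TopologicalSpace Z] {q : T → Z} (hq : IsOrbitMap G q) : SecondCountableTopology Z :=
  hq.isOpenQuotientMap.isQuotientMap.secondCountableTopology hq.isOpenQuotientMap.isOpenMap

lemma IsOrbitMap.locallyCompactSpace [LocallyCompactSpace T] {Z : Type*}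
    [TopologicalSpace Z] [T2Space Z] {q : T → Z} (hq : IsOrbitMap G q) :
    LocallyCompactSpace Z := by
  have : WeaklyLocallyCompactSpace Z := by
    refine ⟨fun z => ?_⟩
    obtain ⟨y, rfl⟩ := hq.isOpenQuotientMap.surjective z
    obtain ⟨K, hK, hKy⟩ := exists_compact_mem_nhds y
    exact ⟨q '' K, hK.image hq.isOpenQuotientMap.continuous,
      hq.isOpenQuotientMap.isOpenMap.image_mem_nhds hKy⟩
  infer_instance

end

variable (ρ : Γ →* SU2)

lemma baseSetoid_eq_orbitRel :
    (baseSetoid ρ : Setoid (Twist ρ ℍ)) = MulAction.orbitRel Γ (Twist ρ ℍ) :=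
  Setoid.ext fun p q => MulAction.mem_orbit_symm (G := Γ) (α := Twist ρ ℍ) (a₁ := q) (a₂ := p)

lemma liftSetoid_eq_orbitRel :
    (liftSetoid ρ : Setoid (Twist ρ SL(2, ℝ))) = MulAction.orbitRel Γ (Twist ρ SL(2, ℝ)) :=
  Setoid.ext fun p q => MulAction.mem_orbit_symm (G := Γ) (α := Twist ρ SL(2, ℝ)) (a₁ := q) (a₂ := p)

instance : ContinuousConstSMul Γ ℍ := inferInstance

instance [DiscreteTopology Γ] : ProperlyDiscontinuousSMul Γ SL(2, ℝ) :=
  Subgroup.properlyDiscontinuousSMul_of_tendsto_cofinite Γ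
    (Subgroup.tendsto_coe_cofinite_of_discrete Γ ⟨inferInstance⟩)

lemma isOrbitMap_baseMk : IsOrbitMap Γ (Y := Twist ρ ℍ) (Base.mk ρ) :=
  isOrbitMap_quotientMk (T := Twist ρ ℍ) (baseSetoid_eq_orbitRel ρ)

lemma isOrbitMap_liftMk : IsOrbitMap Γ (Y := Twist ρ SL(2, ℝ)) (Lift.mk ρ) :=
  isOrbitMap_quotientMk (T := Twist ρ SL(2, ℝ)) (liftSetoid_eq_orbitRel ρ)

instance [DiscreteTopology Γ] : T2Space (Base ρ) :=
  t2Space_quotient (T := Twist ρ ℍ) (baseSetoid_eq_orbitRel ρ)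

instance [DiscreteTopology Γ] : T2Space (Lift ρ) :=
  t2Space_quotient (T := Twist ρ SL(2, ℝ)) (liftSetoid_eq_orbitRel ρ)

instance : SecondCountableTopology (Base ρ) := (isOrbitMap_baseMk ρ).secondCountableTopology

instance : SecondCountableTopology (Lift ρ) := (isOrbitMap_liftMk ρ).secondCountableTopology

instance [DiscreteTopology Γ] : LocallyCompactSpace (Base ρ) :=
  (isOrbitMap_baseMk ρ).locallyCompactSpace

instance [DiscreteTopology Γ] : LocallyCompactSpace (Lift ρ) :=
  (isOrbitMap_liftMk ρ).locallyCompactSpace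

lemma countable_of_discreteTopology (Γ : Subgroup SL(2, ℝ)) [DiscreteTopology Γ] : Countable Γ :=
  TopologicalSpace.separableSpace_iff_countable.1 inferInstance

instance : SMulInvariantMeasure Γ ℍ volume :=
  ⟨fun γ _ hs => measure_preimage_smul_of_nullMeasurableSet (μ := (volume : Measure ℍ))
    hs.nullMeasurableSet (γ : SL(2, ℝ))⟩

instance : SMulInvariantMeasure Γ SL(2, ℝ) haarSL2 :=
  ⟨fun γ s _ => measure_preimage_mul haarSL2 (γ : SL(2, ℝ)) s⟩

lemma lift_free (γ : Γ) (p : Twist ρ SL(2, ℝ)) (h : γ • p = p) : γ = 1 := by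
  have h1 : (γ : SL(2, ℝ)) * p.1 = p.1 := congrArg Prod.fst h
  exact Subtype.ext (mul_eq_right.1 h1)

lemma volBase_eq : volBase ρ =
    quotientMeasure (α := Twist ρ ℍ) (Twist.measure ρ volume) (Base.mk ρ) := rfl

lemma volLift_eq : volLift ρ =
    quotientMeasure (α := Twist ρ SL(2, ℝ)) (Twist.measure ρ haarSL2) (Lift.mk ρ) := rfl

end TwistedAction

/-! ### Calculus in the ambient space of `SL(2, ℝ) × S³` -/

/-- The vector space in which `SL(2, ℝ) × S³` is embedded by `emb`: a real matrix with rows `(a, b)`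
and `(c, d)` is encoded by the pair of complex numbers `(a + ib, c + id)`. -/
abbrev Amb : Type := ℂ × ℂ × EuclideanSpace ℂ (Fin 2)

/-- The determinant of the matrix encoded by a point of `Amb`. -/
def det (v : Amb) : ℝ := ((starRingEnd ℂ) v.1 * v.2.1).im

/-- The open set of the points of `Amb` with positive determinant and nonzero vector part. -/
def dom : Set Amb := {v | 0 < det v ∧ v.2.2 ≠ 0}

/-- The embedding of `SL(2, ℝ) × S³` in `Amb`. -/
def emb (p : SL(2, ℝ) × S3) : Amb :=
  (⟨p.1 0 0, p.1 0 1⟩, ⟨p.1 1 0, p.1 1 1⟩, p.2)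

lemma continuous_det : Continuous det := by
  unfold det
  fun_prop

lemma isOpen_dom : IsOpen dom :=
  (isOpen_lt continuous_const continuous_det).inter
    (isOpen_ne_fun (continuous_snd.comp continuous_snd) continuous_const)

lemma det_emb (p : SL(2, ℝ) × S3) : det (emb p) = 1 := by
  have h := p.1.det_coe
  rw [Matrix.det_fin_two] at h
  simp only [det, emb, Complex.mul_im, Complex.conj_re, Complex.conj_im]
  linarith

lemma emb_mem_dom (p : SL(2, ℝ) × S3) : emb p ∈ dom := by
  refine ⟨by rw [det_emb]; exact one_pos, ?_⟩
  have h : ‖(p.2 : EuclideanSpace ℂ (Fin 2))‖ = 1 := mem_sphere_zero_iff_norm.1 p.2.2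
  intro h0
  change (p.2 : EuclideanSpace ℂ (Fin 2)) = 0 at h0
  rw [h0, norm_zero] at h
  exact zero_ne_one h

/-- The homeomorphism between real `2 × 2` matrices and pairs of complex numbers. -/
def matrixHomeo : Matrix (Fin 2) (Fin 2) ℝ ≃ₜ ℂ × ℂ where
  toFun A := (⟨A 0 0, A 0 1⟩, ⟨A 1 0, A 1 1⟩)
  invFun v := !![v.1.re, v.1.im; v.2.re, v.2.im]
  left_inv A := by
    ext i j
    fin_cases i <;> fin_cases j <;> rfl
  right_inv v := rfl
  continuous_toFun := by
    have h : ∀ i j : Fin 2, Continuous fun A : Matrix (Fin 2) (Fin 2) ℝ => A i j :=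
      fun i j => continuous_id.matrix_elem i j
    have h2 : ∀ i : Fin 2, Continuous fun A : Matrix (Fin 2) (Fin 2) ℝ => (⟨A i 0, A i 1⟩ : ℂ) :=
      fun i => Complex.equivRealProdCLM.symm.continuous.comp ((h i 0).prodMk (h i 1))
    exact (h2 0).prodMk (h2 1)
  continuous_invFun := by
    refine continuous_matrix fun i j => ?_
    fin_cases i <;> fin_cases j <;> simp <;> fun_prop

lemma isClosedEmbedding_emb : IsClosedEmbedding emb := by
  have h1 : IsClosedEmbedding fun g : SL(2, ℝ) => matrixHomeo g :=
    matrixHomeo.isClosedEmbedding.comp Matrix.SpecialLinearGroup.isClosedEmbedding_val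
  have h2 : IsClosedEmbedding ((↑) : S3 → EuclideanSpace ℂ (Fin 2)) :=
    Metric.isClosed_sphere.isClosedEmbedding_subtypeVal
  exact (Homeomorph.prodAssoc ℂ ℂ (EuclideanSpace ℂ (Fin 2))).isClosedEmbedding.comp
    (h1.prodMap h2)

lemma continuous_emb : Continuous emb := isClosedEmbedding_emb.continuous

/-- The vector field on `Amb` generating right translation by `geo`. -/
def fieldH : Amb →L[ℝ] Amb :=
  ((1 / 2 : ℝ) • (Complex.conjCLE : ℂ →L[ℝ] ℂ).comp (ContinuousLinearMap.fst ℝ _ _)).prod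
    (((1 / 2 : ℝ) • (Complex.conjCLE : ℂ →L[ℝ] ℂ).comp
      ((ContinuousLinearMap.fst ℝ _ _).comp (ContinuousLinearMap.snd ℝ _ _))).prod 0)

/-- The vector field on `Amb` generating right translation by `hyp`. -/
def fieldV : Amb →L[ℝ] Amb :=
  ((Complex.I / 2) • (Complex.conjCLE : ℂ →L[ℝ] ℂ).comp (ContinuousLinearMap.fst ℝ _ _)).prod
    (((Complex.I / 2) • (Complex.conjCLE : ℂ →L[ℝ] ℂ).comp
      ((ContinuousLinearMap.fst ℝ _ _).comp (ContinuousLinearMap.snd ℝ _ _))).prod 0)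

/-- The vector field on `Amb` generating right translation by `t ↦ rot (t / 2)`. -/
def fieldW : Amb →L[ℝ] Amb :=
  ((-Complex.I / 2) • (ContinuousLinearMap.fst ℝ ℂ (ℂ × EuclideanSpace ℂ (Fin 2)))).prod
    (((-Complex.I / 2) • ((ContinuousLinearMap.fst ℝ ℂ (EuclideanSpace ℂ (Fin 2))).comp
      (ContinuousLinearMap.snd ℝ ℂ (ℂ × EuclideanSpace ℂ (Fin 2))))).prod 0)

lemma fieldH_apply (v : Amb) :
    fieldH v = ((starRingEnd ℂ) v.1 / 2, (starRingEnd ℂ) v.2.1 / 2, 0) := by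
  refine Prod.ext ?_ (Prod.ext ?_ rfl) <;> simp [fieldH] <;> ring

lemma fieldV_apply (v : Amb) : fieldV v =
    (Complex.I / 2 * (starRingEnd ℂ) v.1, Complex.I / 2 * (starRingEnd ℂ) v.2.1, 0) := by
  refine Prod.ext ?_ (Prod.ext ?_ rfl) <;> simp [fieldV]

lemma fieldW_apply (v : Amb) :
    fieldW v = (-Complex.I / 2 * v.1, -Complex.I / 2 * v.2.1, 0) := by
  refine Prod.ext ?_ (Prod.ext ?_ rfl) <;> simp [fieldW]

lemma fieldV_comp_fieldH : fieldV.comp fieldH - fieldH.comp fieldV = -fieldW := by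
  have h2 : (starRingEnd ℂ) 2 = 2 := map_ofNat _ 2
  refine ContinuousLinearMap.ext fun v => ?_
  simp only [sub_apply, ContinuousLinearMap.comp_apply, fieldH_apply,
    fieldV_apply, neg_apply, fieldW_apply]
  refine Prod.ext ?_ (Prod.ext ?_ ?_) <;> simp [h2] <;> ring

lemma fieldH_comp_fieldW : fieldH.comp fieldW - fieldW.comp fieldH = fieldV := by
  have h2 : (starRingEnd ℂ) 2 = 2 := map_ofNat _ 2
  refine ContinuousLinearMap.ext fun v => ?_
  simp only [sub_apply, ContinuousLinearMap.comp_apply, fieldH_apply,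
    fieldV_apply, fieldW_apply]
  refine Prod.ext ?_ (Prod.ext ?_ ?_) <;> simp [h2] <;> ring

lemma fieldV_comp_fieldW : fieldV.comp fieldW - fieldW.comp fieldV = -fieldH := by
  refine ContinuousLinearMap.ext fun v => ?_
  simp only [sub_apply, ContinuousLinearMap.comp_apply, fieldH_apply,
    fieldV_apply, neg_apply, fieldW_apply]
  refine Prod.ext ?_ (Prod.ext ?_ ?_)
  · simp only [Prod.fst_sub, map_mul, map_div₀, map_neg, Complex.conj_I, map_ofNat, Prod.fst_neg]
    linear_combination ((starRingEnd ℂ) v.1 / 2) * Complex.I_sq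
  · simp only [Prod.fst_sub, Prod.snd_sub, map_mul, map_div₀, map_neg, Complex.conj_I, map_ofNat,
      Prod.fst_neg, Prod.snd_neg]
    linear_combination ((starRingEnd ℂ) v.2.1 / 2) * Complex.I_sq
  · simp

/-- The derivative of `f` along the linear vector field `L`. -/
def lieD (L : Amb →L[ℝ] Amb) (f : Amb → ℂ) (v : Amb) : ℂ := fderiv ℝ f v (L v)

section lieD

variable {L : Amb →L[ℝ] Amb} {f g : Amb → ℂ} {v : Amb}

lemma differentiableAt_of_contDiffOn (hf : ContDiffOn ℝ ∞ f dom) (hv : v ∈ dom) :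
    DifferentiableAt ℝ f v :=
  ((hf.contDiffAt (isOpen_dom.mem_nhds hv)).differentiableAt (by simp))

lemma contDiffOn_lieD (L : Amb →L[ℝ] Amb) (hf : ContDiffOn ℝ ∞ f dom) :
    ContDiffOn ℝ ∞ (lieD L f) dom :=
  (hf.fderiv_of_isOpen isOpen_dom (by simp)).clm_apply L.contDiff.contDiffOn

lemma lieD_congr (L : Amb →L[ℝ] Amb) (h : Set.EqOn f g dom) : Set.EqOn (lieD L f) (lieD L g) dom := by
  intro v hv
  unfold lieD
  rw [(h.eventuallyEq_of_mem (isOpen_dom.mem_nhds hv)).fderiv_eq]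

lemma lieD_add (hf : ContDiffOn ℝ ∞ f dom) (hg : ContDiffOn ℝ ∞ g dom) (hv : v ∈ dom) :
    lieD L (fun w => f w + g w) v = lieD L f v + lieD L g v := by
  unfold lieD
  rw [fderiv_fun_add (differentiableAt_of_contDiffOn hf hv) (differentiableAt_of_contDiffOn hg hv)]
  rfl

lemma lieD_sub (hf : ContDiffOn ℝ ∞ f dom) (hg : ContDiffOn ℝ ∞ g dom) (hv : v ∈ dom) :
    lieD L (fun w => f w - g w) v = lieD L f v - lieD L g v := by
  unfold lieD
  rw [fderiv_fun_sub (differentiableAt_of_contDiffOn hf hv) (differentiableAt_of_contDiffOn hg hv)]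
  rfl

lemma lieD_const_mul (c : ℂ) (hf : ContDiffOn ℝ ∞ f dom) (hv : v ∈ dom) :
    lieD L (fun w => c * f w) v = c * lieD L f v := by
  unfold lieD
  rw [fderiv_const_mul (differentiableAt_of_contDiffOn hf hv)]
  rfl

lemma lieD_mul (hf : ContDiffOn ℝ ∞ f dom) (hg : ContDiffOn ℝ ∞ g dom) (hv : v ∈ dom) :
    lieD L (fun w => f w * g w) v = lieD L f v * g v + f v * lieD L g v := by
  unfold lieD
  rw [fderiv_fun_mul (differentiableAt_of_contDiffOn hf hv) (differentiableAt_of_contDiffOn hg hv)]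
  simp only [add_apply, smul_apply, smul_eq_mul]
  ring

lemma lieD_conj (hf : ContDiffOn ℝ ∞ f dom) (hv : v ∈ dom) :
    lieD L (fun w => (starRingEnd ℂ) (f w)) v = (starRingEnd ℂ) (lieD L f v) := by
  unfold lieD
  have h := (Complex.conjCLE : ℂ →L[ℝ] ℂ).hasFDerivAt.comp v
    (differentiableAt_of_contDiffOn hf hv).hasFDerivAt
  have h2 : HasFDerivAt (fun w => (starRingEnd ℂ) (f w))
    ((Complex.conjCLE : ℂ →L[ℝ] ℂ).comp (fderiv ℝ f v)) v := h
  rw [h2.fderiv]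
  simp

lemma contDiffOn_conj (hf : ContDiffOn ℝ ∞ f dom) :
    ContDiffOn ℝ ∞ (fun w => (starRingEnd ℂ) (f w)) dom :=
  (Complex.conjCLE : ℂ →L[ℝ] ℂ).contDiff.comp_contDiffOn hf

lemma lieD_neg_field (v : Amb) : lieD (-L) f v = -lieD L f v := by
  simp [lieD]

/-- The commutator of two linear vector fields is the linear vector field of the commutator. -/
lemma lieD_lieD_sub (L₁ L₂ : Amb →L[ℝ] Amb) (hf : ContDiffOn ℝ ∞ f dom) (hv : v ∈ dom) :
    lieD L₁ (lieD L₂ f) v - lieD L₂ (lieD L₁ f) v = lieD (L₂.comp L₁ - L₁.comp L₂) f v := by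
  have hd : DifferentiableAt ℝ (fderiv ℝ f) v :=
    ((hf.fderiv_of_isOpen isOpen_dom (m := ∞) (by simp)).contDiffAt
      (isOpen_dom.mem_nhds hv)).differentiableAt (by simp)
  have h : ∀ A B : Amb →L[ℝ] Amb, lieD A (lieD B f) v =
      fderiv ℝ (fderiv ℝ f) v (A v) (B v) + fderiv ℝ f v (B (A v)) := by
    intro A B
    have h1 : HasFDerivAt (lieD B f) _ v := hd.hasFDerivAt.clm_apply B.hasFDerivAt
    rw [lieD, h1.fderiv]
    simp [add_comm]
  have hsymm : IsSymmSndFDerivAt ℝ f v :=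
    (hf.contDiffAt (isOpen_dom.mem_nhds hv)).isSymmSndFDerivAt (by
      rw [minSmoothness_of_isRCLikeNormedField]
      exact WithTop.coe_le_coe.2 (le_top : (2 : ℕ∞) ≤ ⊤))
  rw [h, h, hsymm.eq (L₁ v) (L₂ v)]
  simp [lieD]

end lieD

/-! ### One-parameter groups of right translations -/

/-- `c` is a one-parameter subgroup, right translation by which is generated by the vector field
`L`. -/
structure IsFlow (c : ℝ → SL(2, ℝ)) (L : Amb →L[ℝ] Amb) : Prop where
  map_add : ∀ s t, c s * c t = c (s + t)
  map_zero : c 0 = 1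
  continuous : Continuous c
  hasDerivAt_zero : ∀ p : SL(2, ℝ) × S3,
    HasDerivAt (fun t => emb (p.1 * c t, p.2)) (L (emb p)) 0
  map_haar : ∀ t, haarSL2.map (fun g => g * c t) = haarSL2

lemma emb_mul (g h : SL(2, ℝ)) (z : S3) : emb (g * h, z) =
    ((⟨g 0 0 * h 0 0 + g 0 1 * h 1 0, g 0 0 * h 0 1 + g 0 1 * h 1 1⟩,
      ⟨g 1 0 * h 0 0 + g 1 1 * h 1 0, g 1 0 * h 0 1 + g 1 1 * h 1 1⟩, z) : Amb) := by
  simp only [emb, Matrix.SpecialLinearGroup.coe_mul, Matrix.mul_apply, Fin.sum_univ_two]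

lemma hasDerivAt_complex_mk {f g : ℝ → ℝ} {f' g' t : ℝ} (hf : HasDerivAt f f' t)
    (hg : HasDerivAt g g' t) : HasDerivAt (fun s => (⟨f s, g s⟩ : ℂ)) ⟨f', g'⟩ t :=
  (Complex.equivRealProdCLM.symm : ℝ × ℝ →L[ℝ] ℂ).hasFDerivAt.comp_hasDerivAt t (hf.prodMk hg)

lemma hasDerivAt_emb_mul {c : ℝ → SL(2, ℝ)} {c' : Fin 2 → Fin 2 → ℝ}
    (hc : ∀ i j, HasDerivAt (fun t => c t i j) (c' i j) 0) (p : SL(2, ℝ) × S3) :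
    HasDerivAt (fun t => emb (p.1 * c t, p.2))
      ((⟨p.1 0 0 * c' 0 0 + p.1 0 1 * c' 1 0, p.1 0 0 * c' 0 1 + p.1 0 1 * c' 1 1⟩,
      ⟨p.1 1 0 * c' 0 0 + p.1 1 1 * c' 1 0, p.1 1 0 * c' 0 1 + p.1 1 1 * c' 1 1⟩, 0) : Amb) 0 := by
  simp only [emb_mul]
  exact (hasDerivAt_complex_mk
    (((hc 0 0).const_mul _).add ((hc 1 0).const_mul _))
    (((hc 0 1).const_mul _).add ((hc 1 1).const_mul _))).prodMk
    ((hasDerivAt_complex_mk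
    (((hc 0 0).const_mul _).add ((hc 1 0).const_mul _))
    (((hc 0 1).const_mul _).add ((hc 1 1).const_mul _))).prodMk (hasDerivAt_const _ _))

lemma isFlow_geo : IsFlow geo fieldH where
  map_add := geo_mul_geo
  map_zero := geo_zero
  continuous := continuous_geo
  hasDerivAt_zero p := by
    have h1 : HasDerivAt (fun t : ℝ => Real.exp (t / 2)) (1 / 2) 0 := by
      simpa using ((hasDerivAt_id (0 : ℝ)).div_const 2).exp
    have h2 : HasDerivAt (fun t : ℝ => Real.exp (-(t / 2))) (-(1 / 2)) 0 := by
      simpa using ((hasDerivAt_id (0 : ℝ)).div_const 2).neg.exp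
    convert hasDerivAt_emb_mul (c := geo) (c' := !![1 / 2, 0; 0, -(1 / 2)]) ?_ p using 1
    · rw [fieldH_apply]
      refine Prod.ext ?_ (Prod.ext ?_ rfl) <;> apply Complex.ext <;> simp [emb] <;> ring
    · intro i j
      fin_cases i <;> fin_cases j <;> simp [coe_geo] <;> first
        | exact hasDerivAt_const _ _
        | simpa using h1
        | simpa using h2
  map_haar := map_mul_geo_haarSL2

lemma isFlow_hyp : IsFlow hyp fieldV where
  map_add := hyp_mul_hyp
  map_zero := hyp_zero
  continuous := continuous_hyp
  hasDerivAt_zero p := by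
    have h1 : HasDerivAt (fun t : ℝ => Real.cosh (t / 2)) 0 0 := by
      simpa using ((hasDerivAt_id (0 : ℝ)).div_const 2).cosh
    have h2 : HasDerivAt (fun t : ℝ => Real.sinh (t / 2)) (1 / 2) 0 := by
      simpa using ((hasDerivAt_id (0 : ℝ)).div_const 2).sinh
    convert hasDerivAt_emb_mul (c := hyp) (c' := !![0, 1 / 2; 1 / 2, 0]) ?_ p using 1
    · rw [fieldV_apply]
      refine Prod.ext ?_ (Prod.ext ?_ rfl) <;> apply Complex.ext <;> simp [emb] <;> ring
    · intro i j
      fin_cases i <;> fin_cases j <;> simp [coe_hyp] <;> first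
        | exact h1
        | simpa using h2
  map_haar := map_mul_hyp_haarSL2

lemma isFlow_rot : IsFlow (fun t => rot (t / 2)) fieldW where
  map_add s t := by rw [rot_mul_rot, add_div]
  map_zero := by rw [zero_div, rot_zero]
  continuous := continuous_rot.comp (continuous_id.div_const 2)
  hasDerivAt_zero p := by
    have h1 : HasDerivAt (fun t : ℝ => Real.cos (t / 2)) 0 0 := by
      simpa using ((hasDerivAt_id (0 : ℝ)).div_const 2).cos
    have h2 : HasDerivAt (fun t : ℝ => Real.sin (t / 2)) (1 / 2) 0 := by
      simpa using ((hasDerivAt_id (0 : ℝ)).div_const 2).sin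
    have h3 : HasDerivAt (fun t : ℝ => -Real.sin (t / 2)) (-(1 / 2)) 0 := h2.neg
    convert hasDerivAt_emb_mul (c := fun t => rot (t / 2)) (c' := !![0, -(1 / 2); 1 / 2, 0]) ?_ p
      using 1
    · rw [fieldW_apply]
      refine Prod.ext ?_ (Prod.ext ?_ rfl) <;> apply Complex.ext <;> simp [emb] <;> ring
    · intro i j
      fin_cases i <;> fin_cases j <;> simp [coe_rot] <;> first
        | exact h1
        | simpa using h2
        | simpa using h3
  map_haar t := map_mul_rot_haarSL2 _

section Flow

variable {c : ℝ → SL(2, ℝ)} {L : Amb →L[ℝ] Amb} {f : Amb → ℂ}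

lemma contDiffOn_comp_emb_continuous {F : Type*} [TopologicalSpace F] {f : Amb → F}
    (hf : ContinuousOn f dom) : Continuous fun p => f (emb p) :=
  hf.comp_continuous continuous_emb emb_mem_dom

lemma IsFlow.hasDerivAt (hc : IsFlow c L) (p : SL(2, ℝ) × S3) (t : ℝ) :
    HasDerivAt (fun s => emb (p.1 * c s, p.2)) (L (emb (p.1 * c t, p.2))) t := by
  have h := hc.hasDerivAt_zero (p.1 * c t, p.2)
  have h2 : HasDerivAt (fun s : ℝ => s - t) 1 t := (hasDerivAt_id t).sub_const t
  have h3 := HasDerivAt.scomp (h := fun s : ℝ => s - t) t (by simpa using h) h2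
  rw [one_smul] at h3
  refine h3.congr_of_eventuallyEq (Eventually.of_forall fun s => ?_)
  simp only [Function.comp, mul_assoc, hc.map_add]
  rw [add_sub_cancel]

/-- The derivative of a function along a flow. -/
lemma IsFlow.hasDerivAt_comp (hc : IsFlow c L) (hf : ContDiffOn ℝ ∞ f dom)
    (p : SL(2, ℝ) × S3) (t : ℝ) :
    HasDerivAt (fun s => f (emb (p.1 * c s, p.2))) (lieD L f (emb (p.1 * c t, p.2))) t :=
  (differentiableAt_of_contDiffOn hf (emb_mem_dom _)).hasFDerivAt.comp_hasDerivAt t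
    (hc.hasDerivAt p t)

lemma continuous_lieD_emb (L : Amb →L[ℝ] Amb) (hf : ContDiffOn ℝ ∞ f dom) :
    Continuous fun p => lieD L f (emb p) :=
  contDiffOn_comp_emb_continuous (contDiffOn_lieD L hf).continuousOn

lemma IsFlow.continuous_mul (hc : IsFlow c L) :
    Continuous fun x : (SL(2, ℝ) × S3) × ℝ => ((x.1.1 * c x.2, x.1.2) : SL(2, ℝ) × S3) :=
  (((continuous_fst.comp continuous_fst).mul (hc.continuous.comp continuous_snd))).prodMk
    (continuous_snd.comp continuous_fst)

lemma IsFlow.mul_mul_neg (hc : IsFlow c L) (p : SL(2, ℝ) × S3) (t : ℝ) :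
    ((p.1 * c t * c (-t), p.2) : SL(2, ℝ) × S3) = p := by
  rw [mul_assoc, hc.map_add, add_neg_cancel, hc.map_zero, mul_one]

/-- Differentiation along a flow does not increase supports. -/
lemma IsFlow.lieD_emb_eq_zero (hc : IsFlow c L) (hf : ContDiffOn ℝ ∞ f dom)
    {p : SL(2, ℝ) × S3} (hp : p ∉ tsupport fun p => f (emb p)) : lieD L f (emb p) = 0 := by
  have h := hc.hasDerivAt_comp hf p 0
  rw [hc.map_zero, mul_one] at h
  have hcont : ContinuousAt (fun s => ((p.1 * c s, p.2) : SL(2, ℝ) × S3)) 0 :=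
    (hc.continuous_mul.comp (Continuous.prodMk_right p)).continuousAt
  have hmem : ∀ᶠ s in 𝓝 (0 : ℝ), ((p.1 * c s, p.2) : SL(2, ℝ) × S3) ∉ tsupport fun p => f (emb p) := by
    refine hcont.eventually_mem (IsOpen.mem_nhds (isClosed_tsupport _).isOpen_compl ?_)
    rw [hc.map_zero, mul_one]
    exact hp
  have h0 : HasDerivAt (fun s => f (emb (p.1 * c s, p.2))) 0 0 := by
    refine (hasDerivAt_const (0 : ℝ) (0 : ℂ)).congr_of_eventuallyEq ?_
    filter_upwards [hmem] with s hs
    exact image_eq_zero_of_notMem_tsupport (f := fun p => f (emb p)) hs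
  exact h.unique h0

lemma IsFlow.hasCompactSupport_lieD (hc : IsFlow c L) (hf : ContDiffOn ℝ ∞ f dom)
    (hs : HasCompactSupport fun p => f (emb p)) : HasCompactSupport fun p => lieD L f (emb p) :=
  HasCompactSupport.intro hs fun _ hp => hc.lieD_emb_eq_zero hf hp

/-- Differentiation of the integral of a function along a flow. -/
lemma IsFlow.hasDerivAt_integral (hc : IsFlow c L) (m : Measure (SL(2, ℝ) × S3))
    [IsFiniteMeasureOnCompacts m] (hf : ContDiffOn ℝ ∞ f dom)
    (hs : HasCompactSupport fun p => f (emb p)) (t : ℝ) :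
    HasDerivAt (fun s => ∫ p, f (emb (p.1 * c s, p.2)) ∂m)
      (∫ p, lieD L f (emb (p.1 * c t, p.2)) ∂m) t := by
  set K := tsupport fun p => f (emb p) with hK
  have hKc : IsCompact K := hs
  set K' : Set (SL(2, ℝ) × S3) := (fun x : (SL(2, ℝ) × S3) × ℝ => (x.1.1 * c x.2, x.1.2)) ''
    (K ×ˢ Set.Icc (-t - 1) (-t + 1)) with hK'
  have hKc' : IsCompact K' := (hKc.prod isCompact_Icc).image hc.continuous_mul
  have hmem : ∀ s ∈ Metric.ball t 1, ∀ p : SL(2, ℝ) × S3, p ∉ K' → (p.1 * c s, p.2) ∉ K := by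
    intro s hsb p hp hpK
    refine hp ⟨((p.1 * c s, p.2), -s), ⟨hpK, ?_⟩, hc.mul_mul_neg p s⟩
    rw [Metric.mem_ball, Real.dist_eq, abs_lt] at hsb
    constructor <;> linarith
  obtain ⟨C, hC⟩ := (hc.hasCompactSupport_lieD hf hs).exists_bound_of_continuous
    (continuous_lieD_emb L hf)
  have hcs : ∀ s, Continuous fun p : SL(2, ℝ) × S3 => ((p.1 * c s, p.2) : SL(2, ℝ) × S3) :=
    fun s => hc.continuous_mul.comp (Continuous.prodMk_left s)
  have hfc : Continuous fun p => f (emb p) := contDiffOn_comp_emb_continuous hf.continuousOn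
  refine (hasDerivAt_integral_of_dominated_loc_of_deriv_le (bound := K'.indicator fun _ => C)
    (F := fun s p => f (emb (p.1 * c s, p.2)))
    (F' := fun s p => lieD L f (emb (p.1 * c s, p.2))) (Metric.ball_mem_nhds t one_pos)
    (Eventually.of_forall fun s => (hfc.comp (hcs s)).aestronglyMeasurable) ?_
    ((continuous_lieD_emb L hf).comp (hcs t)).aestronglyMeasurable ?_ ?_ ?_).2
  · refine (hfc.comp (hcs t)).integrable_of_hasCompactSupport (HasCompactSupport.intro hKc' ?_)
    intro p hp
    exact image_eq_zero_of_notMem_tsupport (f := fun p => f (emb p))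
      (hmem t (Metric.mem_ball_self one_pos) p hp)
  · refine Eventually.of_forall fun p s hsb => ?_
    by_cases hp : p ∈ K'
    · rw [Set.indicator_of_mem hp]
      exact hC _
    · rw [Set.indicator_of_notMem hp, hc.lieD_emb_eq_zero hf (hmem s hsb p hp), norm_zero]
  · refine IntegrableOn.integrable_indicator ?_ hKc'.measurableSet
    exact integrableOn_const hKc'.measure_lt_top.ne
  · exact Eventually.of_forall fun p s _ => hc.hasDerivAt_comp hf p s

/-- The product of the Haar measure and the measure of the sphere. -/
def volP : Measure (SL(2, ℝ) × S3) := haarSL2.prod volS3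

instance : IsFiniteMeasureOnCompacts volP := by
  unfold volP
  infer_instance

lemma IsFlow.measurePreserving (hc : IsFlow c L) (t : ℝ) :
    MeasurePreserving (fun p : SL(2, ℝ) × S3 => ((p.1 * c t, p.2) : SL(2, ℝ) × S3)) volP volP :=
  MeasurePreserving.prod ⟨measurable_mul_const _, hc.map_haar t⟩ (MeasurePreserving.id volS3)

/-- Integration by parts: the integral of a derivative along a flow vanishes. -/
lemma IsFlow.integral_lieD (hc : IsFlow c L) (hf : ContDiffOn ℝ ∞ f dom)
    (hs : HasCompactSupport fun p => f (emb p)) : ∫ p, lieD L f (emb p) ∂volP = 0 := by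
  have h := hc.hasDerivAt_integral volP hf hs 0
  simp only [hc.map_zero, mul_one] at h
  have hconst : (fun s => ∫ p, f (emb (p.1 * c s, p.2)) ∂volP) = fun _ => ∫ p, f (emb p) ∂volP := by
    funext s
    have hemb : MeasurableEmbedding
        (fun p : SL(2, ℝ) × S3 => ((p.1 * c s, p.2) : SL(2, ℝ) × S3)) :=
      ((Homeomorph.mulRight (c s)).prodCongr (Homeomorph.refl S3)).measurableEmbedding
    exact (hc.measurePreserving s).integral_comp hemb (fun p => f (emb p))
  rw [hconst] at h
  exact h.unique (hasDerivAt_const _ _)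

end Flow

/-! ### Raising and lowering operators on the ambient space -/

/-- The raising operator `E⁺ = H + iV`. -/
def opE (f : Amb → ℂ) (v : Amb) : ℂ := lieD fieldH f v + Complex.I * lieD fieldV f v

/-- The lowering operator `E⁻ = H - iV`. -/
def opF (f : Amb → ℂ) (v : Amb) : ℂ := lieD fieldH f v - Complex.I * lieD fieldV f v

/-- The generator `W` of the rotations. -/
def opW (f : Amb → ℂ) (v : Amb) : ℂ := lieD fieldW f v

section Operators

variable {f g : Amb → ℂ} {v : Amb}

lemma contDiffOn_opE (hf : ContDiffOn ℝ ∞ f dom) : ContDiffOn ℝ ∞ (opE f) dom :=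
  (contDiffOn_lieD _ hf).add (contDiffOn_const.mul (contDiffOn_lieD _ hf))

lemma contDiffOn_opF (hf : ContDiffOn ℝ ∞ f dom) : ContDiffOn ℝ ∞ (opF f) dom :=
  (contDiffOn_lieD _ hf).sub (contDiffOn_const.mul (contDiffOn_lieD _ hf))

lemma opE_congr (h : Set.EqOn f g dom) : Set.EqOn (opE f) (opE g) dom := fun v hv => by
  rw [opE, opE, lieD_congr _ h hv, lieD_congr _ h hv]

lemma opF_congr (h : Set.EqOn f g dom) : Set.EqOn (opF f) (opF g) dom := fun v hv => by
  rw [opF, opF, lieD_congr _ h hv, lieD_congr _ h hv]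

lemma opE_const_mul (c : ℂ) (hf : ContDiffOn ℝ ∞ f dom) (hv : v ∈ dom) :
    opE (fun w => c * f w) v = c * opE f v := by
  rw [opE, opE, lieD_const_mul c hf hv, lieD_const_mul c hf hv]
  ring

lemma opF_const_mul (c : ℂ) (hf : ContDiffOn ℝ ∞ f dom) (hv : v ∈ dom) :
    opF (fun w => c * f w) v = c * opF f v := by
  rw [opF, opF, lieD_const_mul c hf hv, lieD_const_mul c hf hv]
  ring

lemma opW_const_mul (c : ℂ) (hf : ContDiffOn ℝ ∞ f dom) (hv : v ∈ dom) :
    opW (fun w => c * f w) v = c * opW f v := lieD_const_mul c hf hv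

lemma opE_mul (hf : ContDiffOn ℝ ∞ f dom) (hg : ContDiffOn ℝ ∞ g dom) (hv : v ∈ dom) :
    opE (fun w => f w * g w) v = opE f v * g v + f v * opE g v := by
  simp only [opE, lieD_mul hf hg hv]
  ring

lemma opF_mul (hf : ContDiffOn ℝ ∞ f dom) (hg : ContDiffOn ℝ ∞ g dom) (hv : v ∈ dom) :
    opF (fun w => f w * g w) v = opF f v * g v + f v * opF g v := by
  simp only [opF, lieD_mul hf hg hv]
  ring

lemma opW_mul (hf : ContDiffOn ℝ ∞ f dom) (hg : ContDiffOn ℝ ∞ g dom) (hv : v ∈ dom) :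
    opW (fun w => f w * g w) v = opW f v * g v + f v * opW g v := lieD_mul hf hg hv

lemma opE_conj (hf : ContDiffOn ℝ ∞ f dom) (hv : v ∈ dom) :
    opE (fun w => (starRingEnd ℂ) (f w)) v = (starRingEnd ℂ) (opF f v) := by
  rw [opE, opF, lieD_conj hf hv, lieD_conj hf hv, map_sub, map_mul, Complex.conj_I]
  ring

lemma opF_conj (hf : ContDiffOn ℝ ∞ f dom) (hv : v ∈ dom) :
    opF (fun w => (starRingEnd ℂ) (f w)) v = (starRingEnd ℂ) (opE f v) := by
  rw [opE, opF, lieD_conj hf hv, lieD_conj hf hv, map_add, map_mul, Complex.conj_I]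
  ring

lemma opW_conj (hf : ContDiffOn ℝ ∞ f dom) (hv : v ∈ dom) :
    opW (fun w => (starRingEnd ℂ) (f w)) v = (starRingEnd ℂ) (opW f v) := lieD_conj hf hv

lemma lieD_opE (L : Amb →L[ℝ] Amb) (hf : ContDiffOn ℝ ∞ f dom) (hv : v ∈ dom) :
    lieD L (opE f) v = lieD L (lieD fieldH f) v + Complex.I * lieD L (lieD fieldV f) v := by
  have h := lieD_add (L := L) (contDiffOn_lieD fieldH hf)
    (contDiffOn_const.mul (contDiffOn_lieD fieldV hf) (f := fun _ => Complex.I)) hv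
  rw [lieD_const_mul Complex.I (contDiffOn_lieD fieldV hf) hv] at h
  exact h

lemma lieD_opF (L : Amb →L[ℝ] Amb) (hf : ContDiffOn ℝ ∞ f dom) (hv : v ∈ dom) :
    lieD L (opF f) v = lieD L (lieD fieldH f) v - Complex.I * lieD L (lieD fieldV f) v := by
  have h := lieD_sub (L := L) (contDiffOn_lieD fieldH hf)
    (contDiffOn_const.mul (contDiffOn_lieD fieldV hf) (f := fun _ => Complex.I)) hv
  rw [lieD_const_mul Complex.I (contDiffOn_lieD fieldV hf) hv] at h
  exact h

lemma lieD_fieldH_fieldV (hf : ContDiffOn ℝ ∞ f dom) (hv : v ∈ dom) :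
    lieD fieldH (lieD fieldV f) v - lieD fieldV (lieD fieldH f) v = -opW f v := by
  rw [lieD_lieD_sub _ _ hf hv, fieldV_comp_fieldH, lieD_neg_field, opW]

lemma lieD_fieldW_fieldH (hf : ContDiffOn ℝ ∞ f dom) (hv : v ∈ dom) :
    lieD fieldW (lieD fieldH f) v - lieD fieldH (lieD fieldW f) v = lieD fieldV f v := by
  rw [lieD_lieD_sub _ _ hf hv, fieldH_comp_fieldW]

lemma lieD_fieldW_fieldV (hf : ContDiffOn ℝ ∞ f dom) (hv : v ∈ dom) :
    lieD fieldW (lieD fieldV f) v - lieD fieldV (lieD fieldW f) v = -lieD fieldH f v := by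
  rw [lieD_lieD_sub _ _ hf hv, fieldV_comp_fieldW, lieD_neg_field]

lemma opW_opE (hf : ContDiffOn ℝ ∞ f dom) (hv : v ∈ dom) :
    opW (opE f) v = opE (opW f) v - Complex.I * opE f v := by
  have h1 := lieD_fieldW_fieldH hf hv
  have h2 := lieD_fieldW_fieldV hf hv
  rw [opW, lieD_opE _ hf hv]
  simp only [opE]
  change _ = lieD fieldH (lieD fieldW f) v + Complex.I * lieD fieldV (lieD fieldW f) v - _
  linear_combination h1 + Complex.I * h2 + lieD fieldV f v * Complex.I_sq

lemma opW_opF (hf : ContDiffOn ℝ ∞ f dom) (hv : v ∈ dom) :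
    opW (opF f) v = opF (opW f) v + Complex.I * opF f v := by
  have h1 := lieD_fieldW_fieldH hf hv
  have h2 := lieD_fieldW_fieldV hf hv
  rw [opW, lieD_opF _ hf hv]
  simp only [opF]
  change _ = lieD fieldH (lieD fieldW f) v - Complex.I * lieD fieldV (lieD fieldW f) v + _
  linear_combination h1 - Complex.I * h2 + lieD fieldV f v * Complex.I_sq

lemma opF_opE (hf : ContDiffOn ℝ ∞ f dom) (hv : v ∈ dom) :
    opF (opE f) v = lieD fieldH (lieD fieldH f) v + lieD fieldV (lieD fieldV f) v -
      Complex.I * opW f v := by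
  have h1 := lieD_fieldH_fieldV hf hv
  rw [opF, lieD_opE _ hf hv, lieD_opE _ hf hv]
  linear_combination Complex.I * h1 - lieD fieldV (lieD fieldV f) v * Complex.I_sq

lemma opE_opF (hf : ContDiffOn ℝ ∞ f dom) (hv : v ∈ dom) :
    opE (opF f) v = lieD fieldH (lieD fieldH f) v + lieD fieldV (lieD fieldV f) v +
      Complex.I * opW f v := by
  have h1 := lieD_fieldH_fieldV hf hv
  rw [opE, lieD_opF _ hf hv, lieD_opF _ hf hv]
  linear_combination -Complex.I * h1 - lieD fieldV (lieD fieldV f) v * Complex.I_sq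

end Operators

/-! ### The ladder of weight functions generated by an eigenfunction -/

/-- A sequence of functions of all even weights, on which the raising and lowering operators act as
on a vector of the principal series with spectral parameter `r`. -/
structure IsLadder (r : ℝ) (S : ℤ → Amb → ℂ) : Prop where
  smooth : ∀ n, ContDiffOn ℝ ∞ (S n) dom
  opE : ∀ n, ∀ v ∈ dom, opE (S n) v = (Complex.I * r + 1 / 2 + n) * S (n + 1) v
  opF : ∀ n, ∀ v ∈ dom, opF (S n) v = (Complex.I * r + 1 / 2 - n) * S (n - 1) v
  opW : ∀ n, ∀ v ∈ dom, opW (S n) v = -Complex.I * n * S n v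

/-- The ascending half of the ladder generated by `f`. -/
def ascend (r : ℝ) (f : Amb → ℂ) : ℕ → Amb → ℂ
  | 0 => f
  | n + 1 => fun v => (Complex.I * r + 1 / 2 + n)⁻¹ * opE (ascend r f n) v

/-- The descending half of the ladder generated by `f`. -/
def descend (r : ℝ) (f : Amb → ℂ) : ℕ → Amb → ℂ
  | 0 => f
  | n + 1 => fun v => (Complex.I * r + 1 / 2 - (-(n : ℂ)))⁻¹ * opF (descend r f n) v

/-- The ladder generated by `f`. -/
def fullLadder (r : ℝ) (f : Amb → ℂ) (n : ℤ) : Amb → ℂ :=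
  if 0 ≤ n then ascend r f n.toNat else descend r f (-n).toNat

section

variable {r : ℝ} {f : Amb → ℂ}

lemma ladder_coeff_ne_zero (r : ℝ) (n : ℕ) : (Complex.I * r + 1 / 2 + n : ℂ) ≠ 0 := by
  intro h
  have h2 := congrArg Complex.re h
  simp at h2
  have : (0 : ℝ) ≤ n := n.cast_nonneg
  linarith

lemma contDiffOn_ascend (hf : ContDiffOn ℝ ∞ f dom) (n : ℕ) :
    ContDiffOn ℝ ∞ (ascend r f n) dom := by
  induction n with
  | zero => exact hf
  | succ n ih => exact contDiffOn_const.mul (contDiffOn_opE ih)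

lemma contDiffOn_descend (hf : ContDiffOn ℝ ∞ f dom) (n : ℕ) :
    ContDiffOn ℝ ∞ (descend r f n) dom := by
  induction n with
  | zero => exact hf
  | succ n ih => exact contDiffOn_const.mul (contDiffOn_opF ih)

lemma opE_ascend (n : ℕ) (v : Amb) :
    opE (ascend r f n) v = (Complex.I * r + 1 / 2 + n) * ascend r f (n + 1) v := by
  rw [ascend, mul_inv_cancel_left₀ (ladder_coeff_ne_zero r n)]

lemma opF_descend (n : ℕ) (v : Amb) :
    opF (descend r f n) v = (Complex.I * r + 1 / 2 + n) * descend r f (n + 1) v := by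
  rw [descend, sub_neg_eq_add, mul_inv_cancel_left₀ (ladder_coeff_ne_zero r n)]

lemma opW_ascend (hf : ContDiffOn ℝ ∞ f dom) (hW : ∀ v ∈ dom, opW f v = 0) (n : ℕ) :
    ∀ v ∈ dom, opW (ascend r f n) v = -Complex.I * n * ascend r f n v := by
  induction n with
  | zero => intro v hv; change opW f v = _; rw [hW v hv]; simp
  | succ n ih =>
    intro v hv
    have h := contDiffOn_ascend (r := r) hf n
    rw [ascend, opW_const_mul _ (contDiffOn_opE h) hv, opW_opE h hv,
      opE_congr (g := fun v => -Complex.I * n * ascend r f n v) ih hv, opE_const_mul _ h hv]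
    push_cast
    ring

lemma opW_descend (hf : ContDiffOn ℝ ∞ f dom) (hW : ∀ v ∈ dom, opW f v = 0) (n : ℕ) :
    ∀ v ∈ dom, opW (descend r f n) v = Complex.I * n * descend r f n v := by
  induction n with
  | zero => intro v hv; change opW f v = _; rw [hW v hv]; simp
  | succ n ih =>
    intro v hv
    have h := contDiffOn_descend (r := r) hf n
    rw [descend, opW_const_mul _ (contDiffOn_opF h) hv, opW_opF h hv,
      opF_congr (g := fun v => Complex.I * n * descend r f n v) ih hv, opF_const_mul _ h hv]
    push_cast
    ring

lemma opF_ascend (hf : ContDiffOn ℝ ∞ f dom) (hW : ∀ v ∈ dom, opW f v = 0)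
    (hC : ∀ v ∈ dom, lieD fieldH (lieD fieldH f) v + lieD fieldV (lieD fieldV f) v =
      -((r : ℂ) ^ 2 + 1 / 4) * f v) (n : ℕ) : ∀ v ∈ dom, opF (ascend r f (n + 1)) v =
    (Complex.I * r - 1 / 2 - n) * ascend r f n v := by
  induction n with
  | zero =>
    intro v hv
    change opF (fun v => (Complex.I * r + 1 / 2 + (0 : ℕ))⁻¹ * opE f v) v = _ * f v
    rw [opF_const_mul _ (contDiffOn_opE hf) hv]
    rw [opF_opE hf hv, hC v hv, hW v hv, inv_mul_eq_iff_eq_mul₀ (ladder_coeff_ne_zero r 0)]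
    push_cast
    linear_combination (-(r : ℂ) ^ 2 * f v) * Complex.I_sq
  | succ n ih =>
    intro v hv
    have h := contDiffOn_ascend (r := r) hf (n + 1)
    -- `E⁻E⁺ = E⁺E⁻ - 2iW`
    have h1 : opF (opE (ascend r f (n + 1))) v =
        opE (opF (ascend r f (n + 1))) v - 2 * Complex.I * opW (ascend r f (n + 1)) v := by
      rw [opF_opE h hv, opE_opF h hv]
      ring
    rw [ascend, opF_const_mul _ (contDiffOn_opE h) hv, h1,
      opE_congr (g := fun v => (Complex.I * r - 1 / 2 - n) * ascend r f n v) ih hv,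
      opE_const_mul _ (contDiffOn_ascend hf n) hv, opE_ascend, opW_ascend hf hW (n + 1) v hv,
      inv_mul_eq_iff_eq_mul₀ (ladder_coeff_ne_zero r (n + 1))]
    push_cast
    linear_combination (2 * (n + 1) * ascend r f (n + 1) v) * Complex.I_sq

lemma opE_descend (hf : ContDiffOn ℝ ∞ f dom) (hW : ∀ v ∈ dom, opW f v = 0)
    (hC : ∀ v ∈ dom, lieD fieldH (lieD fieldH f) v + lieD fieldV (lieD fieldV f) v =
      -((r : ℂ) ^ 2 + 1 / 4) * f v) (n : ℕ) : ∀ v ∈ dom, opE (descend r f (n + 1)) v =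
    (Complex.I * r - 1 / 2 - n) * descend r f n v := by
  induction n with
  | zero =>
    intro v hv
    change opE (fun v => (Complex.I * r + 1 / 2 - -((0 : ℕ) : ℂ))⁻¹ * opF f v) v = _ * f v
    rw [sub_neg_eq_add, opE_const_mul _ (contDiffOn_opF hf) hv]
    rw [opE_opF hf hv, hC v hv, hW v hv, inv_mul_eq_iff_eq_mul₀ (ladder_coeff_ne_zero r 0)]
    push_cast
    linear_combination (-(r : ℂ) ^ 2 * f v) * Complex.I_sq
  | succ n ih =>
    intro v hv
    have h := contDiffOn_descend (r := r) hf (n + 1)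
    have h1 : opE (opF (descend r f (n + 1))) v =
        opF (opE (descend r f (n + 1))) v + 2 * Complex.I * opW (descend r f (n + 1)) v := by
      rw [opF_opE h hv, opE_opF h hv]
      ring
    rw [descend, sub_neg_eq_add, opE_const_mul _ (contDiffOn_opF h) hv, h1,
      opF_congr (g := fun v => (Complex.I * r - 1 / 2 - n) * descend r f n v) ih hv,
      opF_const_mul _ (contDiffOn_descend hf n) hv, opF_descend, opW_descend hf hW (n + 1) v hv,
      inv_mul_eq_iff_eq_mul₀ (ladder_coeff_ne_zero r (n + 1))]
    push_cast
    linear_combination (2 * (n + 1) * descend r f (n + 1) v) * Complex.I_sq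

lemma isLadder_fullLadder (hf : ContDiffOn ℝ ∞ f dom) (hW : ∀ v ∈ dom, opW f v = 0)
    (hC : ∀ v ∈ dom, lieD fieldH (lieD fieldH f) v + lieD fieldV (lieD fieldV f) v =
      -((r : ℂ) ^ 2 + 1 / 4) * f v) : IsLadder r (fullLadder r f) := by
  have hup : ∀ n : ℕ, fullLadder r f n = ascend r f n := fun n => by
    simp [fullLadder]
  have hdown : ∀ n : ℕ, fullLadder r f (-(n : ℤ)) = descend r f n := fun n => by
    rcases Nat.eq_zero_or_pos n with rfl | hn
    · simp [fullLadder, ascend, descend]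
    · rw [fullLadder, if_neg (by omega)]
      simp
  refine ⟨fun n => ?_, fun n v hv => ?_, fun n v hv => ?_, fun n v hv => ?_⟩
  · unfold fullLadder
    split_ifs
    · exact contDiffOn_ascend hf _
    · exact contDiffOn_descend hf _
  · rcases lt_or_ge n 0 with hn | hn
    · obtain ⟨m, rfl⟩ : ∃ m : ℕ, n = -((m + 1 : ℕ) : ℤ) := ⟨(-n - 1).toNat, by omega⟩
      rw [hdown, show -((m + 1 : ℕ) : ℤ) + 1 = -(m : ℤ) by push_cast; ring, hdown,
        opE_descend hf hW hC m v hv]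
      push_cast
      ring
    · obtain ⟨m, rfl⟩ := Int.eq_ofNat_of_zero_le hn
      rw [hup, show (m : ℤ) + 1 = ((m + 1 : ℕ) : ℤ) by push_cast; ring, hup, opE_ascend]
      push_cast
      ring
  · rcases lt_or_ge 0 n with hn | hn
    · obtain ⟨m, rfl⟩ : ∃ m : ℕ, n = ((m + 1 : ℕ) : ℤ) := ⟨(n - 1).toNat, by omega⟩
      rw [hup, show ((m + 1 : ℕ) : ℤ) - 1 = (m : ℤ) by push_cast; ring, hup,
        opF_ascend hf hW hC m v hv]
      push_cast
      ring
    · obtain ⟨m, rfl⟩ : ∃ m : ℕ, n = -(m : ℤ) := ⟨(-n).toNat, by omega⟩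
      rw [hdown, show -(m : ℤ) - 1 = -((m + 1 : ℕ) : ℤ) by push_cast; ring, hdown, opF_descend]
      push_cast
      ring
  · rcases lt_or_ge n 0 with hn | hn
    · obtain ⟨m, rfl⟩ : ∃ m : ℕ, n = -(m : ℤ) := ⟨(-n).toNat, by omega⟩
      rw [hdown, opW_descend hf hW m v hv]
      push_cast
      ring
    · obtain ⟨m, rfl⟩ := Int.eq_ofNat_of_zero_le hn
      rw [hup, opW_ascend hf hW m v hv]
      push_cast
      ring

end

/-! ### Functions on `ℍ × S³` as functions of weight zero -/

/-- The radial projection of `ℂ² ∖ {0}` to the sphere, with an arbitrary value at `0`. -/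
def radial (w : EuclideanSpace ℂ (Fin 2)) : S3 :=
  if h : w ≠ 0 then ⟨(‖w‖⁻¹ : ℝ) • w, by
    rw [mem_sphere_zero_iff_norm, norm_smul, norm_inv, norm_norm,
      inv_mul_cancel₀ (norm_ne_zero_iff.2 h)]⟩
  else ⟨EuclideanSpace.single 0 1, by simp⟩

lemma radial_coe (z : S3) : radial (z : EuclideanSpace ℂ (Fin 2)) = z := by
  have h : ‖(z : EuclideanSpace ℂ (Fin 2))‖ = 1 := mem_sphere_zero_iff_norm.1 z.2
  have h0 : (z : EuclideanSpace ℂ (Fin 2)) ≠ 0 := norm_ne_zero_iff.1 (by rw [h]; exact one_ne_zero)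
  apply Subtype.ext
  rw [radial, dif_pos h0]
  simp [h]

lemma contMDiffAt_radial {w : EuclideanSpace ℂ (Fin 2)} (hw : w ≠ 0) :
    ContMDiffAt 𝓘(ℝ, EuclideanSpace ℂ (Fin 2)) (𝓡 3) ∞ radial w := by
  let U : TopologicalSpace.Opens (EuclideanSpace ℂ (Fin 2)) := ⟨{0}ᶜ, isOpen_compl_singleton⟩
  have h0 : ∀ x : U, (x : EuclideanSpace ℂ (Fin 2)) ≠ 0 := fun x => x.2
  have h1 : ContMDiff 𝓘(ℝ, EuclideanSpace ℂ (Fin 2)) 𝓘(ℝ, EuclideanSpace ℂ (Fin 2)) ∞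
      (fun x : U => (‖(x : EuclideanSpace ℂ (Fin 2))‖⁻¹ : ℝ) • (x : EuclideanSpace ℂ (Fin 2))) := by
    intro x
    have h2 : ContDiffAt ℝ ∞ (fun x : EuclideanSpace ℂ (Fin 2) => (‖x‖⁻¹ : ℝ) • x)
        (x : EuclideanSpace ℂ (Fin 2)) :=
      ((contDiffAt_norm ℂ (h0 x)).restrict_scalars ℝ |>.inv (norm_ne_zero_iff.2 (h0 x))).smul
        contDiffAt_id
    exact h2.contMDiffAt.comp x (contMDiff_subtype_val x)
  have h3 := h1.codRestrict_sphere (n := 3) (fun x => by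
    rw [mem_sphere_zero_iff_norm, norm_smul, norm_inv, norm_norm,
      inv_mul_cancel₀ (norm_ne_zero_iff.2 (h0 x))])
  have h4 : ContMDiffAt 𝓘(ℝ, EuclideanSpace ℂ (Fin 2)) (𝓡 3) ∞ (fun x : U => radial x)
      (⟨w, hw⟩ : U) := by
    refine (h3 ⟨w, hw⟩).congr_of_eventuallyEq (Eventually.of_forall fun x => ?_)
    apply Subtype.ext
    simp only [radial, dif_pos (h0 x), Set.val_codRestrict_apply]
  exact (contMDiffAt_subtype_iff (U := U) (f := radial) (x := ⟨w, hw⟩)).1 h4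

/-- The inclusion of the upper half-plane has real smooth local inverse `ofComplex`. -/
lemma contMDiffAt_real_ofComplex {z : ℂ} (hz : 0 < z.im) :
    ContMDiffAt 𝓘(ℝ, ℂ) 𝓘(ℝ, ℂ) ∞ ofComplex z := by
  rw [_root_.contMDiffAt_iff]
  constructor
  · rw [ContinuousAt, nhds_induced, tendsto_comap_iff]
    refine Tendsto.congr' (eventuallyEq_coe_comp_ofComplex hz).symm ?_
    simpa [ofComplex_apply_of_im_pos hz] using! tendsto_id
  · simpa using! contDiffAt_id.congr_of_eventuallyEq (eventuallyEq_coe_comp_ofComplex hz)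

/-- The complex number `(ai + b) / (ci + d)`, for `v = (a + ib, c + id, w)`. -/
def moebius (v : Amb) : ℂ := (starRingEnd ℂ) v.1 / (starRingEnd ℂ) v.2.1

/-- The extension to `Amb` of the function `(g, z) ↦ F (g • i, z)`. -/
def pull (F : ℍ × S3 → ℂ) (v : Amb) : ℂ := F (ofComplex (moebius v), radial v.2.2)

lemma im_moebius (v : Amb) : (moebius v).im = det v / Complex.normSq v.2.1 := by
  rw [moebius, Complex.div_im, det, Complex.normSq_conj]
  simp only [Complex.mul_im, Complex.conj_re, Complex.conj_im]
  ring

lemma snd_ne_zero_of_mem_dom {v : Amb} (hv : v ∈ dom) : v.2.1 ≠ 0 := by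
  intro h
  have := hv.1
  rw [det, h] at this
  simp at this

lemma im_moebius_pos {v : Amb} (hv : v ∈ dom) : 0 < (moebius v).im := by
  rw [im_moebius]
  exact div_pos hv.1 (Complex.normSq_pos.2 (snd_ne_zero_of_mem_dom hv))

lemma moebius_emb (p : SL(2, ℝ) × S3) : moebius (emb p) = ((p.1 • I : ℍ) : ℂ) := by
  rw [coe_specialLinearGroup_apply, moebius]
  have h2 : (starRingEnd ℂ) (emb p).2.1 ≠ 0 :=
    (map_ne_zero _).2 (snd_ne_zero_of_mem_dom (emb_mem_dom p))
  have h3 : ((p.1 1 0 : ℝ) : ℂ) * Complex.I + (p.1 1 1 : ℝ) ≠ 0 := by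
    intro h
    apply h2
    have e : (starRingEnd ℂ) (emb p).2.1 =
        -Complex.I * (((p.1 1 0 : ℝ) : ℂ) * Complex.I + (p.1 1 1 : ℝ)) := by
      apply Complex.ext <;> simp [emb]
    rw [e, h, mul_zero]
  simp only [coe_I, Algebra.algebraMap_self, RingHom.id_apply]
  rw [div_eq_div_iff h2 (by simpa using h3)]
  apply Complex.ext <;> simp [emb] <;> ring

lemma pull_emb (F : ℍ × S3 → ℂ) (p : SL(2, ℝ) × S3) : pull F (emb p) = F (p.1 • I, p.2) := by
  rw [pull, moebius_emb, ofComplex_apply]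
  congr 2
  exact radial_coe p.2

lemma contDiffAt_moebius {v : Amb} (hv : v ∈ dom) : ContDiffAt ℝ ∞ moebius v := by
  have h1 : ContDiff ℝ ∞ fun v : Amb => (starRingEnd ℂ) v.1 :=
    (Complex.conjCLE : ℂ →L[ℝ] ℂ).contDiff.comp contDiff_fst
  have h2 : ContDiff ℝ ∞ fun v : Amb => (starRingEnd ℂ) v.2.1 :=
    (Complex.conjCLE : ℂ →L[ℝ] ℂ).contDiff.comp (contDiff_fst.comp contDiff_snd)
  have h3 : (starRingEnd ℂ) v.2.1 ≠ 0 := (map_ne_zero _).2 (snd_ne_zero_of_mem_dom hv)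
  have h4 : moebius = fun v : Amb => (starRingEnd ℂ) v.1 * ((starRingEnd ℂ) v.2.1)⁻¹ :=
    funext fun v => div_eq_mul_inv _ _
  rw [h4]
  exact h1.contDiffAt.mul (h2.contDiffAt.inv h3)

lemma contDiffOn_pull {F : ℍ × S3 → ℂ}
    (hF : ContMDiff (𝓘(ℝ, ℂ).prod (𝓡 3)) 𝓘(ℝ, ℂ) ∞ F) : ContDiffOn ℝ ∞ (pull F) dom := by
  intro v hv
  apply ContDiffAt.contDiffWithinAt
  rw [← contMDiffAt_iff_contDiffAt]
  refine ContMDiffAt.comp v (hF _) (ContMDiffAt.prodMk ?_ ?_)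
  · exact (contMDiffAt_real_ofComplex (im_moebius_pos hv)).comp v (contDiffAt_moebius hv).contMDiffAt
  · have h : ContDiff ℝ ∞ fun v : Amb => v.2.2 := contDiff_snd.comp contDiff_snd
    exact (contMDiffAt_radial hv.2).comp v h.contDiffAt.contMDiffAt

lemma hasDerivAt_line {f : Amb → ℂ} {v : Amb} (hf : DifferentiableAt ℝ f v)
    (L : Amb →L[ℝ] Amb) : HasDerivAt (fun s : ℝ => f (v + s • L v)) (lieD L f v) 0 := by
  have h1 : HasDerivAt (fun s : ℝ => v + s • L v) (L v) 0 := by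
    simpa using ((hasDerivAt_id (0 : ℝ)).smul_const (L v)).const_add v
  have h2 : HasFDerivAt f (fderiv ℝ f v) (v + (0 : ℝ) • L v) := by
    simpa using hf.hasFDerivAt
  exact h2.comp_hasDerivAt 0 h1

/-- Functions on `ℍ × S³` are invariant under right rotations. -/
lemma opW_pull {F : ℍ × S3 → ℂ} (hF : ContMDiff (𝓘(ℝ, ℂ).prod (𝓡 3)) 𝓘(ℝ, ℂ) ∞ F) {v : Amb}
    (hv : v ∈ dom) : opW (pull F) v = 0 := by
  have h := hasDerivAt_line (differentiableAt_of_contDiffOn (contDiffOn_pull hF) hv) fieldW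
  have hc : (fun s : ℝ => pull F (v + s • fieldW v)) = fun _ => pull F v := by
    funext s
    have hm : moebius (v + s • fieldW v) = moebius v := by
      have h1 : (starRingEnd ℂ) (1 - s * Complex.I / 2 : ℂ) ≠ 0 := by
        rw [map_ne_zero]
        intro h
        have := congrArg Complex.re h
        simp at this
      rw [moebius, fieldW_apply, moebius]
      have e : ∀ x : ℂ, x + s • (-Complex.I / 2 * x) = (1 - s * Complex.I / 2) * x := fun x => by
        rw [Complex.real_smul]
        ring
      simp only [Prod.fst_add, Prod.snd_add, Prod.smul_fst, Prod.smul_snd, e, map_mul]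
      exact mul_div_mul_left _ _ h1
    rw [pull, hm, pull]
    simp [fieldW_apply]
  rw [hc] at h
  exact h.unique (hasDerivAt_const _ _)

/-- The derivative of `moebius` along `fieldH`. Its derivative along `fieldV` is `-i` times it. -/
def moebiusH (v : Amb) : ℂ := -Complex.I * det v / (starRingEnd ℂ) v.2.1 ^ 2

section Laplacian

variable {v : Amb}

lemma I_mul_det (v : Amb) : 2 * Complex.I * det v =
    (starRingEnd ℂ) v.1 * v.2.1 - v.1 * (starRingEnd ℂ) v.2.1 := by
  rw [det]
  apply Complex.ext <;> simp <;> ring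

lemma hasDerivAt_conj_line_H (x : ℂ) : HasDerivAt
    (fun s : ℝ => (starRingEnd ℂ) (x + s • ((starRingEnd ℂ) x / 2))) (x / 2) 0 := by
  have h : (fun s : ℝ => (starRingEnd ℂ) (x + s • ((starRingEnd ℂ) x / 2))) =
      fun s : ℝ => (starRingEnd ℂ) x + s • (x / 2) := by
    have h2 : (starRingEnd ℂ) 2 = 2 := map_ofNat _ 2
    funext s
    simp [Complex.real_smul, h2]
  rw [h]
  simpa using ((hasDerivAt_id (0 : ℝ)).smul_const (x / 2)).const_add ((starRingEnd ℂ) x)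

lemma hasDerivAt_conj_line_V (x : ℂ) : HasDerivAt
    (fun s : ℝ => (starRingEnd ℂ) (x + s • (Complex.I / 2 * (starRingEnd ℂ) x)))
      (-Complex.I / 2 * x) 0 := by
  have h : (fun s : ℝ => (starRingEnd ℂ) (x + s • (Complex.I / 2 * (starRingEnd ℂ) x))) =
      fun s : ℝ => (starRingEnd ℂ) x + s • (-Complex.I / 2 * x) := by
    have h2 : (starRingEnd ℂ) 2 = 2 := map_ofNat _ 2
    funext s
    simp [Complex.real_smul, h2]
  rw [h]
  simpa using ((hasDerivAt_id (0 : ℝ)).smul_const (-Complex.I / 2 * x)).const_add ((starRingEnd ℂ) x)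

lemma det_line_H (v : Amb) (s : ℝ) : det (v + s • fieldH v) = (1 - s ^ 2 / 4) * det v := by
  have h2 : (starRingEnd ℂ) 2 = 2 := map_ofNat _ 2
  rw [det, fieldH_apply, det]
  simp [h2]
  ring

lemma det_line_V (v : Amb) (s : ℝ) : det (v + s • fieldV v) = (1 - s ^ 2 / 4) * det v := by
  have h2 : (starRingEnd ℂ) 2 = 2 := map_ofNat _ 2
  rw [det, fieldV_apply, det]
  simp [h2]
  ring

lemma hasDerivAt_moebius_H (hv : v ∈ dom) :
    HasDerivAt (fun s : ℝ => moebius (v + s • fieldH v)) (moebiusH v) 0 := by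
  have h0 : (starRingEnd ℂ) v.2.1 ≠ 0 := (map_ne_zero _).2 (snd_ne_zero_of_mem_dom hv)
  have h := (hasDerivAt_conj_line_H v.1).div (hasDerivAt_conj_line_H v.2.1) (by simpa using h0)
  rw [show moebiusH v = _ from ?_]
  · refine h.congr_of_eventuallyEq (Eventually.of_forall fun s => ?_)
    simp only [moebius, fieldH_apply]
    rfl
  · have e := I_mul_det v
    simp only [zero_smul, add_zero, moebiusH]
    congr 1
    linear_combination (-1 / 2) * e

lemma hasDerivAt_moebius_V (hv : v ∈ dom) :
    HasDerivAt (fun s : ℝ => moebius (v + s • fieldV v)) (-Complex.I * moebiusH v) 0 := by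
  have h0 : (starRingEnd ℂ) v.2.1 ≠ 0 := (map_ne_zero _).2 (snd_ne_zero_of_mem_dom hv)
  have h := (hasDerivAt_conj_line_V v.1).div (hasDerivAt_conj_line_V v.2.1) (by simpa using h0)
  rw [show -Complex.I * moebiusH v = _ from ?_]
  · refine h.congr_of_eventuallyEq (Eventually.of_forall fun s => ?_)
    simp only [moebius, fieldV_apply]
    rfl
  · have e := I_mul_det v
    simp only [zero_smul, add_zero, moebiusH]
    rw [← mul_div_assoc]
    congr 1
    linear_combination (Complex.I / 2) * e

lemma hasDerivAt_moebiusH_H (hv : v ∈ dom) :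
    HasDerivAt (fun s : ℝ => moebiusH (v + s • fieldH v))
      (Complex.I * det v * v.2.1 / (starRingEnd ℂ) v.2.1 ^ 3) 0 := by
  have h0 : (starRingEnd ℂ) v.2.1 ≠ 0 := (map_ne_zero _).2 (snd_ne_zero_of_mem_dom hv)
  have h1 : HasDerivAt (fun s : ℝ => -Complex.I * ((det (v + s • fieldH v) : ℝ) : ℂ)) 0 0 := by
    simp only [det_line_H]
    have : HasDerivAt (fun s : ℝ => (1 - s ^ 2 / 4) * det v) 0 0 := by
      simpa using (((hasDerivAt_pow 2 (0 : ℝ)).div_const 4).const_sub 1).mul_const (det v)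
    simpa using this.ofReal_comp.const_mul (-Complex.I)
  have h := h1.div ((hasDerivAt_conj_line_H v.2.1).pow 2) (by simpa using h0)
  refine (h.congr_deriv ?_).congr_of_eventuallyEq (Eventually.of_forall fun s => ?_)
  · simp only [zero_smul, add_zero, Pi.pow_apply]
    field_simp
    ring
  · simp [moebiusH, fieldH_apply]

lemma hasDerivAt_moebiusH_V (hv : v ∈ dom) :
    HasDerivAt (fun s : ℝ => -Complex.I * moebiusH (v + s • fieldV v))
      (-(Complex.I * det v * v.2.1 / (starRingEnd ℂ) v.2.1 ^ 3)) 0 := by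
  have h0 : (starRingEnd ℂ) v.2.1 ≠ 0 := (map_ne_zero _).2 (snd_ne_zero_of_mem_dom hv)
  have h1 : HasDerivAt (fun s : ℝ => -Complex.I * ((det (v + s • fieldV v) : ℝ) : ℂ)) 0 0 := by
    simp only [det_line_V]
    have : HasDerivAt (fun s : ℝ => (1 - s ^ 2 / 4) * det v) 0 0 := by
      simpa using (((hasDerivAt_pow 2 (0 : ℝ)).div_const 4).const_sub 1).mul_const (det v)
    simpa using this.ofReal_comp.const_mul (-Complex.I)
  have h := (h1.div ((hasDerivAt_conj_line_V v.2.1).pow 2) (by simpa using h0)).const_mul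
    (-Complex.I)
  refine (h.congr_deriv ?_).congr_of_eventuallyEq (Eventually.of_forall fun s => ?_)
  · simp only [zero_smul, add_zero, Pi.pow_apply]
    field_simp
    simp only [Nat.cast_ofNat]
    linear_combination (2 * (starRingEnd ℂ) v.2.1 * det v * v.2.1) * Complex.I_sq
  · simp [moebiusH, fieldV_apply]

lemma normSq_moebiusH (v : Amb) : Complex.normSq (moebiusH v) = (moebius v).im ^ 2 := by
  rw [moebiusH, im_moebius]
  simp only [map_div₀, map_mul, Complex.normSq_neg, Complex.normSq_I, map_pow,
    Complex.normSq_conj, Complex.normSq_ofReal]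
  ring

end Laplacian

/-- The second derivatives in two orthogonal directions of equal length. -/
lemma second_fderiv_add_rotate {G : ℂ → ℂ} {z : ℂ} (hG : ContDiffAt ℝ ∞ G z) (ζ : ℂ) :
    fderiv ℝ (fderiv ℝ G) z ζ ζ + fderiv ℝ (fderiv ℝ G) z (-Complex.I * ζ) (-Complex.I * ζ) =
      Complex.normSq ζ * Laplacian.laplacian G z := by
  have hsymm : IsSymmSndFDerivAt ℝ G z := hG.isSymmSndFDerivAt (by
    rw [minSmoothness_of_isRCLikeNormedField]
    exact WithTop.coe_le_coe.2 (le_top : (2 : ℕ∞) ≤ ⊤))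
  obtain ⟨a, b⟩ := ζ
  have h1 : (⟨a, b⟩ : ℂ) = a • (1 : ℂ) + b • Complex.I := by
    apply Complex.ext <;> simp
  have h2 : -Complex.I * ⟨a, b⟩ = b • (1 : ℂ) + (-a) • Complex.I := by
    apply Complex.ext <;> simp
  rw [InnerProductSpace.laplacian_eq_iteratedFDeriv_complexPlane]
  simp only [iteratedFDeriv_two_apply, Matrix.cons_val_zero, Matrix.cons_val_one]
  rw [Complex.normSq_mk, h2, h1]
  simp only [map_add, map_smul, add_apply, smul_apply]
  rw [hsymm.eq Complex.I 1]
  simp only [Complex.real_smul]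
  push_cast
  ring

lemma hasDerivAt_comp_curve {E : Type*} [NormedAddCommGroup E] [NormedSpace ℝ E] {G : ℂ → E}
    {c : ℝ → ℂ} {c' z : ℂ} (hG : DifferentiableAt ℝ G z) (hc : HasDerivAt c c' 0) (hz : c 0 = z) :
    HasDerivAt (fun s => G (c s)) (fderiv ℝ G z c') 0 := by
  subst hz
  exact hG.hasFDerivAt.comp_hasDerivAt (0 : ℝ) hc

section Casimir

variable {F : ℍ × S3 → ℂ} {v : Amb}

/-- The restriction of `F` to the slice through `z`, as a function on the half-plane in `ℂ`. -/
def slice (F : ℍ × S3 → ℂ) (z : S3) (w : ℂ) : ℂ := F (ofComplex w, z)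

lemma contDiffAt_slice (hF : ContMDiff (𝓘(ℝ, ℂ).prod (𝓡 3)) 𝓘(ℝ, ℂ) ∞ F) (z : S3) {w : ℂ}
    (hw : 0 < w.im) : ContDiffAt ℝ ∞ (slice F z) w := by
  rw [← contMDiffAt_iff_contDiffAt]
  exact ContMDiffAt.comp w (hF _) ((contMDiffAt_real_ofComplex hw).prodMk contMDiffAt_const)

lemma lieD_pull (hF : ContMDiff (𝓘(ℝ, ℂ).prod (𝓡 3)) 𝓘(ℝ, ℂ) ∞ F) {L : Amb →L[ℝ] Amb}
    (hL : (L v).2.2 = 0) {ζ : ℂ} (hv : v ∈ dom)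
    (hζ : HasDerivAt (fun s : ℝ => moebius (v + s • L v)) ζ 0) :
    lieD L (pull F) v = fderiv ℝ (slice F (radial v.2.2)) (moebius v) ζ := by
  have h1 := hasDerivAt_line (differentiableAt_of_contDiffOn (contDiffOn_pull hF) hv) L
  have h3 := hasDerivAt_comp_curve ((contDiffAt_slice hF (radial v.2.2)
    (im_moebius_pos hv)).differentiableAt (by simp)) hζ (by simp)
  have h4 : (fun s : ℝ => pull F (v + s • L v)) =
      fun s : ℝ => slice F (radial v.2.2) (moebius (v + s • L v)) := by
    funext s
    rw [pull, slice, Prod.snd_add, Prod.snd_add, Prod.smul_snd, Prod.smul_snd, hL, smul_zero,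
      add_zero]
  rw [h4] at h1
  exact h1.unique h3

lemma lieD_lieD_pull (hF : ContMDiff (𝓘(ℝ, ℂ).prod (𝓡 3)) 𝓘(ℝ, ℂ) ∞ F) {L : Amb →L[ℝ] Amb}
    (hL : ∀ v, (L v).2.2 = 0) {ζ : Amb → ℂ} {ζ' : ℂ} (hv : v ∈ dom)
    (hζ : ∀ v ∈ dom, HasDerivAt (fun s : ℝ => moebius (v + s • L v)) (ζ v) 0)
    (hζ' : HasDerivAt (fun s : ℝ => ζ (v + s • L v)) ζ' 0) :
    lieD L (lieD L (pull F)) v =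
      fderiv ℝ (fderiv ℝ (slice F (radial v.2.2))) (moebius v) (ζ v) (ζ v) +
        fderiv ℝ (slice F (radial v.2.2)) (moebius v) ζ' := by
  have h1 := hasDerivAt_line
    (differentiableAt_of_contDiffOn (contDiffOn_lieD L (contDiffOn_pull hF)) hv) L
  have h2 := hasDerivAt_comp_curve (((contDiffAt_slice hF (radial v.2.2)
    (im_moebius_pos hv)).fderiv_right (m := ∞) (by simp)).differentiableAt (by simp))
    (hζ v hv) (by simp)
  have h3 := h2.clm_apply hζ'
  have hcont : ContinuousAt (fun s : ℝ => v + s • L v) 0 := by fun_prop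
  have hmem : ∀ᶠ s : ℝ in 𝓝 0, v + s • L v ∈ dom :=
    hcont (isOpen_dom.mem_nhds (by simpa using hv))
  have h4 : (fun s : ℝ => lieD L (pull F) (v + s • L v)) =ᶠ[𝓝 0] fun s : ℝ =>
      fderiv ℝ (slice F (radial v.2.2)) (moebius (v + s • L v)) (ζ (v + s • L v)) := by
    filter_upwards [hmem] with s hs
    have h5 : (v + s • L v).2.2 = v.2.2 := by
      rw [Prod.snd_add, Prod.snd_add, Prod.smul_snd, Prod.smul_snd, hL, smul_zero, add_zero]
    rw [lieD_pull hF (hL _) hs (hζ _ hs), h5]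
  have h6 := h1.unique (h3.congr_of_eventuallyEq h4)
  rw [h6, zero_smul, add_zero]

/-- The operator `H² + V²` lifts the hyperbolic Laplacian. -/
lemma casimir_pull (hF : ContMDiff (𝓘(ℝ, ℂ).prod (𝓡 3)) 𝓘(ℝ, ℂ) ∞ F) (hv : v ∈ dom) :
    lieD fieldH (lieD fieldH (pull F)) v + lieD fieldV (lieD fieldV (pull F)) v =
      -hypLaplacian (fun σ => F (σ, radial v.2.2)) (ofComplex (moebius v)) := by
  rw [lieD_lieD_pull hF (fun v => by rw [fieldH_apply]) hv (fun v hv => hasDerivAt_moebius_H hv)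
      (hasDerivAt_moebiusH_H hv),
    lieD_lieD_pull hF (ζ := fun v => -Complex.I * moebiusH v) (fun v => by rw [fieldV_apply]) hv
      (fun v hv => hasDerivAt_moebius_V hv) (hasDerivAt_moebiusH_V hv), map_neg]
  have h := second_fderiv_add_rotate (contDiffAt_slice hF (radial v.2.2) (im_moebius_pos hv))
    (moebiusH v)
  rw [normSq_moebiusH v] at h
  have him : (ofComplex (moebius v) : ℂ) = moebius v := by
    rw [ofComplex_apply_of_im_pos (im_moebius_pos hv)]
  have him2 : (ofComplex (moebius v)).im = (moebius v).im := by
    rw [← coe_im, him]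
  rw [hypLaplacian, him, him2]
  push_cast at h
  change _ = -(-((moebius v).im : ℂ) ^ 2 * Laplacian.laplacian (slice F (radial v.2.2)) (moebius v))
  linear_combination h

end Casimir

/-! ### The ladder of a Maass form -/

section Maass

variable {Γ : Subgroup SL(2, ℝ)} {ρ : Γ →* SU2} {u : Base ρ → ℂ} {lam r : ℝ}

/-- The ladder of functions on `Amb` that restricts to the ladder of `u`. -/
def maassLadder (r : ℝ) (u : Base ρ → ℂ) : ℤ → Amb → ℂ :=
  fullLadder r (pull fun p => u (Base.mk ρ p))

lemma IsMaassForm.casimir (hu : IsMaassForm ρ lam u) {v : Amb} (hv : v ∈ dom) :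
    lieD fieldH (lieD fieldH (pull fun p => u (Base.mk ρ p))) v +
      lieD fieldV (lieD fieldV (pull fun p => u (Base.mk ρ p))) v =
      -(lam : ℂ) * pull (fun p => u (Base.mk ρ p)) v := by
  rw [casimir_pull hu.smooth hv, hu.eigen, pull]
  ring

lemma IsMaassForm.isLadder (hu : IsMaassForm ρ lam u) (hr : lam = r ^ 2 + 1 / 4) :
    IsLadder r (maassLadder r u) :=
  isLadder_fullLadder (contDiffOn_pull hu.smooth) (fun _ hv => opW_pull hu.smooth hv)
    fun v hv => by
      rw [hu.casimir hv, hr]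
      push_cast
      ring

lemma derivAlong_mk {c : ℝ → SL(2, ℝ)} {L : Amb →L[ℝ] Amb} (hc : IsFlow c L) {s : Lift ρ → ℂ}
    {f : Amb → ℂ} (hf : ContDiffOn ℝ ∞ f dom) (hs : ∀ p, s (Lift.mk ρ p) = f (emb p))
    (p : SL(2, ℝ) × S3) : derivAlong c s (Lift.mk ρ p) = lieD L f (emb p) := by
  have h := (hc.hasDerivAt_comp hf p 0).deriv
  rw [hc.map_zero, mul_one] at h
  rw [derivAlong, ← h]
  congr 1
  funext t
  exact hs (p.1 * c t, p.2)

lemma ladder_mk (hu : IsMaassForm ρ lam u) (n : ℤ) (p : SL(2, ℝ) × S3) :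
    ladder r u n (Lift.mk ρ p) = maassLadder r u n (emb p) := by
  have hf := contDiffOn_pull hu.smooth
  have hup : ∀ (n : ℕ) (p : SL(2, ℝ) × S3), ladderUp r u n (Lift.mk ρ p) =
      ascend r (pull fun p => u (Base.mk ρ p)) n (emb p) := by
    intro n
    induction n with
    | zero => exact fun p => (pull_emb (fun p => u (Base.mk ρ p)) p).symm
    | succ n ih =>
      intro p
      simp only [ladderUp, ascend, raise, opE]
      rw [derivAlong_mk isFlow_geo (contDiffOn_ascend hf n) ih,
        derivAlong_mk isFlow_hyp (contDiffOn_ascend hf n) ih]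
  have hdown : ∀ (n : ℕ) (p : SL(2, ℝ) × S3), ladderDown r u n (Lift.mk ρ p) =
      descend r (pull fun p => u (Base.mk ρ p)) n (emb p) := by
    intro n
    induction n with
    | zero => exact fun p => (pull_emb (fun p => u (Base.mk ρ p)) p).symm
    | succ n ih =>
      intro p
      simp only [ladderDown, descend, lower, opF]
      rw [derivAlong_mk isFlow_geo (contDiffOn_descend hf n) ih,
        derivAlong_mk isFlow_hyp (contDiffOn_descend hf n) ih]
  rw [ladder, maassLadder, fullLadder]
  split_ifs
  · exact hup _ p
  · exact hdown _ p

end Maass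

/-! ### Matrix coefficients of test functions -/

/-- A function on `Amb`, smooth on `dom`, whose restriction to `SL(2, ℝ) × S³` has compact
support. -/
structure IsTest (a : Amb → ℂ) : Prop where
  smooth : ContDiffOn ℝ ∞ a dom
  hasCompactSupport : HasCompactSupport fun p => a (emb p)

namespace IsTest

variable {a b : Amb → ℂ}

lemma continuous (ha : IsTest a) : Continuous fun p => a (emb p) :=
  contDiffOn_comp_emb_continuous ha.smooth.continuousOn

lemma lieD (ha : IsTest a) {c : ℝ → SL(2, ℝ)} {L : Amb →L[ℝ] Amb} (hc : IsFlow c L) :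
    IsTest (lieD L a) :=
  ⟨contDiffOn_lieD L ha.smooth, hc.hasCompactSupport_lieD ha.smooth ha.hasCompactSupport⟩

lemma mul_right (ha : IsTest a) (hb : ContDiffOn ℝ ∞ b dom) : IsTest fun v => a v * b v :=
  ⟨ha.smooth.mul hb, ha.hasCompactSupport.mul_right (f' := fun p => b (emb p))⟩

lemma sub (ha : IsTest a) (hb : IsTest b) : IsTest fun v => a v - b v :=
  ⟨ha.smooth.sub hb.smooth, ha.hasCompactSupport.sub hb.hasCompactSupport⟩

lemma add (ha : IsTest a) (hb : IsTest b) : IsTest fun v => a v + b v :=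
  ⟨ha.smooth.add hb.smooth, ha.hasCompactSupport.add hb.hasCompactSupport⟩

lemma const_mul (c : ℂ) (ha : IsTest a) : IsTest fun v => c * a v :=
  ⟨contDiffOn_const.mul ha.smooth, ha.hasCompactSupport.mul_left (f := fun _ => c)⟩

lemma opE (ha : IsTest a) : IsTest (opE a) :=
  (ha.lieD isFlow_geo).add ((ha.lieD isFlow_hyp).const_mul Complex.I)

lemma opF (ha : IsTest a) : IsTest (opF a) :=
  (ha.lieD isFlow_geo).sub ((ha.lieD isFlow_hyp).const_mul Complex.I)

lemma opW (ha : IsTest a) : IsTest (opW a) := ha.lieD isFlow_rot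

lemma integrable (ha : IsTest a) : Integrable (fun p => a (emb p)) volP :=
  ha.continuous.integrable_of_hasCompactSupport ha.hasCompactSupport

lemma integral_opE (ha : IsTest a) : ∫ p, MicrolocalLift.opE a (emb p) ∂volP = 0 := by
  have h := (ha.lieD isFlow_geo).integrable
  have h2 := (ha.lieD isFlow_hyp).integrable.const_mul Complex.I
  simp only [MicrolocalLift.opE]
  rw [integral_add h h2, integral_const_mul, isFlow_geo.integral_lieD ha.smooth ha.hasCompactSupport,
    isFlow_hyp.integral_lieD ha.smooth ha.hasCompactSupport, mul_zero, add_zero]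

lemma integral_opF (ha : IsTest a) : ∫ p, MicrolocalLift.opF a (emb p) ∂volP = 0 := by
  have h := (ha.lieD isFlow_geo).integrable
  have h2 := (ha.lieD isFlow_hyp).integrable.const_mul Complex.I
  simp only [MicrolocalLift.opF]
  rw [integral_sub h h2, integral_const_mul, isFlow_geo.integral_lieD ha.smooth ha.hasCompactSupport,
    isFlow_hyp.integral_lieD ha.smooth ha.hasCompactSupport, mul_zero, sub_zero]

lemma integral_opW (ha : IsTest a) : ∫ p, MicrolocalLift.opW a (emb p) ∂volP = 0 :=
  isFlow_rot.integral_lieD ha.smooth ha.hasCompactSupport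

end IsTest

/-- The matrix coefficient `∫ a S_n \bar S_m` of multiplication by `a`. -/
def coef (S : ℤ → Amb → ℂ) (a : Amb → ℂ) (n m : ℤ) : ℂ :=
  ∫ p, a (emb p) * S n (emb p) * (starRingEnd ℂ) (S m (emb p)) ∂volP

section Coefficients

variable {r : ℝ} {S : ℤ → Amb → ℂ} {a b : Amb → ℂ}

lemma IsTest.mul_ladder (ha : IsTest a) (hS : IsLadder r S) (n m : ℤ) :
    IsTest fun v => a v * S n v * (starRingEnd ℂ) (S m v) :=
  (ha.mul_right (hS.smooth n)).mul_right (contDiffOn_conj (hS.smooth m))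

lemma coef_sub (ha : IsTest a) (hb : IsTest b) (hS : IsLadder r S) (n m : ℤ) :
    coef S (fun v => a v - b v) n m = coef S a n m - coef S b n m := by
  rw [coef, coef, coef, ← integral_sub (ha.mul_ladder hS n m).integrable
    (hb.mul_ladder hS n m).integrable]
  simp only [sub_mul]

lemma coef_add (ha : IsTest a) (hb : IsTest b) (hS : IsLadder r S) (n m : ℤ) :
    coef S (fun v => a v + b v) n m = coef S a n m + coef S b n m := by
  rw [coef, coef, coef, ← integral_add (ha.mul_ladder hS n m).integrable
    (hb.mul_ladder hS n m).integrable]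
  simp only [add_mul]

/-- Integration by parts for the raising operator. -/
lemma coef_opE (ha : IsTest a) (hS : IsLadder r S) (n m : ℤ) :
    coef S (opE a) n m = -(Complex.I * r + 1 / 2 + n) * coef S a (n + 1) m +
      (Complex.I * r - 1 / 2 + m) * coef S a n (m - 1) := by
  have h := (ha.mul_ladder hS n m).integral_opE
  have hc : ∀ p, opE (fun v => a v * S n v * (starRingEnd ℂ) (S m v)) (emb p) =
      opE a (emb p) * S n (emb p) * (starRingEnd ℂ) (S m (emb p)) +
      (Complex.I * r + 1 / 2 + n) * (a (emb p) * S (n + 1) (emb p) *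
        (starRingEnd ℂ) (S m (emb p))) -
      (Complex.I * r - 1 / 2 + m) * (a (emb p) * S n (emb p) *
        (starRingEnd ℂ) (S (m - 1) (emb p))) := by
    intro p
    have hp := emb_mem_dom p
    rw [opE_mul (ha.smooth.mul (hS.smooth n)) (contDiffOn_conj (hS.smooth m)) hp,
      opE_mul ha.smooth (hS.smooth n) hp, opE_conj (hS.smooth m) hp, hS.opE n _ hp,
      hS.opF m _ hp]
    simp only [map_mul, map_add, map_sub, Complex.conj_I, Complex.conj_ofReal, map_div₀, map_one,
      map_ofNat, map_intCast]
    ring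
  simp only [hc] at h
  rw [integral_sub, integral_add, integral_const_mul, integral_const_mul] at h
  · simp only [coef]
    linear_combination h
  · exact (ha.opE.mul_ladder hS n m).integrable
  · exact ((ha.mul_ladder hS (n + 1) m).integrable).const_mul _
  · exact (ha.opE.mul_ladder hS n m).integrable.add
      (((ha.mul_ladder hS (n + 1) m).integrable).const_mul _)
  · exact ((ha.mul_ladder hS n (m - 1)).integrable).const_mul _

/-- Integration by parts for the lowering operator. -/
lemma coef_opF (ha : IsTest a) (hS : IsLadder r S) (n m : ℤ) :
    coef S (opF a) n m = -(Complex.I * r + 1 / 2 - n) * coef S a (n - 1) m +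
      (Complex.I * r - 1 / 2 - m) * coef S a n (m + 1) := by
  have h := (ha.mul_ladder hS n m).integral_opF
  have hc : ∀ p, opF (fun v => a v * S n v * (starRingEnd ℂ) (S m v)) (emb p) =
      opF a (emb p) * S n (emb p) * (starRingEnd ℂ) (S m (emb p)) +
      (Complex.I * r + 1 / 2 - n) * (a (emb p) * S (n - 1) (emb p) *
        (starRingEnd ℂ) (S m (emb p))) -
      (Complex.I * r - 1 / 2 - m) * (a (emb p) * S n (emb p) *
        (starRingEnd ℂ) (S (m + 1) (emb p))) := by
    intro p
    have hp := emb_mem_dom p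
    rw [opF_mul (ha.smooth.mul (hS.smooth n)) (contDiffOn_conj (hS.smooth m)) hp,
      opF_mul ha.smooth (hS.smooth n) hp, opF_conj (hS.smooth m) hp, hS.opF n _ hp,
      hS.opE m _ hp]
    simp only [map_mul, map_add, Complex.conj_I, Complex.conj_ofReal, map_div₀, map_one,
      map_ofNat, map_intCast]
    ring
  simp only [hc] at h
  rw [integral_sub, integral_add, integral_const_mul, integral_const_mul] at h
  · simp only [coef]
    linear_combination h
  · exact (ha.opF.mul_ladder hS n m).integrable
  · exact ((ha.mul_ladder hS (n - 1) m).integrable).const_mul _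
  · exact (ha.opF.mul_ladder hS n m).integrable.add
      (((ha.mul_ladder hS (n - 1) m).integrable).const_mul _)
  · exact ((ha.mul_ladder hS n (m + 1)).integrable).const_mul _

/-- Integration by parts for the rotations. -/
lemma coef_opW (ha : IsTest a) (hS : IsLadder r S) (n m : ℤ) :
    Complex.I * coef S (opW a) n m = (m - n) * coef S a n m := by
  have h := (ha.mul_ladder hS n m).integral_opW
  have hc : ∀ p, opW (fun v => a v * S n v * (starRingEnd ℂ) (S m v)) (emb p) =
      opW a (emb p) * S n (emb p) * (starRingEnd ℂ) (S m (emb p)) +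
      Complex.I * (m - n) * (a (emb p) * S n (emb p) * (starRingEnd ℂ) (S m (emb p))) := by
    intro p
    have hp := emb_mem_dom p
    rw [opW_mul (ha.smooth.mul (hS.smooth n)) (contDiffOn_conj (hS.smooth m)) hp,
      opW_mul ha.smooth (hS.smooth n) hp, opW_conj (hS.smooth m) hp, hS.opW n _ hp,
      hS.opW m _ hp]
    simp only [map_mul, map_neg, Complex.conj_I, map_intCast]
    ring
  simp only [hc] at h
  rw [integral_add, integral_const_mul] at h
  · simp only [coef]
    linear_combination Complex.I * h - (m - n) *
      (∫ p, a (emb p) * S n (emb p) * (starRingEnd ℂ) (S m (emb p)) ∂volP) * Complex.I_sq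
  · exact (ha.opW.mul_ladder hS n m).integrable
  · exact ((ha.mul_ladder hS n m).integrable).const_mul _

/-- The difference of the coefficients along the diagonals is smaller by a factor `r`. -/
lemma mul_coef_succ_sub (ha : IsTest a) (hS : IsLadder r S) (n m : ℤ) :
    (Complex.I * r + 1 / 2 + n) * (coef S a (n + 1) (m + 1) - coef S a n m) =
      Complex.I * coef S (opW a) n m - coef S (opE a) n (m + 1) := by
  rw [coef_opW ha hS, coef_opE ha hS, add_sub_cancel_right]
  push_cast
  ring

/-- The sum of the coefficients of `E⁺ a` and `E⁻ a` is a second difference, up to the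
non-leading term `2n - 1`. -/
lemma coef_opE_add_coef_opF (ha : IsTest a) (hS : IsLadder r S) (n m : ℤ) :
    coef S (opE a) n (m + 1) + coef S (opF a) n (m - 1) =
      -(Complex.I * (coef S (opW a) n m - coef S (opW a) (n - 1) (m - 1)) -
        (coef S (opE a) n (m + 1) - coef S (opE a) (n - 1) m)) -
      (2 * n - 1) * (coef S a n m - coef S a (n - 1) (m - 1)) := by
  have h1 := mul_coef_succ_sub ha hS n m
  have h2 := mul_coef_succ_sub ha hS (n - 1) (m - 1)
  have h3 := coef_opF ha hS n (m - 1)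
  have h4 := coef_opE ha hS n (m + 1)
  simp only [sub_add_cancel, add_sub_cancel_right] at h2 h3 h4
  push_cast at h1 h2 h3 h4
  rw [h3]
  linear_combination h4 - h1 + h2

/-- Two integrations by parts along the rotations, which give decay off the diagonal. -/
lemma one_add_sq_mul_coef (ha : IsTest a) (hS : IsLadder r S) (n m : ℤ) :
    (1 + ((n : ℂ) - m) ^ 2) * coef S a n m = coef S (fun v => a v - opW (opW a) v) n m := by
  rw [coef_sub ha ha.opW.opW hS]
  have h1 := coef_opW ha hS n m
  have h2 := coef_opW ha.opW hS n m
  linear_combination (n - m : ℂ) * h1 - Complex.I * h2 +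
    (coef S (opW (opW a)) n m) * Complex.I_sq

/-- The integral against the square of a partial sum of the ladder. -/
lemma integral_mul_sum_mul_conj (ha : IsTest a) (hS : IsLadder r S) (s : Finset ℤ) :
    ∫ p, a (emb p) * ((∑ n ∈ s, S n (emb p)) * (starRingEnd ℂ) (∑ n ∈ s, S n (emb p))) ∂volP =
      ∑ n ∈ s, ∑ m ∈ s, coef S a n m := by
  have h : ∀ p, a (emb p) * ((∑ n ∈ s, S n (emb p)) * (starRingEnd ℂ) (∑ n ∈ s, S n (emb p))) =
      ∑ n ∈ s, ∑ m ∈ s, a (emb p) * S n (emb p) * (starRingEnd ℂ) (S m (emb p)) := by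
    intro p
    rw [map_sum, Finset.sum_mul_sum, Finset.mul_sum]
    refine Finset.sum_congr rfl fun n _ => ?_
    rw [Finset.mul_sum]
    exact Finset.sum_congr rfl fun m _ => (mul_assoc _ _ _).symm
  simp only [h]
  rw [integral_finsetSum _ fun n _ => integrable_finsetSum _ fun m _ =>
    (ha.mul_ladder hS n m).integrable]
  refine Finset.sum_congr rfl fun n _ => ?_
  rw [integral_finsetSum _ fun m _ => (ha.mul_ladder hS n m).integrable]
  rfl

end Coefficients

/-! ### Cut-off weights -/

/-- The sum of the squares of the matrix entries. -/
def hs (v : Amb) : ℝ := Complex.normSq v.1 + Complex.normSq v.2.1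

lemma contDiff_hs : ContDiff ℝ ∞ hs := by
  have h : hs = fun v : Amb => ‖v.1‖ ^ 2 + ‖v.2.1‖ ^ 2 := by
    funext v
    rw [hs, Complex.sq_norm, Complex.sq_norm]
  rw [h]
  exact ((contDiff_norm_sq ℝ).comp contDiff_fst).add
    ((contDiff_norm_sq ℝ).comp (contDiff_fst.comp contDiff_snd))

lemma hs_pos {v : Amb} (hv : v ∈ dom) : 0 < hs v :=
  add_pos_of_nonneg_of_pos (Complex.normSq_nonneg _)
    (Complex.normSq_pos.2 (snd_ne_zero_of_mem_dom hv))

lemma hasDerivAt_hs_H (v : Amb) : ∃ d : ℝ, |d| ≤ hs v ∧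
    HasDerivAt (fun s : ℝ => hs (v + s • fieldH v)) d 0 := by
  refine ⟨v.1.re ^ 2 - v.1.im ^ 2 + (v.2.1.re ^ 2 - v.2.1.im ^ 2), ?_, ?_⟩
  · rw [hs, Complex.normSq_apply, Complex.normSq_apply, abs_le]
    constructor <;> nlinarith [sq_nonneg v.1.re, sq_nonneg v.1.im, sq_nonneg v.2.1.re,
      sq_nonneg v.2.1.im]
  · have h2 : (starRingEnd ℂ) 2 = 2 := map_ofNat _ 2
    have e : (fun s : ℝ => hs (v + s • fieldH v)) = fun s : ℝ =>
        (v.1.re ^ 2 + v.2.1.re ^ 2) * (1 + s / 2) ^ 2 +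
          (v.1.im ^ 2 + v.2.1.im ^ 2) * (1 - s / 2) ^ 2 := by
      funext s
      rw [hs, fieldH_apply, Complex.normSq_apply, Complex.normSq_apply]
      simp
      ring
    rw [e]
    have h3 : HasDerivAt (fun s : ℝ => (1 + s / 2) ^ 2) 1 0 := by
      simpa using (((hasDerivAt_id (0 : ℝ)).div_const 2).const_add 1).fun_pow 2
    have h4 : HasDerivAt (fun s : ℝ => (1 - s / 2) ^ 2) (-1) 0 := by
      simpa using (((hasDerivAt_id (0 : ℝ)).div_const 2).const_sub 1).fun_pow 2
    refine ((h3.const_mul _).add (h4.const_mul _)).congr_deriv ?_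
    ring

lemma hasDerivAt_hs_V (v : Amb) : ∃ d : ℝ, |d| ≤ hs v ∧
    HasDerivAt (fun s : ℝ => hs (v + s • fieldV v)) d 0 := by
  refine ⟨2 * v.1.re * v.1.im + 2 * v.2.1.re * v.2.1.im, ?_, ?_⟩
  · rw [hs, Complex.normSq_apply, Complex.normSq_apply, abs_le]
    constructor <;> nlinarith [sq_nonneg (v.1.re + v.1.im), sq_nonneg (v.1.re - v.1.im),
      sq_nonneg (v.2.1.re + v.2.1.im), sq_nonneg (v.2.1.re - v.2.1.im)]
  · have e : (fun s : ℝ => hs (v + s • fieldV v)) = fun s : ℝ => hs v * (1 + s ^ 2 / 4) +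
        s * (2 * v.1.re * v.1.im + 2 * v.2.1.re * v.2.1.im) := by
      funext s
      rw [hs, hs, fieldV_apply, Complex.normSq_apply, Complex.normSq_apply, Complex.normSq_apply,
        Complex.normSq_apply]
      simp
      ring
    rw [e]
    have h3 : HasDerivAt (fun s : ℝ => 1 + s ^ 2 / 4) 0 0 := by
      simpa using ((hasDerivAt_pow 2 (0 : ℝ)).div_const 4).const_add 1
    refine ((h3.const_mul _).add ((hasDerivAt_id (0 : ℝ)).mul_const _)).congr_deriv ?_
    ring

/-- The profile of the cut-off weights, in terms of `t = ‖g‖²`. The exponent is so large that the sum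
of `(t⁻³)² = ‖g‖⁻¹²` over an orbit of `Γ` is bounded. -/
def profile (R t : ℝ) : ℝ := (t ^ 3)⁻¹ * Real.smoothTransition (2 - t / R)

/-- The weight `‖g‖⁻⁶`, cut off at the radius `‖g‖² = R`. -/
def omega (R : ℝ) (v : Amb) : ℝ := profile R (hs v)

lemma profile_nonneg {R t : ℝ} (ht : 0 < t) : 0 ≤ profile R t :=
  mul_nonneg (by positivity) (Real.smoothTransition.nonneg _)

lemma omega_nonneg {R : ℝ} {v : Amb} (hv : v ∈ dom) : 0 ≤ omega R v := profile_nonneg (hs_pos hv)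

lemma exists_abs_deriv_smoothTransition_le : ∃ C, ∀ x, |deriv Real.smoothTransition x| ≤ C := by
  have hc : Continuous (deriv Real.smoothTransition) :=
    (Real.smoothTransition.contDiff (n := 1)).continuous_deriv le_rfl
  obtain ⟨C, hC⟩ := (isCompact_Icc (a := (0 : ℝ)) (b := 1)).exists_bound_of_continuousOn
    hc.continuousOn
  refine ⟨max C 0, fun x => ?_⟩
  by_cases hx : x ∈ Set.Icc (0 : ℝ) 1
  · exact (hC x hx).trans (le_max_left _ _)
  · have h0 : deriv Real.smoothTransition x = 0 := by
      rw [Set.mem_Icc, not_and_or, not_le, not_le] at hx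
      rcases hx with hx | hx
      · have : Real.smoothTransition =ᶠ[𝓝 x] fun _ => 0 := by
          filter_upwards [Iio_mem_nhds hx] with y hy
          exact Real.smoothTransition.zero_of_nonpos (le_of_lt hy)
        rw [this.deriv_eq, deriv_const]
      · have : Real.smoothTransition =ᶠ[𝓝 x] fun _ => 1 := by
          filter_upwards [Ioi_mem_nhds hx] with y hy
          exact Real.smoothTransition.one_of_one_le (le_of_lt hy)
        rw [this.deriv_eq, deriv_const]
    rw [h0, abs_zero]
    exact le_max_right _ _

lemma contDiffAt_profile (R : ℝ) {t : ℝ} (ht : 0 < t) : ContDiffAt ℝ ∞ (profile R) t := by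
  refine ((contDiffAt_id.pow 3).inv (by positivity)).mul ?_
  exact Real.smoothTransition.contDiff.contDiffAt.comp t
    (contDiffAt_const.sub (contDiffAt_id.div_const R))

/-- The profile varies slowly on the logarithmic scale. -/
lemma exists_mul_abs_deriv_profile_le :
    ∃ C, 0 ≤ C ∧ ∀ R > 0, ∀ t > 0, t * |deriv (profile R) t| ≤ C * profile (2 * R) t := by
  obtain ⟨C, hC⟩ := exists_abs_deriv_smoothTransition_le
  have hC0 : 0 ≤ C := (abs_nonneg _).trans (hC 0)
  refine ⟨3 + 2 * C, by positivity, fun R hR t ht => ?_⟩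
  by_cases htR : t ≤ 2 * R
  · have h1 : HasDerivAt (fun t : ℝ => (t ^ 3)⁻¹) (-(3 * t ^ 2) / (t ^ 3) ^ 2) t := by
      simpa using (hasDerivAt_pow 3 t).fun_inv (by positivity)
    have h2 : HasDerivAt (fun t : ℝ => Real.smoothTransition (2 - t / R))
        (deriv Real.smoothTransition (2 - t / R) * (-(1 / R))) t := by
      have h3 : HasDerivAt (fun t : ℝ => 2 - t / R) (-(1 / R)) t :=
        ((hasDerivAt_id t).div_const R).const_sub 2
      exact ((Real.smoothTransition.contDiff (n := 1)).differentiable (by simp)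
        (2 - t / R)).hasDerivAt.comp t h3
    have hd : deriv (profile R) t = _ := (h1.mul h2).deriv
    have hone : profile (2 * R) t = (t ^ 3)⁻¹ := by
      rw [profile, Real.smoothTransition.one_of_one_le, mul_one]
      have : t / (2 * R) ≤ 1 := (div_le_one (by positivity)).2 htR
      linarith
    rw [hd, hone]
    have e : -(3 * t ^ 2) / (t ^ 3) ^ 2 * Real.smoothTransition (2 - t / R) +
        (t ^ 3)⁻¹ * (deriv Real.smoothTransition (2 - t / R) * (-(1 / R))) =
        (t ^ 3)⁻¹ * t⁻¹ * (-3 * Real.smoothTransition (2 - t / R) -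
          deriv Real.smoothTransition (2 - t / R) * (t / R)) := by
      field_simp
      ring
    rw [e, abs_mul, abs_of_pos (by positivity : 0 < (t ^ 3)⁻¹ * t⁻¹)]
    have hb : |-3 * Real.smoothTransition (2 - t / R) -
        deriv Real.smoothTransition (2 - t / R) * (t / R)| ≤ 3 + 2 * C := by
      refine (abs_sub _ _).trans (add_le_add ?_ ?_)
      · rw [abs_mul, abs_of_nonneg (Real.smoothTransition.nonneg _)]
        have := Real.smoothTransition.le_one (2 - t / R)
        norm_num
        linarith
      · rw [abs_mul, mul_comm, abs_of_pos (by positivity : 0 < t / R)]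
        exact mul_le_mul ((div_le_iff₀ hR).2 htR) (hC _) (abs_nonneg _) zero_le_two
    calc t * ((t ^ 3)⁻¹ * t⁻¹ * _) = (t ^ 3)⁻¹ * |-3 * Real.smoothTransition (2 - t / R) -
        deriv Real.smoothTransition (2 - t / R) * (t / R)| := by field_simp
      _ ≤ (t ^ 3)⁻¹ * (3 + 2 * C) := by gcongr
      _ = _ := mul_comm _ _
  · have h0 : deriv (profile R) t = 0 := by
      have : profile R =ᶠ[𝓝 t] fun _ => 0 := by
        filter_upwards [Ioi_mem_nhds (not_le.1 htR)] with y hy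
        rw [profile, Real.smoothTransition.zero_of_nonpos, mul_zero]
        have : 2 < y / R := (lt_div_iff₀ hR).2 hy
        linarith
      rw [this.deriv_eq, deriv_const]
    rw [h0, abs_zero, mul_zero]
    exact mul_nonneg (by positivity) (profile_nonneg ht)

lemma contDiffOn_omega (R : ℝ) : ContDiffOn ℝ ∞ (fun v => (omega R v : ℂ)) dom := by
  intro v hv
  have h : ContDiffAt ℝ ∞ (omega R) v :=
    (contDiffAt_profile R (hs_pos hv)).comp v contDiff_hs.contDiffAt
  exact (Complex.ofRealCLM.contDiff.contDiffAt.comp v h).contDiffWithinAt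

lemma norm_lieD_omega_le {L : Amb →L[ℝ] Amb} {R : ℝ} {v : Amb} (hv : v ∈ dom)
    (h : ∃ d : ℝ, |d| ≤ hs v ∧ HasDerivAt (fun s : ℝ => hs (v + s • L v)) d 0) :
    ‖lieD L (fun v => (omega R v : ℂ)) v‖ ≤ hs v * |deriv (profile R) (hs v)| := by
  obtain ⟨d, hd, h⟩ := h
  have h1 := hasDerivAt_line (differentiableAt_of_contDiffOn (contDiffOn_omega R) hv) L
  have h2 : HasDerivAt (profile R) (deriv (profile R) (hs v)) (hs (v + (0 : ℝ) • L v)) := by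
    rw [zero_smul, add_zero]
    exact ((contDiffAt_profile R (hs_pos hv)).differentiableAt (by simp)).hasDerivAt
  have h3 : HasDerivAt (fun s : ℝ => ((omega R (v + s • L v) : ℝ) : ℂ))
      ((deriv (profile R) (hs v) * d : ℝ) : ℂ) 0 := (h2.comp (0 : ℝ) h).ofReal_comp
  rw [h1.unique h3, Complex.norm_real, Real.norm_eq_abs, abs_mul, mul_comm]
  exact mul_le_mul_of_nonneg_right hd (abs_nonneg _)

/-- The weight `ω_R` varies slowly along the raising operator. -/
lemma exists_norm_opE_omega_le : ∃ C, 0 ≤ C ∧ ∀ R > 0, ∀ v ∈ dom,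
    ‖opE (fun v => (omega R v : ℂ)) v‖ ≤ C * omega (2 * R) v := by
  obtain ⟨C, hC0, hC⟩ := exists_mul_abs_deriv_profile_le
  refine ⟨2 * C, by positivity, fun R hR v hv => ?_⟩
  have h1 := norm_lieD_omega_le (R := R) hv (hasDerivAt_hs_H v)
  have h2 := norm_lieD_omega_le (R := R) hv (hasDerivAt_hs_V v)
  have h3 := hC R hR (hs v) (hs_pos hv)
  rw [opE]
  refine (norm_add_le _ _).trans ?_
  rw [norm_mul, Complex.norm_I, one_mul]
  rw [omega]
  linarith

lemma isCompact_setOf_hs_le (T : ℝ) : IsCompact {p : SL(2, ℝ) × S3 | hs (emb p) ≤ T} := by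
  have hK : IsCompact (Metric.closedBall (0 : Amb) (max (√T) 1)) := isCompact_closedBall _ _
  have h := isClosedEmbedding_emb.isCompact_preimage hK
  refine h.of_isClosed_subset
    (isClosed_le (contDiff_hs.continuous.comp continuous_emb) continuous_const) fun p hp => ?_
  have hp' : hs (emb p) ≤ T := hp
  have hn : ∀ z : ℂ, Complex.normSq z ≤ T → ‖z‖ ≤ √T := fun z hz => by
    apply Real.le_sqrt_of_sq_le
    rwa [Complex.sq_norm]
  have h1 := hn (emb p).1 (by
    have := Complex.normSq_nonneg (emb p).2.1
    rw [hs] at hp'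
    linarith)
  have h2 := hn (emb p).2.1 (by
    have := Complex.normSq_nonneg (emb p).1
    rw [hs] at hp'
    linarith)
  have h3 : ‖(emb p).2.2‖ = 1 := mem_sphere_zero_iff_norm.1 p.2.2
  rw [Set.mem_preimage, mem_closedBall_zero_iff, Prod.norm_def, Prod.norm_def]
  exact max_le (h1.trans (le_max_left _ _))
    (max_le (h2.trans (le_max_left _ _)) (h3.le.trans (le_max_right _ _)))

lemma isTest_omega {R : ℝ} (hR : 0 < R) : IsTest fun v => (omega R v : ℂ) := by
  refine ⟨contDiffOn_omega R, HasCompactSupport.intro (isCompact_setOf_hs_le (2 * R)) fun p hp => ?_⟩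
  have hp' : 2 * R < hs (emb p) := not_le.1 hp
  rw [omega, profile, Real.smoothTransition.zero_of_nonpos, mul_zero, Complex.ofReal_zero]
  have : 2 < hs (emb p) / R := (lt_div_iff₀ hR).2 hp'
  linarith

/-- Every test function is dominated by a multiple of one of the weights. -/
lemma IsTest.exists_norm_le {a : Amb → ℂ} (ha : IsTest a) :
    ∃ C R, 0 ≤ C ∧ 1 ≤ R ∧ ∀ p, ‖a (emb p)‖ ≤ C * omega R (emb p) ^ 2 := by
  have hK : IsCompact (tsupport fun p => a (emb p)) := ha.hasCompactSupport
  obtain ⟨T, hT⟩ := hK.exists_bound_of_continuousOn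
    (contDiff_hs.continuous.comp continuous_emb).continuousOn
  obtain ⟨B, hB⟩ := ha.continuous.bounded_above_of_compact_support ha.hasCompactSupport
  have hB0 : 0 ≤ B := (norm_nonneg _).trans (hB (1, radial 0))
  set R := max T 1 with hR
  have hR1 : 1 ≤ R := le_max_right _ _
  refine ⟨B * (R ^ 3) ^ 2, R, by positivity, hR1, fun p => ?_⟩
  by_cases hp : p ∈ tsupport fun p => a (emb p)
  · have h1 : hs (emb p) ≤ R := (le_abs_self _).trans ((hT p hp).trans (le_max_left _ _))
    have h2 := hs_pos (emb_mem_dom p)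
    have h3 : (R ^ 3)⁻¹ ≤ omega R (emb p) := by
      rw [omega, profile, Real.smoothTransition.one_of_one_le, mul_one]
      · gcongr
      · have : hs (emb p) / R ≤ 1 := (div_le_one (by positivity)).2 h1
        linarith
    calc ‖a (emb p)‖ ≤ B := hB p
      _ = B * (R ^ 3) ^ 2 * ((R ^ 3)⁻¹) ^ 2 := by field_simp
      _ ≤ _ := by gcongr
  · rw [image_eq_zero_of_notMem_tsupport hp, norm_zero]
    positivity

/-! ### Uniform bounds for the ladder -/

/-- The weighted mass of the `n`-th function of the ladder. -/
def energy (S : ℤ → Amb → ℂ) (n : ℤ) (R : ℝ) : ℝ :=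
  ∫ p, omega R (emb p) ^ 2 * ‖S n (emb p)‖ ^ 2 ∂volP

section Energy

variable {r : ℝ} {S : ℤ → Amb → ℂ} {a b : Amb → ℂ}

lemma continuous_omega_emb (R : ℝ) : Continuous fun p => omega R (emb p) := by
  have h := Complex.continuous_re.comp
    (contDiffOn_comp_emb_continuous (contDiffOn_omega R).continuousOn)
  simpa [Function.comp_def] using h

lemma IsLadder.continuous (hS : IsLadder r S) (n : ℤ) : Continuous fun p => S n (emb p) :=
  contDiffOn_comp_emb_continuous (hS.smooth n).continuousOn

lemma hasCompactSupport_omega {R : ℝ} (hR : 0 < R) : HasCompactSupport fun p => omega R (emb p) := by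
  have h := (isTest_omega hR).hasCompactSupport.comp_left (g := Complex.re) Complex.zero_re
  simpa [Function.comp_def] using h

lemma integrable_energy (hS : IsLadder r S) (n : ℤ) {R : ℝ} (hR : 0 < R) :
    Integrable (fun p => omega R (emb p) ^ 2 * ‖S n (emb p)‖ ^ 2) volP := by
  refine Continuous.integrable_of_hasCompactSupport
    (((continuous_omega_emb R).pow 2).mul ((hS.continuous n).norm.pow 2)) ?_
  have h := (hasCompactSupport_omega hR).comp_left (g := fun x : ℝ => x ^ 2) (by simp)
  exact h.mul_right (f' := fun p => ‖S n (emb p)‖ ^ 2)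

lemma energy_nonneg (S : ℤ → Amb → ℂ) (n : ℤ) (R : ℝ) : 0 ≤ energy S n R :=
  integral_nonneg fun _ => by positivity

/-- The Cauchy–Schwarz bound for matrix coefficients. -/
lemma norm_coef_le (hS : IsLadder r S) {C R R' : ℝ} (hC : 0 ≤ C) (hR : 0 < R) (hR' : 0 < R')
    (hb : ∀ p, ‖b (emb p)‖ ≤ C * (omega R (emb p) * omega R' (emb p))) (n m : ℤ) :
    ‖coef S b n m‖ ≤ C / 2 * (energy S n R + energy S m R') := by
  have hi := ((integrable_energy hS n hR).add (integrable_energy hS m hR')).const_mul (C / 2)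
  refine (norm_integral_le_of_norm_le hi (Eventually.of_forall fun p => ?_)).trans_eq ?_
  · rw [norm_mul, norm_mul, RCLike.norm_conj]
    have h0 := two_mul_le_add_sq (omega R (emb p) * ‖S n (emb p)‖) (omega R' (emb p) * ‖S m (emb p)‖)
    calc ‖b (emb p)‖ * ‖S n (emb p)‖ * ‖S m (emb p)‖
        ≤ C * (omega R (emb p) * omega R' (emb p)) * ‖S n (emb p)‖ * ‖S m (emb p)‖ := by
          gcongr
          exact hb p
      _ = C / 2 * (2 * (omega R (emb p) * ‖S n (emb p)‖) * (omega R' (emb p) * ‖S m (emb p)‖)) := by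
          ring
      _ ≤ C / 2 * ((omega R (emb p) * ‖S n (emb p)‖) ^ 2 +
          (omega R' (emb p) * ‖S m (emb p)‖) ^ 2) := by gcongr
      _ = _ := by
          simp only [Pi.add_apply]
          ring
  · simp only [Pi.add_apply]
    rw [integral_const_mul, integral_add (integrable_energy hS n hR) (integrable_energy hS m hR')]
    rfl

lemma coef_omega (S : ℤ → Amb → ℂ) (n : ℤ) (R : ℝ) :
    coef S (fun v => (omega R v : ℂ) * (omega R v : ℂ)) n n = (energy S n R : ℂ) := by
  rw [coef, energy, ← integral_complex_ofReal]
  congr 1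
  funext p
  rw [mul_assoc, Complex.mul_conj, Complex.normSq_eq_norm_sq]
  push_cast
  ring

lemma le_norm_ladder_coeff (r : ℝ) (n : ℤ) : r ≤ ‖(Complex.I * r + 1 / 2 + n : ℂ)‖ := by
  refine le_trans ?_ (Complex.abs_im_le_norm _)
  refine le_trans (le_abs_self r) (le_of_eq ?_)
  congr 1
  simp

lemma exists_energy_succ_sub_le : ∃ C, 0 < C ∧ ∀ (r : ℝ) (S : ℤ → Amb → ℂ), IsLadder r S →
    ∀ (n : ℤ) (R : ℝ), 1 ≤ R →
      r * |energy S (n + 1) R - energy S n R| ≤ C * (energy S n (2 * R) + energy S (n + 1) R) ∧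
      r * |energy S (n + 1) R - energy S n R| ≤ C * (energy S n R + energy S (n + 1) (2 * R)) := by
  obtain ⟨C, hC0, hC⟩ := exists_norm_opE_omega_le
  refine ⟨C + 1, by positivity, fun r S hS n R hR => ?_⟩
  have hR0 : 0 < R := by linarith
  have ht := (isTest_omega hR0).mul_right (contDiffOn_omega R)
  have h1 := mul_coef_succ_sub ht hS n n
  rw [coef_opW ht hS, sub_self, zero_mul, zero_sub, coef_omega, coef_omega] at h1
  have h2 : r * |energy S (n + 1) R - energy S n R| ≤
      ‖coef S (opE fun v => (omega R v : ℂ) * (omega R v : ℂ)) n (n + 1)‖ := by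
    have h3 := congrArg norm h1
    rw [norm_neg, norm_mul, ← Complex.ofReal_sub, Complex.norm_real, Real.norm_eq_abs] at h3
    rw [← h3]
    exact mul_le_mul_of_nonneg_right (le_norm_ladder_coeff r n) (abs_nonneg _)
  have hb : ∀ p, ‖opE (fun v => (omega R v : ℂ) * (omega R v : ℂ)) (emb p)‖ ≤
      2 * C * (omega R (emb p) * omega (2 * R) (emb p)) := by
    intro p
    have hp := emb_mem_dom p
    have h4 := hC R hR0 _ hp
    have h5 := omega_nonneg (R := R) hp
    rw [opE_mul (contDiffOn_omega R) (contDiffOn_omega R) hp]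
    refine (norm_add_le _ _).trans ?_
    rw [norm_mul, norm_mul, Complex.norm_real, Real.norm_eq_abs, abs_of_nonneg h5]
    nlinarith
  have e : ∀ x y : ℝ, 0 ≤ x → 0 ≤ y → 2 * C / 2 * (x + y) ≤ (C + 1) * (x + y) := fun x y hx hy => by
    nlinarith
  constructor
  · refine h2.trans ((norm_coef_le hS (by positivity) (by positivity) hR0 (fun p => ?_) n
      (n + 1)).trans (e _ _ (energy_nonneg _ _ _) (energy_nonneg _ _ _)))
    rw [mul_comm (omega _ _)]
    exact hb p
  · exact h2.trans ((norm_coef_le hS (by positivity) hR0 (by positivity) hb n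
      (n + 1)).trans (e _ _ (energy_nonneg _ _ _) (energy_nonneg _ _ _)))

/-- Energies grow by a bounded factor along the first `r` steps of a ladder, since one step
multiplies them by `1 + O(1/r)` at most. -/
lemma exists_energy_le : ∃ C, 1 ≤ C ∧ ∀ (r : ℝ) (S : ℤ → Amb → ℂ) (B : ℝ), IsLadder r S → C ≤ r →
    (∀ R, 1 ≤ R → energy S 0 R ≤ B) →
      ∀ n : ℤ, |(n : ℝ)| ≤ r → ∀ R, 1 ≤ R → energy S n R ≤ C * B := by
  obtain ⟨C, hC0, hC⟩ := exists_energy_succ_sub_le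
  refine ⟨max (max 1 (2 * C)) (Real.exp (4 * C)), le_trans (le_max_left _ _) (le_max_left _ _),
    fun r S B hS hr hB n hn R hR => ?_⟩
  have hr1 : 1 ≤ r := (le_max_left _ _).trans ((le_max_left _ _).trans hr)
  have hr2 : 2 * C ≤ r := (le_max_right _ _).trans ((le_max_left _ _).trans hr)
  have hB0 : 0 ≤ B := (energy_nonneg S 0 1).trans (hB 1 le_rfl)
  have hr0 : 0 < r := by linarith
  have hx : C / r ≤ 1 / 2 := by
    rw [div_le_div_iff₀ hr0 two_pos]
    linarith
  have hx0 : 0 ≤ C / r := by positivity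
  -- one step, in either direction
  have hstep : ∀ D x y z : ℝ, 0 ≤ D → y ≤ D → z ≤ D → r * |x - y| ≤ C * (z + x) →
      x ≤ D * (1 + 4 * (C / r)) := by
    intro D x y z hD hy hz h
    have h1 : |x - y| ≤ C / r * (z + x) := by
      rw [div_mul_eq_mul_div, le_div_iff₀ hr0]
      linarith
    have h2 : x ≤ D + C / r * (D + x) := by
      have := le_abs_self (x - y)
      have := mul_le_mul_of_nonneg_left hz hx0
      nlinarith
    by_contra! hlt
    nlinarith [mul_pos (by linarith : 0 < 1 - C / r) (sub_pos.2 hlt), mul_nonneg hD hx0,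
      mul_nonneg (mul_nonneg hD hx0) (by linarith : 0 ≤ 1 / 2 - C / r)]
  have hpow : ∀ k : ℕ, 0 ≤ B * (1 + 4 * (C / r)) ^ k := fun k => by positivity
  have hup : ∀ k : ℕ, ∀ R, 1 ≤ R → energy S k R ≤ B * (1 + 4 * (C / r)) ^ k := by
    intro k
    induction k with
    | zero => simpa using hB
    | succ k ih =>
      intro R hR
      have h := (hC r S hS k R hR).1
      rw [pow_succ, ← mul_assoc]
      push_cast
      exact hstep _ _ _ _ (hpow k) (ih R hR) (ih (2 * R) (by linarith)) h
  have hdown : ∀ k : ℕ, ∀ R, 1 ≤ R → energy S (-(k : ℤ)) R ≤ B * (1 + 4 * (C / r)) ^ k := by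
    intro k
    induction k with
    | zero => simpa using hB
    | succ k ih =>
      intro R hR
      have h := (hC r S hS (-((k + 1 : ℕ) : ℤ)) R hR).2
      rw [show -((k + 1 : ℕ) : ℤ) + 1 = -(k : ℤ) by push_cast; ring, abs_sub_comm,
        add_comm (energy S _ R)] at h
      rw [pow_succ, ← mul_assoc]
      exact hstep _ _ _ _ (hpow k) (ih R hR) (ih (2 * R) (by linarith)) h
  have hexp : ∀ k : ℕ, (k : ℝ) ≤ r → B * (1 + 4 * (C / r)) ^ k ≤
      max (max 1 (2 * C)) (Real.exp (4 * C)) * B := by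
    intro k hk
    rw [mul_comm]
    refine mul_le_mul_of_nonneg_right (le_trans ?_ (le_max_right _ _)) hB0
    calc (1 + 4 * (C / r)) ^ k ≤ Real.exp (4 * (C / r)) ^ k := by
          gcongr
          linarith [Real.add_one_le_exp (4 * (C / r))]
      _ = Real.exp (k * (4 * (C / r))) := (Real.exp_nat_mul _ _).symm
      _ ≤ Real.exp (4 * C) := by
          apply Real.exp_le_exp.2
          calc (k : ℝ) * (4 * (C / r)) ≤ r * (4 * (C / r)) := by gcongr
            _ = 4 * C := by field_simp
  obtain ⟨k, rfl | rfl⟩ := n.eq_nat_or_neg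
  · exact (hup k R hR).trans (hexp k (by simpa using hn))
  · exact (hdown k R hR).trans (hexp k (by simpa using hn))

/-- The energies of the functions of index at most `M` are bounded by `B`. -/
def EnergyBound (B M : ℝ) (S : ℤ → Amb → ℂ) : Prop :=
  ∀ n : ℤ, |(n : ℝ)| ≤ M → ∀ R, 1 ≤ R → energy S n R ≤ B

variable {B : ℝ}

/-- Rapid decay of the coefficients off the diagonal. -/
lemma IsTest.exists_norm_coef_le (ha : IsTest a) (hB : 0 ≤ B) : ∃ C, 0 ≤ C ∧
    ∀ (r M : ℝ) (S : ℤ → Amb → ℂ), IsLadder r S → EnergyBound B M S →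
      ∀ n m : ℤ, |(n : ℝ)| ≤ M → |(m : ℝ)| ≤ M →
        ‖coef S a n m‖ ≤ C * (1 + ((n : ℝ) - m) ^ 2)⁻¹ := by
  have ht : IsTest fun v => a v - MicrolocalLift.opW (MicrolocalLift.opW a) v := ha.sub ha.opW.opW
  obtain ⟨C, R, hC, hR, hb⟩ := ht.exists_norm_le
  refine ⟨C / 2 * (B + B), by positivity, fun r M S hS hM n m hn hm => ?_⟩
  have hR0 : 0 < R := by linarith
  have h1 := norm_coef_le (b := fun v => a v - MicrolocalLift.opW (MicrolocalLift.opW a) v) hS hC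
    hR0 hR0 (fun p => (hb p).trans_eq (by rw [pow_two])) n m
  rw [← one_add_sq_mul_coef ha hS, norm_mul] at h1
  have h2 : ‖(1 + ((n : ℂ) - m) ^ 2 : ℂ)‖ = 1 + ((n : ℝ) - m) ^ 2 := by
    rw [show (1 + ((n : ℂ) - m) ^ 2 : ℂ) = ((1 + ((n : ℝ) - m) ^ 2 : ℝ) : ℂ) by push_cast; rfl,
      Complex.norm_real, Real.norm_eq_abs, abs_of_nonneg (by positivity)]
  rw [h2] at h1
  rw [← div_eq_mul_inv, le_div_iff₀ (by positivity), mul_comm]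
  refine h1.trans ?_
  gcongr
  · exact hM n hn R hR
  · exact hM m hm R hR

lemma one_add_sub_one_sq_inv_le (x : ℝ) : (1 + (x - 1) ^ 2)⁻¹ ≤ 3 * (1 + x ^ 2)⁻¹ := by
  rw [← div_eq_mul_inv, ← one_div, div_le_div_iff₀ (by positivity) (by positivity)]
  nlinarith [sq_nonneg (2 * x - 3)]

/-- The coefficients vary slowly along the diagonals. -/
lemma IsTest.exists_norm_coef_succ_sub_le (ha : IsTest a) (hB : 0 ≤ B) : ∃ C, 0 ≤ C ∧
    ∀ (r M : ℝ) (S : ℤ → Amb → ℂ), 0 < r → IsLadder r S → EnergyBound B M S →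
      ∀ n m : ℤ, |(n : ℝ)| ≤ M → |(m : ℝ)| ≤ M → |(m + 1 : ℝ)| ≤ M →
        ‖coef S a (n + 1) (m + 1) - coef S a n m‖ ≤ C / r * (1 + ((n : ℝ) - m) ^ 2)⁻¹ := by
  obtain ⟨C₁, h₁, hC₁⟩ := ha.opW.exists_norm_coef_le hB
  obtain ⟨C₂, h₂, hC₂⟩ := ha.opE.exists_norm_coef_le hB
  refine ⟨C₁ + 3 * C₂, by positivity, fun r M S hr hS hM n m hn hm hm1 => ?_⟩
  have h := congrArg norm (mul_coef_succ_sub ha hS n m)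
  rw [norm_mul] at h
  have h3 : ‖Complex.I * coef S (MicrolocalLift.opW a) n m -
      coef S (MicrolocalLift.opE a) n (m + 1)‖ ≤ (C₁ + 3 * C₂) * (1 + ((n : ℝ) - m) ^ 2)⁻¹ := by
    refine (norm_sub_le _ _).trans ?_
    rw [norm_mul, Complex.norm_I, one_mul]
    have e1 := hC₁ r M S hS hM n m hn hm
    have e2 := hC₂ r M S hS hM n (m + 1) hn (by push_cast; exact hm1)
    have e3 := one_add_sub_one_sq_inv_le ((n : ℝ) - m)
    push_cast at e2
    rw [← sub_sub] at e2
    nlinarith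
  have h4 := mul_le_mul_of_nonneg_right (le_norm_ladder_coeff r n)
    (norm_nonneg (coef S a (n + 1) (m + 1) - coef S a n m))
  rw [div_mul_eq_mul_div, le_div_iff₀ hr, mul_comm]
  linarith

/-- The weighted sum of the coefficients of `E⁺ a` and `E⁻ a` is small. -/
lemma IsTest.exists_norm_coef_opE_add_coef_opF_le (ha : IsTest a) (hB : 0 ≤ B) : ∃ C, 0 ≤ C ∧
    ∀ (r : ℝ) (N : ℕ) (S : ℤ → Amb → ℂ), 0 < r → IsLadder r S → EnergyBound B (N + 1) S →
      ∀ n m : ℤ, |(n : ℝ)| ≤ N → |(m : ℝ)| ≤ N →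
        ‖coef S (MicrolocalLift.opE a) n (m + 1) + coef S (MicrolocalLift.opF a) n (m - 1)‖ ≤
          C * (N + 1) / r * (1 + ((n : ℝ) - m) ^ 2)⁻¹ := by
  obtain ⟨C₁, h₁, hC₁⟩ := ha.opW.exists_norm_coef_succ_sub_le hB
  obtain ⟨C₂, h₂, hC₂⟩ := ha.opE.exists_norm_coef_succ_sub_le hB
  obtain ⟨C₃, h₃, hC₃⟩ := ha.exists_norm_coef_succ_sub_le hB
  refine ⟨C₁ + 3 * C₂ + 2 * C₃, by positivity, fun r N S hr hS hM n m hn hm => ?_⟩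
  rw [coef_opE_add_coef_opF ha hS]
  have hn' := abs_le.1 hn
  have hm' := abs_le.1 hm
  have hn1 : |((n - 1 : ℤ) : ℝ)| ≤ N + 1 := by
    push_cast
    rw [abs_le]
    constructor <;> linarith
  have hm1 : |((m - 1 : ℤ) : ℝ)| ≤ N + 1 := by
    push_cast
    rw [abs_le]
    constructor <;> linarith
  have hm2 : |(m + 1 : ℝ)| ≤ N + 1 := by
    rw [abs_le]
    constructor <;> linarith
  have e1 := hC₁ r _ S hr hS hM (n - 1) (m - 1) hn1 hm1 (by push_cast; rw [sub_add_cancel]; linarith)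
  have e2 := hC₂ r _ S hr hS hM (n - 1) m hn1 (by linarith) hm2
  have e3 := hC₃ r _ S hr hS hM (n - 1) (m - 1) hn1 hm1 (by push_cast; rw [sub_add_cancel]; linarith)
  have e4 := one_add_sub_one_sq_inv_le ((n : ℝ) - m)
  push_cast at e1 e2 e3
  rw [sub_sub_sub_cancel_right, sub_add_cancel, sub_add_cancel] at e1 e3
  rw [sub_add_cancel, sub_right_comm] at e2
  set d := (1 + ((n : ℝ) - m) ^ 2)⁻¹ with hd
  have hd0 : 0 ≤ d := by positivity
  have hN : (1 : ℝ) ≤ N + 1 := by linarith [(Nat.cast_nonneg N : (0 : ℝ) ≤ N)]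
  have hc : ‖(2 * n - 1 : ℂ)‖ ≤ 2 * (N + 1) := by
    rw [show (2 * n - 1 : ℂ) = ((2 * n - 1 : ℝ) : ℂ) by push_cast; rfl, Complex.norm_real,
      Real.norm_eq_abs, abs_le]
    constructor <;> linarith
  refine (norm_sub_le _ _).trans ?_
  rw [norm_neg, norm_mul]
  have e5 : ‖Complex.I * (coef S (MicrolocalLift.opW a) n m -
      coef S (MicrolocalLift.opW a) (n - 1) (m - 1)) -
      (coef S (MicrolocalLift.opE a) n (m + 1) - coef S (MicrolocalLift.opE a) (n - 1) m)‖ ≤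
      C₁ / r * d + C₂ / r * (3 * d) := by
    refine (norm_sub_le _ _).trans (add_le_add ?_ ?_)
    · rwa [norm_mul, Complex.norm_I, one_mul]
    · exact e2.trans (mul_le_mul_of_nonneg_left e4 (by positivity))
  calc _ ≤ (C₁ / r * d + C₂ / r * (3 * d)) + 2 * (N + 1) * (C₃ / r * d) :=
        add_le_add e5 (mul_le_mul hc e3 (norm_nonneg _) (by positivity))
    _ = ((C₁ + 3 * C₂) * 1 + 2 * C₃ * (N + 1)) / r * d := by ring
    _ ≤ ((C₁ + 3 * C₂) * (N + 1) + 2 * C₃ * (N + 1)) / r * d := by gcongr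
    _ = _ := by ring

end Energy

/-! ### Asymptotics of the partial sums of the ladder -/

lemma exists_sum_inv_one_add_sq_le : ∃ K : ℝ, 0 ≤ K ∧ ∀ (s : Finset ℤ) (n : ℤ),
    ∑ m ∈ s, (1 + ((n : ℝ) - m) ^ 2)⁻¹ ≤ K := by
  have hs : Summable fun k : ℤ => (1 + (k : ℝ) ^ 2)⁻¹ := by
    refine Summable.of_nonneg_of_le (fun k => by positivity) (fun k => ?_)
      ((Real.summable_one_div_int_pow.2 one_lt_two).add (hasSum_ite_eq (0 : ℤ) (1 : ℝ)).summable)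
    rcases eq_or_ne k 0 with rfl | hk
    · simp
    · have : (0 : ℝ) < (k : ℝ) ^ 2 := by positivity
      rw [if_neg hk, add_zero, one_div]
      gcongr
      linarith
  refine ⟨∑' k : ℤ, (1 + (k : ℝ) ^ 2)⁻¹, tsum_nonneg fun k => by positivity, fun s n => ?_⟩
  have h1 := (Equiv.subLeft n).tsum_eq fun k : ℤ => (1 + (k : ℝ) ^ 2)⁻¹
  have h2 := ((Equiv.subLeft n).summable_iff.2 hs).sum_le_tsum s fun m _ => by
    simp only [Function.comp_apply]
    positivity
  simp only [Function.comp_apply, Equiv.subLeft_apply, Int.cast_sub] at h1 h2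
  rwa [h1] at h2

/-- A telescoping sum over a symmetric interval. -/
lemma sum_Icc_neg_sub (f : ℤ → ℂ) (N : ℕ) :
    ∑ m ∈ Finset.Icc (-(N : ℤ)) N, (f m - f (m + 1)) = f (-N) - f (N + 1) := by
  rw [Finset.sum_sub_distrib]
  have h1 : ∑ m ∈ Finset.Icc (-(N : ℤ)) N, f (m + 1) =
      ∑ m ∈ Finset.Icc (-(N : ℤ) + 1) (N + 1), f m := by
    rw [← Finset.map_add_right_Icc, Finset.sum_map]
    rfl
  have h2 : insert (-(N : ℤ)) (Finset.Icc (-(N : ℤ) + 1) (N + 1)) =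
      insert ((N : ℤ) + 1) (Finset.Icc (-(N : ℤ)) N) := by
    ext m
    simp only [Finset.mem_insert, Finset.mem_Icc]
    omega
  have h3 := congrArg (fun s => ∑ m ∈ s, f m) h2
  rw [Finset.sum_insert (by simp), Finset.sum_insert (by simp)] at h3
  rw [h1]
  linear_combination -h3

section

variable {a : Amb → ℂ} {B : ℝ}

lemma abs_le_of_mem_Icc_neg {N : ℕ} {n : ℤ} (hn : n ∈ Finset.Icc (-(N : ℤ)) N) :
    |(n : ℝ)| ≤ N := by
  rw [Finset.mem_Icc] at hn
  rw [abs_le]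
  exact ⟨by exact_mod_cast hn.1, by exact_mod_cast hn.2⟩

lemma card_Icc_neg (N : ℕ) : ((Finset.Icc (-(N : ℤ)) N).card : ℝ) = 2 * N + 1 := by
  rw [Int.card_Icc]
  have : ((N : ℤ) + 1 - -(N : ℤ)).toNat = 2 * N + 1 := by omega
  rw [this]
  push_cast
  ring

/-- The derivative of a test function along the geodesic flow has small integral against the
square of a partial sum of the ladder. -/
lemma IsTest.exists_norm_integral_lieD_mul_le (ha : IsTest a) (hB : 0 ≤ B) : ∃ C, 0 ≤ C ∧
    ∀ (r : ℝ) (N : ℕ) (S : ℤ → Amb → ℂ), 0 < r → IsLadder r S → EnergyBound B (N + 1) S →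
      ‖∫ p, MicrolocalLift.lieD fieldH a (emb p) *
          ((∑ n ∈ Finset.Icc (-(N : ℤ)) N, S n (emb p)) *
            (starRingEnd ℂ) (∑ n ∈ Finset.Icc (-(N : ℤ)) N, S n (emb p))) ∂volP‖ ≤
        C * (1 + (2 * N + 1) * (N + 1) / r) := by
  obtain ⟨K, hK0, hK⟩ := exists_sum_inv_one_add_sq_le
  obtain ⟨C₁, h₁, hC₁⟩ := ha.opE.exists_norm_coef_le hB
  obtain ⟨C₂, h₂, hC₂⟩ := ha.opF.exists_norm_coef_le hB
  obtain ⟨C₃, h₃, hC₃⟩ := ha.exists_norm_coef_opE_add_coef_opF_le hB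
  refine ⟨(2 * C₁ + 2 * C₂ + C₃) * K, by positivity, fun r N S hr hS hM => ?_⟩
  have hH := ha.lieD isFlow_geo
  rw [integral_mul_sum_mul_conj hH hS]
  set I := Finset.Icc (-(N : ℤ)) N with hI
  set E := coef S (MicrolocalLift.opE a) with hE
  set F := coef S (MicrolocalLift.opF a) with hF
  have hEF : ∀ n m, 2 * coef S (MicrolocalLift.lieD fieldH a) n m = E n m + F n m := by
    intro n m
    rw [hE, hF, ← coef_add ha.opE ha.opF hS, coef, coef, ← integral_const_mul]
    congr 1
    funext p
    rw [MicrolocalLift.opE, MicrolocalLift.opF]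
    ring
  have hbd : ∀ (G : ℤ → ℂ) (C : ℝ) (m : ℤ), (∀ n ∈ I, ‖G n‖ ≤ C * (1 + ((n : ℝ) - m) ^ 2)⁻¹) →
      0 ≤ C → ‖∑ n ∈ I, G n‖ ≤ C * K := by
    intro G C m hG hC
    refine (norm_sum_le_of_le I hG).trans ?_
    rw [← Finset.mul_sum]
    refine mul_le_mul_of_nonneg_left (le_trans (le_of_eq ?_) (hK I m)) hC
    exact Finset.sum_congr rfl fun n _ => by rw [← neg_sub, neg_sq]
  have hkey : 2 * ∑ n ∈ I, ∑ m ∈ I, coef S (MicrolocalLift.lieD fieldH a) n m =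
      ((∑ n ∈ I, E n (-N)) - ∑ n ∈ I, E n (N + 1)) +
      ((∑ n ∈ I, F n N) - ∑ n ∈ I, F n (-N - 1)) +
      ∑ n ∈ I, ∑ m ∈ I, (E n (m + 1) + F n (m - 1)) := by
    simp only [Finset.mul_sum, hEF]
    rw [← Finset.sum_sub_distrib, ← Finset.sum_sub_distrib, ← Finset.sum_add_distrib,
      ← Finset.sum_add_distrib]
    refine Finset.sum_congr rfl fun n _ => ?_
    have e1 := sum_Icc_neg_sub (E n) N
    have e2 := sum_Icc_neg_sub (fun m => F n (m - 1)) N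
    simp only [add_sub_cancel_right] at e2
    rw [← hI] at e1 e2
    rw [Finset.sum_sub_distrib] at e1 e2
    rw [Finset.sum_add_distrib, Finset.sum_add_distrib]
    linear_combination e1 - e2
  have hN1 : ∀ n ∈ I, |(n : ℝ)| ≤ N + 1 := fun n hn => (abs_le_of_mem_Icc_neg hn).trans (by linarith)
  have hN0 : (0 : ℝ) ≤ N := N.cast_nonneg
  have b1 : ‖∑ n ∈ I, E n (-N)‖ ≤ C₁ * K := hbd _ _ (-N) (fun n hn =>
    hC₁ r _ S hS hM n (-N) (hN1 n hn) (by push_cast; rw [abs_neg, abs_of_nonneg hN0]; linarith)) h₁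
  have b2 : ‖∑ n ∈ I, E n (N + 1)‖ ≤ C₁ * K := hbd _ _ (N + 1) (fun n hn =>
    hC₁ r _ S hS hM n (N + 1) (hN1 n hn) (by
      push_cast
      rw [abs_of_nonneg (by linarith)])) h₁
  have b3 : ‖∑ n ∈ I, F n N‖ ≤ C₂ * K := hbd _ _ N (fun n hn =>
    hC₂ r _ S hS hM n N (hN1 n hn) (by push_cast; rw [abs_of_nonneg hN0]; linarith)) h₂
  have b4 : ‖∑ n ∈ I, F n (-N - 1)‖ ≤ C₂ * K := hbd _ _ (-N - 1) (fun n hn =>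
    hC₂ r _ S hS hM n (-N - 1) (hN1 n hn) (by
      push_cast
      rw [abs_of_nonpos (by linarith)]
      linarith)) h₂
  have b5 : ‖∑ n ∈ I, ∑ m ∈ I, (E n (m + 1) + F n (m - 1))‖ ≤
      (2 * N + 1) * (C₃ * (N + 1) / r * K) := by
    rw [← card_Icc_neg, ← hI, ← nsmul_eq_mul]
    refine norm_sum_le_of_le I (fun n hn => ?_) |>.trans_eq (Finset.sum_const _)
    refine (norm_sum_le_of_le I fun m hm => hC₃ r N S hr hS hM n m (abs_le_of_mem_Icc_neg hn)
      (abs_le_of_mem_Icc_neg hm)).trans ?_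
    rw [← Finset.mul_sum]
    exact mul_le_mul_of_nonneg_left (hK I n) (by positivity)
  have hfin := congrArg norm hkey
  rw [norm_mul, Complex.norm_ofNat] at hfin
  have h6 := norm_add_le (((∑ n ∈ I, E n (-N)) - ∑ n ∈ I, E n (N + 1)) +
      ((∑ n ∈ I, F n N) - ∑ n ∈ I, F n (-N - 1)))
      (∑ n ∈ I, ∑ m ∈ I, (E n (m + 1) + F n (m - 1)))
  have h7 := norm_add_le ((∑ n ∈ I, E n (-N)) - ∑ n ∈ I, E n (N + 1))
      ((∑ n ∈ I, F n N) - ∑ n ∈ I, F n (-N - 1))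
  have h8 := norm_sub_le (∑ n ∈ I, E n (-N)) (∑ n ∈ I, E n (N + 1))
  have h9 := norm_sub_le (∑ n ∈ I, F n N) (∑ n ∈ I, F n (-N - 1))
  have hX : 0 ≤ (2 * N + 1) * (N + 1) / r := by positivity
  have h10 : (2 * N + 1) * (C₃ * (N + 1) / r * K) = C₃ * K * ((2 * N + 1) * (N + 1) / r) := by ring
  rw [h10] at b5
  have p1 : 0 ≤ C₁ * K := by positivity
  have p2 : 0 ≤ C₂ * K := by positivity
  have p3 : 0 ≤ C₃ * K := by positivity
  have p4 := mul_nonneg p1 hX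
  have p5 := mul_nonneg p2 hX
  have p6 := mul_nonneg p3 hX
  have h11 : (2 * C₁ + 2 * C₂ + C₃) * K * (1 + (2 * N + 1) * (N + 1) / r) =
      2 * (C₁ * K) + 2 * (C₂ * K) + C₃ * K + 2 * (C₁ * K * ((2 * N + 1) * (N + 1) / r)) +
      2 * (C₂ * K * ((2 * N + 1) * (N + 1) / r)) + C₃ * K * ((2 * N + 1) * (N + 1) / r) := by ring
  rw [h11]
  linarith

/-- For a test function of weight zero, the square of a partial sum of the ladder can be replaced
by the square of its central function. -/
lemma IsTest.exists_norm_integral_mul_sub_le (ha : IsTest a)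
    (hW : ∀ v ∈ dom, MicrolocalLift.opW a v = 0) (hB : 0 ≤ B) : ∃ C, 0 ≤ C ∧
    ∀ (r : ℝ) (N : ℕ) (S : ℤ → Amb → ℂ), 0 < r → IsLadder r S → EnergyBound B (N + 1) S →
      ‖(∫ p, a (emb p) * ((∑ n ∈ Finset.Icc (-(N : ℤ)) N, S n (emb p)) *
            (starRingEnd ℂ) (∑ n ∈ Finset.Icc (-(N : ℤ)) N, S n (emb p))) ∂volP) -
          (2 * N + 1) * coef S a 0 0‖ ≤ C * ((2 * N + 1) * N / r) := by
  obtain ⟨C, hC0, hC⟩ := ha.exists_norm_coef_succ_sub_le hB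
  refine ⟨C, hC0, fun r N S hr hS hM => ?_⟩
  rw [integral_mul_sum_mul_conj ha hS]
  set I := Finset.Icc (-(N : ℤ)) N with hI
  have hoff : ∀ n m, n ≠ m → coef S a n m = 0 := by
    intro n m hnm
    have h := coef_opW ha hS n m
    have h0 : coef S (MicrolocalLift.opW a) n m = 0 := by
      rw [coef]
      simp [hW _ (emb_mem_dom _)]
    rw [h0, mul_zero] at h
    have h1 : (m - n : ℂ) ≠ 0 := sub_ne_zero.2 (by exact_mod_cast hnm.symm)
    exact (mul_eq_zero.1 h.symm).resolve_left h1
  have hdiag : ∑ n ∈ I, ∑ m ∈ I, coef S a n m = ∑ n ∈ I, coef S a n n :=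
    Finset.sum_congr rfl fun n hn =>
      Finset.sum_eq_single_of_mem n hn fun m _ hm => hoff n m hm.symm
  have hsucc : ∀ n : ℤ, |(n : ℝ)| ≤ N + 1 → |(n + 1 : ℝ)| ≤ N + 1 →
      ‖coef S a (n + 1) (n + 1) - coef S a n n‖ ≤ C / r := by
    intro n h1 h2
    have h := hC r _ S hr hS hM n n h1 h1 h2
    simpa using h
  have hup : ∀ k : ℕ, k ≤ N → ‖coef S a k k - coef S a 0 0‖ ≤ k * (C / r) := by
    intro k
    induction k with
    | zero => simp
    | succ k ih =>
      intro hk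
      have hkN : (k : ℝ) + 1 ≤ N := by exact_mod_cast hk
      have hk0 : (0 : ℝ) ≤ k := k.cast_nonneg
      have h1 := hsucc k (by rw [Int.cast_natCast, abs_of_nonneg hk0]; linarith)
        (by rw [Int.cast_natCast, abs_of_nonneg (by linarith)]; linarith)
      have h2 := ih (by omega)
      push_cast
      refine (norm_sub_le_norm_sub_add_norm_sub _ (coef S a k k) _).trans ?_
      linarith
  have hdown : ∀ k : ℕ, k ≤ N → ‖coef S a (-(k : ℤ)) (-(k : ℤ)) - coef S a 0 0‖ ≤ k * (C / r) := by
    intro k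
    induction k with
    | zero => simp
    | succ k ih =>
      intro hk
      have hkN : (k : ℝ) + 1 ≤ N := by exact_mod_cast hk
      have hk0 : (0 : ℝ) ≤ k := k.cast_nonneg
      have e : -((k + 1 : ℕ) : ℤ) + 1 = -(k : ℤ) := by
        push_cast
        ring
      have h1 := hsucc (-((k + 1 : ℕ) : ℤ))
        (by push_cast; rw [abs_le]; constructor <;> linarith)
        (by push_cast; rw [abs_le]; constructor <;> linarith)
      rw [e, norm_sub_rev] at h1
      have h2 := ih (by omega)
      refine (norm_sub_le_norm_sub_add_norm_sub _ (coef S a (-(k : ℤ)) (-(k : ℤ))) _).trans ?_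
      push_cast at h1 ⊢
      linarith
  have hall : ∀ n ∈ I, ‖coef S a n n - coef S a 0 0‖ ≤ N * (C / r) := by
    intro n hn
    rw [hI, Finset.mem_Icc] at hn
    have hCr : 0 ≤ C / r := by positivity
    obtain ⟨k, rfl | rfl⟩ := n.eq_nat_or_neg
    · have hk : k ≤ N := by omega
      exact (hup k hk).trans (by gcongr)
    · have hk : k ≤ N := by omega
      exact (hdown k hk).trans (by gcongr)
  have hsum : ∑ n ∈ I, coef S a n n - (2 * N + 1) * coef S a 0 0 =
      ∑ n ∈ I, (coef S a n n - coef S a 0 0) := by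
    rw [Finset.sum_sub_distrib, Finset.sum_const, nsmul_eq_mul]
    have h := card_Icc_neg N
    rw [← hI] at h
    congr 2
    exact_mod_cast h.symm
  rw [hdiag, hsum]
  refine (norm_sum_le_of_le I hall).trans_eq ?_
  rw [Finset.sum_const, nsmul_eq_mul, hI, card_Icc_neg]
  ring

end

/-! ### A uniformly bounded Poincaré series -/

lemma matrixHomeo_apply (A : Matrix (Fin 2) (Fin 2) ℝ) :
    matrixHomeo A = (⟨A 0 0, A 0 1⟩, ⟨A 1 0, A 1 1⟩) := rfl

lemma norm_matrixHomeo_mul_le (A B : Matrix (Fin 2) (Fin 2) ℝ) :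
    ‖matrixHomeo (A * B)‖ ≤ 2 * ‖matrixHomeo A‖ * ‖matrixHomeo B‖ := by
  have hrow : ∀ i : Fin 2, ‖(⟨(A * B) i 0, (A * B) i 1⟩ : ℂ)‖ ≤
      2 * ‖(⟨A i 0, A i 1⟩ : ℂ)‖ * ‖matrixHomeo B‖ := by
    intro i
    have e : (⟨(A * B) i 0, (A * B) i 1⟩ : ℂ) =
        (A i 0 : ℂ) * (matrixHomeo B).1 + (A i 1 : ℂ) * (matrixHomeo B).2 := by
      apply Complex.ext <;> simp [matrixHomeo_apply, Matrix.mul_apply]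
    have h0 := Complex.abs_re_le_norm (⟨A i 0, A i 1⟩ : ℂ)
    have h1 := Complex.abs_im_le_norm (⟨A i 0, A i 1⟩ : ℂ)
    have h2 := norm_fst_le (matrixHomeo B)
    have h3 := norm_snd_le (matrixHomeo B)
    rw [e]
    refine (norm_add_le _ _).trans ?_
    rw [norm_mul, norm_mul, Complex.norm_real, Complex.norm_real, Real.norm_eq_abs, Real.norm_eq_abs,
      two_mul, add_mul]
    exact add_le_add (mul_le_mul h0 h2 (norm_nonneg _) (norm_nonneg _))
      (mul_le_mul h1 h3 (norm_nonneg _) (norm_nonneg _))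
  rw [Prod.norm_def]
  refine max_le ((hrow 0).trans ?_) ((hrow 1).trans ?_)
  · gcongr
    exact norm_fst_le (matrixHomeo A)
  · gcongr
    exact norm_snd_le (matrixHomeo A)

lemma matrixHomeo_sub (A B : Matrix (Fin 2) (Fin 2) ℝ) :
    matrixHomeo (A - B) = matrixHomeo A - matrixHomeo B := rfl

/-- The element `g` of `SL(2, ℝ)` as a vector of `ℂ²`. -/
def vec (g : SL(2, ℝ)) : ℂ × ℂ := matrixHomeo g

lemma norm_vec_inv_le (g : SL(2, ℝ)) : ‖vec g⁻¹‖ ≤ 2 * ‖vec g‖ := by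
  have e : vec g⁻¹ = (⟨g 1 1, -g 0 1⟩, ⟨-g 1 0, g 0 0⟩) := by
    rw [vec, Matrix.SpecialLinearGroup.coe_inv, Matrix.adjugate_fin_two]
    rfl
  have a1 := (Complex.abs_re_le_norm (vec g).1).trans (norm_fst_le (vec g))
  have a2 := (Complex.abs_im_le_norm (vec g).1).trans (norm_fst_le (vec g))
  have a3 := (Complex.abs_re_le_norm (vec g).2).trans (norm_snd_le (vec g))
  have a4 := (Complex.abs_im_le_norm (vec g).2).trans (norm_snd_le (vec g))
  rw [e, Prod.norm_def]
  refine max_le ((Complex.norm_le_abs_re_add_abs_im _).trans ?_)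
    ((Complex.norm_le_abs_re_add_abs_im _).trans ?_)
  · change |g 1 1| + |-g 0 1| ≤ _
    rw [abs_neg, two_mul]
    exact add_le_add a4 a2
  · change |-g 1 0| + |g 0 0| ≤ _
    rw [abs_neg, two_mul]
    exact add_le_add a3 a1

lemma one_le_norm_vec (g : SL(2, ℝ)) : 1 ≤ ‖vec g‖ := by
  by_contra! hlt
  have hdet := g.det_coe
  rw [Matrix.det_fin_two] at hdet
  have e : ((starRingEnd ℂ) (vec g).1 * (vec g).2).im = 1 := by
    simp only [vec, matrixHomeo_apply, Complex.mul_im,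
      Complex.conj_re, Complex.conj_im]
    linarith
  have h1 := Complex.abs_im_le_norm ((starRingEnd ℂ) (vec g).1 * (vec g).2)
  rw [e, abs_one, norm_mul, RCLike.norm_conj] at h1
  have h2 := norm_fst_le (vec g)
  have h3 := norm_snd_le (vec g)
  nlinarith [norm_nonneg (vec g).1, norm_nonneg (vec g).2]

/-- Distinct elements of `Γ` move `g` to points that are separated by the inverse of their norm. -/
lemma exists_le_norm_vec_sub (Γ : Subgroup SL(2, ℝ)) [DiscreteTopology Γ] :
    ∃ ε : ℝ, 0 < ε ∧ ε ≤ 1 ∧ ∀ γ ∈ Γ, ∀ δ ∈ Γ, γ ≠ δ → ∀ g : SL(2, ℝ),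
      ε ≤ ‖vec (γ * g) - vec (δ * g)‖ * ‖vec (δ * g)‖ := by
  have hind : IsInducing vec :=
    (matrixHomeo.isClosedEmbedding.comp Matrix.SpecialLinearGroup.isClosedEmbedding_val).isInducing
  have h1 : ({1} : Set Γ) ∈ 𝓝 (1 : Γ) := (isOpen_discrete _).mem_nhds rfl
  have hind2 : IsInducing fun γ : Γ => vec γ := hind.comp IsInducing.subtypeVal
  rw [hind2.nhds_eq_comap, (Metric.nhds_basis_ball.comap _).mem_iff] at h1
  obtain ⟨η, hη, hball⟩ := h1
  refine ⟨min (η / 4) 1, by positivity, min_le_right _ _, fun γ hγ δ hδ hne g => ?_⟩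
  refine (min_le_left _ _).trans ?_
  have h2 : η ≤ ‖vec (γ * δ⁻¹) - vec 1‖ := by
    by_contra! hlt
    have h3 : (⟨γ * δ⁻¹, Γ.mul_mem hγ (Γ.inv_mem hδ)⟩ : Γ) ∈ ({1} : Set Γ) :=
      hball (by simpa [dist_eq_norm] using hlt)
    exact hne (mul_inv_eq_one.1 (congrArg Subtype.val h3))
  have h4 : vec (γ * δ⁻¹) - vec 1 =
      matrixHomeo ((((γ * g : SL(2, ℝ)) : Matrix (Fin 2) (Fin 2) ℝ) - (δ * g : SL(2, ℝ))) *
        ((δ * g)⁻¹ : SL(2, ℝ))) := by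
    rw [sub_mul, ← Matrix.SpecialLinearGroup.coe_mul, ← Matrix.SpecialLinearGroup.coe_mul,
      matrixHomeo_sub, mul_inv_cancel, mul_inv_rev, mul_assoc, mul_inv_cancel_left]
    rfl
  have h5 := norm_matrixHomeo_mul_le
    (((γ * g : SL(2, ℝ)) : Matrix (Fin 2) (Fin 2) ℝ) - (δ * g : SL(2, ℝ))) ((δ * g)⁻¹ : SL(2, ℝ))
  rw [← h4, matrixHomeo_sub] at h5
  change _ ≤ 2 * ‖vec (γ * g) - vec (δ * g)‖ * ‖vec (δ * g)⁻¹‖ at h5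
  have h6 := mul_le_mul_of_nonneg_left (norm_vec_inv_le (δ * g))
    (norm_nonneg (vec (γ * g) - vec (δ * g)))
  linarith

/-- The sum of `‖γ g‖⁻¹²` over `Γ` is bounded uniformly in `g`: the balls around the points `γ g`
with radii proportional to `‖γ g‖⁻¹` are disjoint, and on each of them the integrable function
`(1 + ‖x‖)⁻⁸` has integral at least `c ‖γ g‖⁻¹²`. -/
lemma exists_tsum_norm_vec_le (Γ : Subgroup SL(2, ℝ)) [DiscreteTopology Γ] :
    ∃ C : ENNReal, C ≠ ⊤ ∧ ∀ g : SL(2, ℝ),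
      ∑' γ : Γ, ENNReal.ofReal ((‖vec (γ * g)‖ ^ 12)⁻¹) ≤ C := by
  obtain ⟨ε, hε, hε1, hsep⟩ := exists_le_norm_vec_sub Γ
  have := countable_of_discreteTopology Γ
  have : Measure.IsAddHaarMeasure (volume : Measure (ℂ × ℂ)) :=
    Measure.prod.instIsAddHaarMeasure volume volume
  have hdim : Module.finrank ℝ (ℂ × ℂ) = 4 := by
    rw [Module.finrank_prod, Complex.finrank_real_complex]
  set b : ENNReal := volume (Metric.ball (0 : ℂ × ℂ) 1) with hb
  have hb0 : b ≠ 0 := (Metric.measure_ball_pos volume _ one_pos).ne'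
  have hb1 : b ≠ ⊤ := measure_ball_lt_top.ne
  set c : ℝ := (3 ^ 8)⁻¹ * (ε / 4) ^ 4 with hc
  have hc0 : 0 < c := by positivity
  have hfin : ∫⁻ x : ℂ × ℂ, ENNReal.ofReal ((1 + ‖x‖) ^ (-(8 : ℝ))) < ⊤ :=
    finite_integral_one_add_norm (by rw [hdim]; norm_num)
  have hk0 : ENNReal.ofReal c * b ≠ 0 := mul_ne_zero (ENNReal.ofReal_pos.2 hc0).ne' hb0
  have hk1 : ENNReal.ofReal c * b ≠ ⊤ := ENNReal.mul_ne_top ENNReal.ofReal_ne_top hb1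
  refine ⟨(ENNReal.ofReal c * b)⁻¹ * ∫⁻ x : ℂ × ℂ, ENNReal.ofReal ((1 + ‖x‖) ^ (-(8 : ℝ))),
    ENNReal.mul_ne_top (ENNReal.inv_ne_top.2 hk0) hfin.ne, fun g => ?_⟩
  set U : Γ → Set (ℂ × ℂ) := fun γ => Metric.ball (vec (γ * g)) (ε / 4 / ‖vec (γ * g)‖) with hU
  have hdisj : Pairwise (Function.onFun Disjoint U) := by
    intro γ δ hne
    rw [Function.onFun, Set.disjoint_left]
    intro x hx hy
    have h1 : ‖vec (γ * g) - vec (δ * g)‖ <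
        ε / 4 / ‖vec (γ * g)‖ + ε / 4 / ‖vec (δ * g)‖ := by
      rw [hU, Metric.mem_ball, dist_comm] at hx
      rw [hU, Metric.mem_ball] at hy
      rw [← dist_eq_norm]
      exact (dist_triangle _ x _).trans_lt (add_lt_add hx hy)
    have hγ := hsep γ γ.2 δ δ.2 (fun h => hne (Subtype.ext h)) g
    have hδ := hsep δ δ.2 γ γ.2 (fun h => hne (Subtype.ext h.symm)) g
    rw [norm_sub_rev] at hδ
    have n1 := one_le_norm_vec (γ * g)
    have n2 := one_le_norm_vec (δ * g)
    set X := ‖vec (γ * g)‖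
    set Y := ‖vec (δ * g)‖
    set D := ‖vec (γ * g) - vec (δ * g)‖
    rcases le_total X Y with h | h
    · have h2 : ε / 4 / Y ≤ ε / 4 / X := by gcongr
      have h3 : D * X < (ε / 4 / X + ε / 4 / X) * X := by
        apply mul_lt_mul_of_pos_right _ (by linarith)
        linarith
      have h4 : (ε / 4 / X + ε / 4 / X) * X = ε / 2 := by
        field_simp
        ring
      linarith
    · have h2 : ε / 4 / X ≤ ε / 4 / Y := by gcongr
      have h3 : D * Y < (ε / 4 / Y + ε / 4 / Y) * Y := by
        apply mul_lt_mul_of_pos_right _ (by linarith)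
        linarith
      have h4 : (ε / 4 / Y + ε / 4 / Y) * Y = ε / 2 := by
        field_simp
        ring
      linarith
  have hterm : ∀ γ : Γ, ENNReal.ofReal ((‖vec (γ * g)‖ ^ 12)⁻¹) ≤
      (ENNReal.ofReal c * b)⁻¹ * ∫⁻ x in U γ, ENNReal.ofReal ((1 + ‖x‖) ^ (-(8 : ℝ))) := by
    intro γ
    have n1 := one_le_norm_vec (γ * g)
    set X := ‖vec (γ * g)‖ with hX
    have hX0 : 0 < X := by linarith
    have h1 : ENNReal.ofReal (((3 * X) ^ 8)⁻¹) * volume (U γ) ≤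
        ∫⁻ x in U γ, ENNReal.ofReal ((1 + ‖x‖) ^ (-(8 : ℝ))) := by
      rw [← setLIntegral_const]
      refine setLIntegral_mono' measurableSet_ball fun x hx => ENNReal.ofReal_le_ofReal ?_
      rw [Real.rpow_neg (by positivity), show (8 : ℝ) = ((8 : ℕ) : ℝ) by norm_num,
        Real.rpow_natCast]
      have h2 : ‖x‖ ≤ X + ε / 4 / X := by
        rw [Metric.mem_ball, dist_eq_norm] at hx
        have := norm_le_norm_add_norm_sub (vec (γ * g)) x
        rw [norm_sub_rev] at this
        linarith
      have h3 : ε / 4 / X ≤ 1 := by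
        rw [div_le_one hX0]
        linarith
      gcongr
      linarith
    have h2 : ENNReal.ofReal (((3 * X) ^ 8)⁻¹) * volume (U γ) =
        (ENNReal.ofReal c * b) * ENNReal.ofReal ((X ^ 12)⁻¹) := by
      rw [hU, Measure.addHaar_ball _ _ (by positivity), hdim, ← hb, ← mul_assoc,
        ← ENNReal.ofReal_mul (by positivity), mul_right_comm, ← ENNReal.ofReal_mul hc0.le, ← hX]
      congr 2
      rw [hc]
      field_simp
    rw [h2] at h1
    calc ENNReal.ofReal ((X ^ 12)⁻¹) = (ENNReal.ofReal c * b)⁻¹ *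
          ((ENNReal.ofReal c * b) * ENNReal.ofReal ((X ^ 12)⁻¹)) := by
          rw [← mul_assoc, ENNReal.inv_mul_cancel hk0 hk1, one_mul]
      _ ≤ _ := by gcongr
  refine (ENNReal.tsum_le_tsum hterm).trans ?_
  rw [ENNReal.tsum_mul_left, ← lintegral_iUnion (fun γ => measurableSet_ball) hdisj]
  exact mul_le_mul_right (setLIntegral_le_lintegral _ _) _

/-- A bound for an integral upstairs by an integral over the orbit space. -/
lemma lintegral_le_lintegral_quotientMeasure {G Y Z : Type*} [Group G] [MulAction G Y]
    [TopologicalSpace Y] [TopologicalSpace Z] {q : Y → Z} [MeasurableSpace Y] [BorelSpace Y]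
    [ContinuousConstSMul G Y] [MeasurableSpace Z] [BorelSpace Z] [Countable G]
    [ProperlyDiscontinuousSMul G Y] [LocallyCompactSpace Y] [T2Space Y]
    [SecondCountableTopology Y] (hq : IsOrbitMap G q)
    (hfree : ∀ (γ : G) (y : Y), γ • y = y → γ = 1) (ν : Measure Y) [SMulInvariantMeasure G Y ν]
    {f : Y → ENNReal} (hf : Measurable f) {g : Z → ENNReal} (hg : Measurable g)
    (hfg : ∀ y, ∑' γ : G, f (γ • y) ≤ g (q y)) :
    ∫⁻ y, f y ∂ν ≤ ∫⁻ z, g z ∂(quotientMeasure ν q) := by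
  obtain ⟨D, hDm, hD⟩ := exists_measurableSet_existsUnique_smul_mem hq hfree
  have hqm : Measurable q := hq.isOpenQuotientMap.continuous.measurable
  have hfd : IsFundamentalDomain G D ν := IsFundamentalDomain.mk' hDm.nullMeasurableSet hD
  rw [quotientMeasure_eq_map_restrict hq hfree ν hDm hD, lintegral_map hg hqm,
    hfd.lintegral_eq_tsum'', ← lintegral_tsum]
  · exact lintegral_mono fun y => hfg y
  · intro γ
    exact (hf.comp (continuous_const_smul γ).measurable).aemeasurable

/-! ### The mass of a Maass form near infinity -/

/-- The square of the norm of the elements of `SL(2, ℝ)` that map `i` to `τ`. -/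
def height (τ : ℍ) : ℝ := (1 + ‖(τ : ℂ)‖ ^ 2) / τ.im

lemma continuous_height : Continuous height := by
  unfold height
  exact (continuous_const.add (continuous_coe.norm.pow 2)).div continuous_im fun τ => τ.im_pos.ne'

lemma height_pos (τ : ℍ) : 0 < height τ := by
  have := τ.im_pos
  unfold height
  positivity

lemma hs_emb (p : SL(2, ℝ) × S3) : hs (emb p) = height (p.1 • I) := by
  have h0 := Complex.normSq_pos.2 (snd_ne_zero_of_mem_dom (emb_mem_dom p))
  have h1 : (p.1 • I : ℍ).im = (Complex.normSq (emb p).2.1)⁻¹ := by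
    rw [← coe_im, ← moebius_emb, im_moebius, det_emb, one_div]
  have h2 : ‖((p.1 • I : ℍ) : ℂ)‖ ^ 2 =
      Complex.normSq (emb p).1 / Complex.normSq (emb p).2.1 := by
    rw [← moebius_emb, moebius, Complex.sq_norm, map_div₀, Complex.normSq_conj, Complex.normSq_conj]
  rw [height, h1, h2, hs]
  field_simp
  ring

lemma sq_norm_vec_le (p : SL(2, ℝ) × S3) : ‖vec p.1‖ ^ 2 ≤ hs (emb p) := by
  have e1 : (vec p.1).1 = (emb p).1 := rfl
  have e2 : (vec p.1).2 = (emb p).2.1 := rfl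
  rw [hs, Complex.normSq_eq_norm_sq, Complex.normSq_eq_norm_sq, Prod.norm_def, ← e1, ← e2]
  rcases max_choice ‖(vec p.1).1‖ ‖(vec p.1).2‖ with h | h <;> rw [h]
  · linarith [sq_nonneg ‖(vec p.1).2‖]
  · linarith [sq_nonneg ‖(vec p.1).1‖]

lemma omega_sq_le (R : ℝ) (p : SL(2, ℝ) × S3) :
    omega R (emb p) ^ 2 ≤ (height (p.1 • I) ^ 6)⁻¹ := by
  have h0 := hs_pos (emb_mem_dom p)
  rw [← hs_emb, omega, profile, show (hs (emb p) ^ 6)⁻¹ = ((hs (emb p) ^ 3)⁻¹) ^ 2 by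
    rw [inv_pow, ← pow_mul]]
  have h1 := Real.smoothTransition.le_one (2 - hs (emb p) / R)
  have h2 := Real.smoothTransition.nonneg (2 - hs (emb p) / R)
  have h3 : 0 < (hs (emb p) ^ 3)⁻¹ := by positivity
  gcongr
  exact mul_le_of_le_one_right h3.le h1

lemma exists_tsum_height_le (Γ : Subgroup SL(2, ℝ)) [DiscreteTopology Γ] :
    ∃ C : ENNReal, C ≠ ⊤ ∧ ∀ τ : ℍ, ∑' γ : Γ, ENNReal.ofReal ((height (γ • τ) ^ 6)⁻¹) ≤ C := by
  obtain ⟨C, hC, h⟩ := exists_tsum_norm_vec_le Γ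
  refine ⟨C, hC, fun τ => (ENNReal.tsum_le_tsum fun γ => ?_).trans (h τ.toSL2R)⟩
  have h1 := sq_norm_vec_le ((γ : SL(2, ℝ)) * τ.toSL2R, radial 0)
  have h2 := one_le_norm_vec ((γ : SL(2, ℝ)) * τ.toSL2R)
  rw [hs_emb] at h1
  simp only [mul_smul, toSL2R_smul_I] at h1
  apply ENNReal.ofReal_le_ofReal
  rw [show ‖vec ((γ : SL(2, ℝ)) * τ.toSL2R)‖ ^ 12 =
    (‖vec ((γ : SL(2, ℝ)) * τ.toSL2R)‖ ^ 2) ^ 6 by rw [← pow_mul]]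
  change (height ((γ : SL(2, ℝ)) • τ) ^ 6)⁻¹ ≤ _
  gcongr

lemma measurePreserving_smul_I : MeasurePreserving
    (fun p : SL(2, ℝ) × S3 => ((p.1 • I, p.2) : ℍ × S3)) volP ((volume : Measure ℍ).prod volS3) := by
  have hs : Measurable fun g : SL(2, ℝ) => g • I := by
    have : Continuous fun g : SL(2, ℝ) => g • I := by fun_prop
    exact this.measurable
  exact MeasurePreserving.prod ⟨hs, map_smul_I_haarSL2⟩ (MeasurePreserving.id volS3)

lemma maassLadder_zero {Γ : Subgroup SL(2, ℝ)} {ρ : Γ →* SU2} (r : ℝ) (u : Base ρ → ℂ) :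
    maassLadder r u 0 = pull fun p => u (Base.mk ρ p) := rfl

/-- The energies of the Maass forms themselves are bounded by a constant depending only on `Γ`. -/
lemma exists_energy_maassLadder_zero_le {Γ : Subgroup SL(2, ℝ)} [DiscreteTopology Γ]
    (ρ : Γ →* SU2)
    (hfree : ∀ (γ : Γ) (τ : ℍ) (z : S3), γ • τ = τ → ρ γ • z = z → γ = 1) :
    ∃ B : ℝ, 0 ≤ B ∧ ∀ (lam r : ℝ) (u : Base ρ → ℂ), IsMaassForm ρ lam u →
      ∀ R, energy (maassLadder r u) 0 R ≤ B := by
  obtain ⟨C, hC, hsum⟩ := exists_tsum_height_le Γ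
  have := countable_of_discreteTopology Γ
  refine ⟨C.toReal, ENNReal.toReal_nonneg, fun lam r u hu R => ?_⟩
  have hq := isOrbitMap_baseMk ρ
  have huc : Continuous u :=
    hq.isOpenQuotientMap.continuous_comp_iff.1 hu.smooth.continuous
  have huq : Continuous fun p : ℍ × S3 => u (Base.mk ρ p) := hu.smooth.continuous
  set f : ℍ × S3 → ENNReal := fun p =>
    ENNReal.ofReal ((height p.1 ^ 6)⁻¹) * ‖u (Base.mk ρ p)‖ₑ ^ 2 with hf
  have hfm : Measurable f := by
    have h1 : Continuous fun p : ℍ × S3 => (height p.1 ^ 6)⁻¹ :=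
      ((continuous_height.comp continuous_fst).pow 6).inv₀ fun p => (pow_pos (height_pos _) 6).ne'
    exact h1.measurable.ennreal_ofReal.mul (huq.measurable.enorm.pow_const 2)
  have hle : ∫⁻ p, f p ∂((volume : Measure ℍ).prod volS3) ≤ C := by
    calc ∫⁻ p, f p ∂((volume : Measure ℍ).prod volS3)
        ≤ ∫⁻ z, C * ‖u z‖ₑ ^ 2 ∂(volBase ρ) := by
          rw [volBase_eq]
          refine lintegral_le_lintegral_quotientMeasure (Y := Twist ρ ℍ) hq
            (fun γ p h => hfree γ p.1 p.2 (congrArg Prod.fst h) (congrArg Prod.snd h))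
            (Twist.measure ρ volume) (f := f) hfm
            (measurable_const.mul (huc.measurable.enorm.pow_const 2)) fun y => ?_
          have h1 : ∀ γ : Γ, f (γ • y : Twist ρ ℍ) =
              ENNReal.ofReal ((height (γ • y.1) ^ 6)⁻¹) * ‖u (Base.mk ρ y)‖ₑ ^ 2 := by
            intro γ
            rw [← hq.smul_eq γ y]
            rfl
          simp only [h1]
          rw [ENNReal.tsum_mul_right]
          gcongr
          exact hsum y.1
      _ = C := by
          rw [lintegral_const_mul _ (huc.measurable.enorm.pow_const 2), hu.normalized, mul_one]
  rw [energy, integral_eq_lintegral_of_nonneg_ae (Eventually.of_forall fun p => by positivity)]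
  · refine ENNReal.toReal_mono hC (le_trans ?_ hle)
    rw [← measurePreserving_smul_I.lintegral_comp hfm]
    refine lintegral_mono fun p => ?_
    rw [ENNReal.ofReal_mul (by positivity), maassLadder_zero, pull_emb, hf]
    refine mul_le_mul' (ENNReal.ofReal_le_ofReal (omega_sq_le R p)) (le_of_eq ?_)
    rw [ENNReal.ofReal_pow (norm_nonneg _), ofReal_norm]
  · refine Continuous.aestronglyMeasurable ?_
    simp only [maassLadder_zero, pull_emb]
    have h2 : Continuous fun p : SL(2, ℝ) × S3 => ((p.1 • I, p.2) : ℍ × S3) := by fun_prop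
    exact ((continuous_omega_emb R).pow 2).mul ((huq.comp h2).norm.pow 2)

/-! ### Limits along a sequence of ladders -/

/-- The partial sum `∑_{|n| ≤ N} S_n`, `N = ⌈r^{1/2}⌉`, of a ladder. -/
def partialSum (r : ℝ) (S : ℤ → Amb → ℂ) (v : Amb) : ℂ :=
  ∑ n ∈ Finset.Icc (-(⌈√r⌉₊ : ℤ)) (⌈√r⌉₊ : ℤ), S n v

/-- The normalized integral of `g` against the square of the partial sum. -/
def wignerIntegral (r : ℝ) (S : ℤ → Amb → ℂ) (g : Amb → ℂ) : ℂ :=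
  (2 * (⌈√r⌉₊ : ℂ) + 1)⁻¹ * ∫ p, g (emb p) *
    (partialSum r S (emb p) * (starRingEnd ℂ) (partialSum r S (emb p))) ∂volP

lemma norm_two_mul_natCast_add_one (N : ℕ) : ‖(2 * (N : ℂ) + 1)‖ = 2 * N + 1 := by
  rw [show (2 * (N : ℂ) + 1) = ((2 * N + 1 : ℕ) : ℂ) by push_cast; rfl, Complex.norm_natCast]
  push_cast
  rfl

section Asymptotics

variable {r : ℕ → ℝ} {S : ℕ → ℤ → Amb → ℂ} {a : Amb → ℂ} {B : ℝ}

lemma natCeil_sqrt_bounds {r : ℝ} (hr : 4 ≤ r) :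
    (2 * (⌈√r⌉₊ : ℝ) + 1)⁻¹ ≤ (√r)⁻¹ ∧ ((⌈√r⌉₊ : ℝ) + 1) / r ≤ 2 * (√r)⁻¹ ∧
      (⌈√r⌉₊ : ℝ) + 1 ≤ r := by
  have hs : 2 ≤ √r := Real.le_sqrt_of_sq_le (by linarith)
  have hsq : √r * √r = r := Real.mul_self_sqrt (by linarith)
  have h1 := Nat.le_ceil (√r)
  have h2 := (Nat.ceil_lt_add_one (Real.sqrt_nonneg r)).le
  refine ⟨?_, ?_, by nlinarith⟩
  · gcongr
    linarith
  · have e : (√r)⁻¹ * r = √r := by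
      rw [inv_mul_eq_iff_eq_mul₀ (by linarith), hsq]
    rw [div_le_iff₀ (by linarith), mul_assoc, e]
    linarith

lemma eventually_energyBound (hr : Tendsto r atTop atTop)
    (hS : ∀ᶠ j in atTop, IsLadder (r j) (S j)) (hB : ∀ j R, energy (S j) 0 R ≤ B) :
    ∃ B', 0 ≤ B' ∧ ∀ᶠ j in atTop, 4 ≤ r j ∧ IsLadder (r j) (S j) ∧
      EnergyBound B' ((⌈√(r j)⌉₊ : ℝ) + 1) (S j) := by
  obtain ⟨C, hC1, hC⟩ := exists_energy_le
  have hB0 : 0 ≤ B := (energy_nonneg (S 0) 0 1).trans (hB 0 1)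
  refine ⟨C * B, by positivity, ?_⟩
  filter_upwards [hr.eventually_ge_atTop 4, hr.eventually_ge_atTop C, hS] with j h4 hCj hSj
  exact ⟨h4, hSj, fun n hn R hR => hC _ _ B hSj hCj (fun R _ => hB j R) n
    (hn.trans (natCeil_sqrt_bounds h4).2.2) R hR⟩

lemma tendsto_const_mul_inv_sqrt (hr : Tendsto r atTop atTop) (C : ℝ) :
    Tendsto (fun j => C * (√(r j))⁻¹) atTop (𝓝 0) := by
  simpa using (tendsto_inv_atTop_zero.comp (Real.tendsto_sqrt_atTop.comp hr)).const_mul C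

/-- Asymptotic invariance under the geodesic flow. -/
lemma tendsto_wignerIntegral_lieD (ha : IsTest a) (hr : Tendsto r atTop atTop)
    (hS : ∀ᶠ j in atTop, IsLadder (r j) (S j)) (hB : ∀ j R, energy (S j) 0 R ≤ B) :
    Tendsto (fun j => wignerIntegral (r j) (S j) (lieD fieldH a)) atTop (𝓝 0) := by
  obtain ⟨B', hB', hev⟩ := eventually_energyBound hr hS hB
  obtain ⟨C, hC0, hC⟩ := ha.exists_norm_integral_lieD_mul_le hB'
  refine squeeze_zero_norm' ?_ (tendsto_const_mul_inv_sqrt hr (3 * C))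
  filter_upwards [hev] with j hj
  obtain ⟨h4, hSj, hE⟩ := hj
  have h := hC (r j) ⌈√(r j)⌉₊ (S j) (by linarith) hSj hE
  obtain ⟨b1, b2, -⟩ := natCeil_sqrt_bounds h4
  rw [wignerIntegral, norm_mul, norm_inv, norm_two_mul_natCast_add_one]
  have hN : (0 : ℝ) < 2 * (⌈√(r j)⌉₊ : ℝ) + 1 := by positivity
  calc (2 * (⌈√(r j)⌉₊ : ℝ) + 1)⁻¹ * _ ≤ (2 * (⌈√(r j)⌉₊ : ℝ) + 1)⁻¹ *
        (C * (1 + (2 * ⌈√(r j)⌉₊ + 1) * (⌈√(r j)⌉₊ + 1) / r j)) :=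
        mul_le_mul_of_nonneg_left h (by positivity)
    _ = C * ((2 * (⌈√(r j)⌉₊ : ℝ) + 1)⁻¹ + (⌈√(r j)⌉₊ + 1) / r j) := by
        field_simp
    _ ≤ C * ((√(r j))⁻¹ + 2 * (√(r j))⁻¹) := by gcongr
    _ = 3 * C * (√(r j))⁻¹ := by ring

/-- For test functions of weight zero the partial sums can be replaced by the central function. -/
lemma tendsto_wignerIntegral_sub_coef (ha : IsTest a) (hW : ∀ v ∈ dom, opW a v = 0)
    (hr : Tendsto r atTop atTop) (hS : ∀ᶠ j in atTop, IsLadder (r j) (S j))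
    (hB : ∀ j R, energy (S j) 0 R ≤ B) :
    Tendsto (fun j => wignerIntegral (r j) (S j) a - coef (S j) a 0 0) atTop (𝓝 0) := by
  obtain ⟨B', hB', hev⟩ := eventually_energyBound hr hS hB
  obtain ⟨C, hC0, hC⟩ := ha.exists_norm_integral_mul_sub_le hW hB'
  refine squeeze_zero_norm' ?_ (tendsto_const_mul_inv_sqrt hr (2 * C))
  filter_upwards [hev] with j hj
  obtain ⟨h4, hSj, hE⟩ := hj
  have h := hC (r j) ⌈√(r j)⌉₊ (S j) (by linarith) hSj hE
  obtain ⟨-, b2, -⟩ := natCeil_sqrt_bounds h4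
  have hr0 : 0 < r j := by linarith
  have hN : (0 : ℝ) < 2 * (⌈√(r j)⌉₊ : ℝ) + 1 := by positivity
  have hN' : (2 * (⌈√(r j)⌉₊ : ℂ) + 1) ≠ 0 := by
    rw [← norm_ne_zero_iff, norm_two_mul_natCast_add_one]
    exact hN.ne'
  have e : wignerIntegral (r j) (S j) a - coef (S j) a 0 0 = (2 * (⌈√(r j)⌉₊ : ℂ) + 1)⁻¹ *
      ((∫ p, a (emb p) * (partialSum (r j) (S j) (emb p) *
        (starRingEnd ℂ) (partialSum (r j) (S j) (emb p))) ∂volP) -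
          (2 * (⌈√(r j)⌉₊ : ℂ) + 1) * coef (S j) a 0 0) := by
    rw [mul_sub, inv_mul_cancel_left₀ hN', wignerIntegral]
  rw [e, norm_mul, norm_inv, norm_two_mul_natCast_add_one]
  calc (2 * (⌈√(r j)⌉₊ : ℝ) + 1)⁻¹ * _ ≤ (2 * (⌈√(r j)⌉₊ : ℝ) + 1)⁻¹ *
        (C * ((2 * ⌈√(r j)⌉₊ + 1) * ⌈√(r j)⌉₊ / r j)) :=
        mul_le_mul_of_nonneg_left h (by positivity)
    _ = C * (⌈√(r j)⌉₊ / r j) := by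
        field_simp
    _ ≤ C * ((⌈√(r j)⌉₊ + 1) / r j) := by
        gcongr
        linarith
    _ ≤ C * (2 * (√(r j))⁻¹) := by gcongr
    _ = 2 * C * (√(r j))⁻¹ := by ring

end Asymptotics

/-! ### The microlocal lifts on the quotient -/

section Quotient

variable {Γ : Subgroup SL(2, ℝ)} {ρ : Γ →* SU2}

/-- Averages over `Γ` of functions on `SL(2, ℝ) × S³`. -/
abbrev avgLift (ρ : Γ →* SU2) (F : SL(2, ℝ) × S3 → ℝ) : Lift ρ → ℝ :=
  avg Γ (Y := Twist ρ SL(2, ℝ)) (Lift.mk ρ) F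

/-- Averages over `Γ` of functions on `ℍ × S³`. -/
abbrev avgBase (ρ : Γ →* SU2) (F : ℍ × S3 → ℝ) : Base ρ → ℝ :=
  avg Γ (Y := Twist ρ ℍ) (Base.mk ρ) F

lemma specParam_sq {lam : ℝ} (h : 1 / 4 ≤ lam) : lam = specParam lam ^ 2 + 1 / 4 := by
  rw [specParam, Real.sq_sqrt (by linarith)]
  ring

lemma tendsto_specParam {lam : ℕ → ℝ} (h : Tendsto lam atTop atTop) :
    Tendsto (fun j => specParam (lam j)) atTop atTop :=
  Real.tendsto_sqrt_atTop.comp (tendsto_atTop_add_const_right _ (-(1 / 4)) h)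

lemma microlocalLift_mk {lam : ℝ} {u : Base ρ → ℂ} (hu : IsMaassForm ρ lam u)
    (p : SL(2, ℝ) × S3) :
    microlocalLift lam u (Lift.mk ρ p) =
      ((√(2 * (⌈√(specParam lam)⌉₊ : ℝ) + 1) : ℝ) : ℂ)⁻¹ *
        partialSum (specParam lam) (maassLadder (specParam lam) u) (emb p) := by
  rw [microlocalLift, partialSum]
  simp only [ladder_mk hu]

lemma contDiffOn_partialSum {r : ℝ} {S : ℤ → Amb → ℂ} (hS : IsLadder r S) :
    ContDiffOn ℝ ∞ (partialSum r S) dom :=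
  ContDiffOn.sum fun n _ => hS.smooth n

variable [DiscreteTopology Γ]

/-- The measures `|s|² dv` in terms of the ladder. -/
lemma integral_avgLift_microlocalLift {lam : ℝ} {u : Base ρ → ℂ} (hu : IsMaassForm ρ lam u)
    (hlam : 1 / 4 ≤ lam) {g : Amb → ℂ} (hg : IsTest g) :
    ∫ z, avgLift ρ (fun p => (g (emb p)).re) z ∂(sqMeasure (microlocalLift lam u) (volLift ρ)) =
      (wignerIntegral (specParam lam) (maassLadder (specParam lam) u) g).re := by
  have hS := hu.isLadder (specParam_sq hlam)
  set r := specParam lam with hr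
  set S := maassLadder r u with hSdef
  have := countable_of_discreteTopology Γ
  have hc : Continuous fun p => partialSum r S (emb p) :=
    contDiffOn_comp_emb_continuous (contDiffOn_partialSum hS).continuousOn
  have hsc : Continuous fun p : SL(2, ℝ) × S3 => microlocalLift lam u (Lift.mk ρ p) := by
    simp only [microlocalLift_mk hu]
    exact continuous_const.mul hc
  have hgs : HasCompactSupport fun p => (g (emb p)).re :=
    hg.hasCompactSupport.comp_left (g := Complex.re) Complex.zero_re
  have h1 := integral_avg_sqMeasure (Y := Twist ρ SL(2, ℝ)) (isOrbitMap_liftMk ρ) (lift_free ρ)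
    (Twist.measure ρ haarSL2) (u := microlocalLift lam u) hsc
    (F := fun p => (g (emb p)).re) (Complex.continuous_re.comp hg.continuous) hgs
  rw [volLift_eq]
  refine h1.trans ?_
  change ∫ p : SL(2, ℝ) × S3, (g (emb p)).re * ‖microlocalLift lam u (Lift.mk ρ p)‖ ^ 2 ∂volP = _
  have hN : (0 : ℝ) ≤ 2 * (⌈√r⌉₊ : ℝ) + 1 := by positivity
  have h2 : ∀ p : SL(2, ℝ) × S3, (g (emb p)).re * ‖microlocalLift lam u (Lift.mk ρ p)‖ ^ 2 =
      (2 * (⌈√r⌉₊ : ℝ) + 1)⁻¹ * (g (emb p) *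
        (partialSum r S (emb p) * (starRingEnd ℂ) (partialSum r S (emb p)))).re := by
    intro p
    rw [microlocalLift_mk hu, norm_mul, norm_inv, Complex.norm_real, Real.norm_eq_abs,
      abs_of_nonneg (Real.sqrt_nonneg _), mul_pow, inv_pow, Real.sq_sqrt hN, Complex.mul_conj,
      Complex.re_mul_ofReal, Complex.normSq_eq_norm_sq]
    ring
  simp only [h2]
  have h3 := ((hg.mul_right (contDiffOn_partialSum hS)).mul_right
    (contDiffOn_conj (contDiffOn_partialSum hS))).integrable
  simp only [mul_assoc] at h3
  have h4 := Complex.reCLM.integral_comp_comm h3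
  simp only [Complex.reCLM_apply] at h4
  rw [integral_const_mul, h4, wignerIntegral]
  have h5 : (2 * (⌈√r⌉₊ : ℂ) + 1)⁻¹ = (((2 * (⌈√r⌉₊ : ℝ) + 1)⁻¹ : ℝ) : ℂ) := by
    push_cast
    rfl
  rw [h5, Complex.re_ofReal_mul]

/-- The measures `|u|² dv` in terms of the central coefficient. -/
lemma integral_avgBase_sqMeasure
    (hfree : ∀ (γ : Γ) (τ : ℍ) (z : S3), γ • τ = τ → ρ γ • z = z → γ = 1)
    {lam r : ℝ} {u : Base ρ → ℂ} (hu : IsMaassForm ρ lam u) {F : ℍ × S3 → ℝ} (hF : Continuous F)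
    (hFs : HasCompactSupport F) :
    ∫ z, avgBase ρ F z ∂(sqMeasure u (volBase ρ)) =
      (coef (maassLadder r u) (pull fun x => (F x : ℂ)) 0 0).re := by
  have := countable_of_discreteTopology Γ
  have huq : Continuous fun p : ℍ × S3 => u (Base.mk ρ p) := hu.smooth.continuous
  have h1 := integral_avg_sqMeasure (Y := Twist ρ ℍ) (isOrbitMap_baseMk ρ)
    (fun γ p h => hfree γ p.1 p.2 (congrArg Prod.fst h) (congrArg Prod.snd h))
    (Twist.measure ρ volume) (u := u) huq (F := F) hF hFs
  rw [volBase_eq]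
  refine h1.trans ?_
  change ∫ y : ℍ × S3, F y * ‖u (Base.mk ρ y)‖ ^ 2 ∂((volume : Measure ℍ).prod volS3) = _
  have hm : Measurable fun y : ℍ × S3 => F y * ‖u (Base.mk ρ y)‖ ^ 2 :=
    (hF.mul (huq.norm.pow 2)).measurable
  rw [← measurePreserving_smul_I.map_eq, integral_map
    measurePreserving_smul_I.measurable.aemeasurable hm.aestronglyMeasurable, coef]
  have h2 : ∀ p : SL(2, ℝ) × S3, pull (fun x => (F x : ℂ)) (emb p) * maassLadder r u 0 (emb p) *
      (starRingEnd ℂ) (maassLadder r u 0 (emb p)) =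
      ((F (p.1 • I, p.2) * ‖u (Base.mk ρ (p.1 • I, p.2))‖ ^ 2 : ℝ) : ℂ) := by
    intro p
    rw [maassLadder_zero, pull_emb, pull_emb, mul_assoc, Complex.mul_conj,
      Complex.normSq_eq_norm_sq]
    push_cast
    rfl
  simp only [h2]
  rw [integral_complex_ofReal, Complex.ofReal_re]

end Quotient

/-! ### Translates of test functions along the geodesic flow -/

/-- The extension of right translation by `geo t` to a linear map of `Amb`. -/
def geoAmb (t : ℝ) (v : Amb) : Amb :=
  ((Real.cosh (t / 2) : ℂ) * v.1 + (Real.sinh (t / 2) : ℂ) * (starRingEnd ℂ) v.1,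
    (Real.cosh (t / 2) : ℂ) * v.2.1 + (Real.sinh (t / 2) : ℂ) * (starRingEnd ℂ) v.2.1, v.2.2)

lemma geoAmb_emb (t : ℝ) (p : SL(2, ℝ) × S3) : geoAmb t (emb p) = emb (p.1 * geo t, p.2) := by
  have h1 := Real.cosh_add_sinh (t / 2)
  have h2 := Real.cosh_sub_sinh (t / 2)
  rw [emb_mul]
  refine Prod.ext ?_ (Prod.ext ?_ rfl) <;> apply Complex.ext <;>
    simp only [geoAmb, emb, geo, Matrix.of_apply, Matrix.cons_val', Matrix.cons_val_zero,
      Matrix.cons_val_one, Matrix.cons_val_fin_one, Complex.add_re, Complex.add_im,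
      Complex.re_ofReal_mul, Complex.im_ofReal_mul, Complex.conj_re, Complex.conj_im,
      ← h1, ← h2] <;> ring

lemma det_geoAmb (t : ℝ) (v : Amb) : det (geoAmb t v) = det v := by
  have h := Real.cosh_sq_sub_sinh_sq (t / 2)
  simp only [det, geoAmb, map_add, map_mul, Complex.conj_ofReal, Complex.conj_conj, Complex.mul_im,
    Complex.add_re, Complex.add_im, Complex.mul_re, Complex.ofReal_re, Complex.ofReal_im,
    Complex.conj_re, Complex.conj_im]
  linear_combination (v.1.re * v.2.1.im - v.1.im * v.2.1.re) * h

lemma contDiff_geoAmb (t : ℝ) : ContDiff ℝ ∞ (geoAmb t) := by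
  have hc : ContDiff ℝ ∞ (starRingEnd ℂ) := (Complex.conjCLE : ℂ →L[ℝ] ℂ).contDiff
  have h1 : ∀ l : Amb → ℂ, ContDiff ℝ ∞ l → ContDiff ℝ ∞ fun v =>
      (Real.cosh (t / 2) : ℂ) * l v + (Real.sinh (t / 2) : ℂ) * (starRingEnd ℂ) (l v) :=
    fun l hl => (contDiff_const.mul hl).add (contDiff_const.mul (hc.comp hl))
  exact (h1 _ contDiff_fst).prodMk
    ((h1 _ (contDiff_fst.comp contDiff_snd)).prodMk (contDiff_snd.comp contDiff_snd))

/-- Right translation by `geo t`, as a homeomorphism of `SL(2, ℝ) × S³`. -/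
def geoHomeo (t : ℝ) : SL(2, ℝ) × S3 ≃ₜ SL(2, ℝ) × S3 :=
  (Homeomorph.mulRight (geo t)).prodCongr (Homeomorph.refl S3)

lemma IsTest.comp_geoAmb {a : Amb → ℂ} (ha : IsTest a) (t : ℝ) : IsTest fun v => a (geoAmb t v) where
  smooth := ha.smooth.comp (contDiff_geoAmb t).contDiffOn fun v hv =>
    ⟨by rw [det_geoAmb]; exact hv.1, hv.2⟩
  hasCompactSupport := by
    simp only [geoAmb_emb]
    exact ha.hasCompactSupport.comp_homeomorph (geoHomeo t)

/-- The geodesic flow commutes with its generator. -/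
lemma lieD_comp_geoAmb {a : Amb → ℂ} (ha : IsTest a) (t : ℝ) (p : SL(2, ℝ) × S3) :
    lieD fieldH (fun v => a (geoAmb t v)) (emb p) = lieD fieldH a (emb (p.1 * geo t, p.2)) := by
  have h1 := isFlow_geo.hasDerivAt_comp (ha.comp_geoAmb t).smooth p 0
  have h2 := isFlow_geo.hasDerivAt_comp ha.smooth (p.1 * geo t, p.2) 0
  simp only [geoAmb_emb, geo_zero, mul_one, mul_assoc, geo_mul_geo] at h1 h2
  simp only [add_comm t] at h2
  exact h1.unique h2

/-- A measure on `SL(2, ℝ) × S³` that annihilates the derivatives of test functions along the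
geodesic flow is invariant under the flow: the derivative of the integral of `a` along the flow is
the integral of the derivative of a translate of `a`. -/
lemma integral_comp_geo_eq (m : Measure (SL(2, ℝ) × S3)) [IsFiniteMeasureOnCompacts m]
    (hm : ∀ a, IsTest a → ∫ p, (lieD fieldH a (emb p)).re ∂m = 0) {a : Amb → ℂ} (ha : IsTest a)
    (t : ℝ) : ∫ p, (a (emb (p.1 * geo t, p.2))).re ∂m = ∫ p, (a (emb p)).re ∂m := by
  have hint : ∀ {b : Amb → ℂ}, IsTest b → Integrable (fun p => b (emb p)) m := fun hb =>
    hb.continuous.integrable_of_hasCompactSupport hb.hasCompactSupport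
  have key : ∀ s, HasDerivAt (fun s => (∫ p, a (emb (p.1 * geo s, p.2)) ∂m).re) 0 s := by
    intro s
    have h := isFlow_geo.hasDerivAt_integral m ha.smooth ha.hasCompactSupport s
    have h2 := Complex.reCLM.hasFDerivAt.comp_hasDerivAt s h
    have h3 : Complex.reCLM (∫ p, lieD fieldH a (emb (p.1 * geo s, p.2)) ∂m) = 0 := by
      rw [← hm _ (ha.comp_geoAmb s)]
      simp only [← lieD_comp_geoAmb ha]
      exact (Complex.reCLM.integral_comp_comm
        (hint ((ha.comp_geoAmb s).lieD isFlow_geo))).symm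
    rw [h3] at h2
    exact h2
  have h := is_const_of_deriv_eq_zero (fun s => (key s).differentiableAt)
    (fun s => (key s).deriv) t 0
  have e : ∀ s, ∫ p, (a (emb (p.1 * geo s, p.2))).re ∂m =
      (∫ p, a (emb (p.1 * geo s, p.2)) ∂m).re := by
    intro s
    simp only [← geoAmb_emb]
    exact Complex.reCLM.integral_comp_comm (hint (ha.comp_geoAmb s))
  rw [e, h, ← e]
  simp only [geo_zero, mul_one]

/-! ### Density of test functions -/

/-- Test functions are dense: extend to `Amb` by Tietze's theorem, and smooth the extension. -/
lemma exists_isTest_approx {F : SL(2, ℝ) × S3 → ℝ} (hF : Continuous F) (hFs : HasCompactSupport F)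
    {ε : ℝ} (hε : 0 < ε) : ∃ a, IsTest a ∧ (∀ p, |(a (emb p)).re - F p| ≤ ε) ∧
      Function.support (fun p => (a (emb p)).re) ⊆ Function.support F := by
  obtain ⟨F', hF'⟩ := ContinuousMap.exists_extension' isClosedEmbedding_emb ⟨F, hF⟩
  obtain ⟨G, hG, hGF, hGs⟩ := F'.continuous.exists_contDiff_approx ⊤ (ε := fun _ => ε)
    continuous_const fun _ => hε
  have hF'e : ∀ p, F' (emb p) = F p := fun p => congrFun hF' p
  have hsub : Function.support (fun p => G (emb p)) ⊆ Function.support F := by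
    intro p hp
    rw [Function.mem_support, ← hF'e]
    exact hGs hp
  refine ⟨fun v => (G v : ℂ), ⟨?_, ?_⟩, fun p => ?_, ?_⟩
  · exact (Complex.ofRealCLM.contDiff.comp hG).contDiffOn
  · exact (hFs.mono hsub).comp_left (g := fun x : ℝ => (x : ℂ)) Complex.ofReal_zero
  · rw [Complex.ofReal_re, ← hF'e]
    exact (hGF (emb p)).le
  · exact hsub

instance : IsManifold 𝓘(ℝ, ℂ) ∞ ℍ := isOpenEmbedding_coe.isManifold_singleton

lemma exists_contMDiff_approx {F : ℍ × S3 → ℝ} (hF : Continuous F) {ε : ℝ} (hε : 0 < ε) :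
    ∃ G : ℍ × S3 → ℝ, ContMDiff (𝓘(ℝ, ℂ).prod (𝓡 3)) 𝓘(ℝ, ℝ) ∞ G ∧ (∀ p, |G p - F p| ≤ ε) ∧
      Function.support G ⊆ Function.support F := by
  obtain ⟨G, hG, hGs⟩ := hF.exists_contMDiff_approx (𝓘(ℝ, ℂ).prod (𝓡 3)) ⊤ (ε := fun _ => ε)
    continuous_const fun _ => hε
  exact ⟨G, G.contMDiff, fun p => (hG p).le, hGs⟩

/-! ### The flow and the projection on the quotient -/

section Quotient

variable {Γ : Subgroup SL(2, ℝ)} (ρ : Γ →* SU2)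

lemma continuous_flow (t : ℝ) : Continuous (flow ρ t) :=
  (isOrbitMap_liftMk ρ).isOpenQuotientMap.isQuotientMap.continuous_iff.2
    ((isOrbitMap_liftMk ρ).isOpenQuotientMap.continuous.comp (geoHomeo t).continuous)

/-- The projection `(g, z) ↦ (g • i, z)`. -/
def smulI (p : SL(2, ℝ) × S3) : ℍ × S3 := (p.1 • I, p.2)

lemma isProperMap_smulI : IsProperMap smulI :=
  isProperMap_smul_I.prodMap isProperMap_id

lemma continuous_proj : Continuous (proj ρ) :=
  (isOrbitMap_liftMk ρ).isOpenQuotientMap.isQuotientMap.continuous_iff.2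
    ((isOrbitMap_baseMk ρ).isOpenQuotientMap.continuous.comp isProperMap_smulI.continuous)

/-- The geodesic flow at time `t` is a homeomorphism. -/
def flowHomeo (t : ℝ) : Lift ρ ≃ₜ Lift ρ where
  toFun := flow ρ t
  invFun := flow ρ (-t)
  left_inv x := by
    obtain ⟨p, rfl⟩ := (isOrbitMap_liftMk ρ).isOpenQuotientMap.surjective x
    exact congrArg (Lift.mk ρ) (isFlow_geo.mul_mul_neg p t)
  right_inv x := by
    obtain ⟨p, rfl⟩ := (isOrbitMap_liftMk ρ).isOpenQuotientMap.surjective x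
    have h := isFlow_geo.mul_mul_neg p (-t)
    rw [neg_neg] at h
    exact congrArg (Lift.mk ρ) h
  continuous_toFun := continuous_flow ρ t
  continuous_invFun := continuous_flow ρ (-t)

lemma avgLift_flow (F : SL(2, ℝ) × S3 → ℝ) (t : ℝ) (x : Lift ρ) :
    avgLift ρ F (flow ρ t x) = avgLift ρ (fun p => F (p.1 * geo t, p.2)) x := by
  obtain ⟨p, rfl⟩ := (isOrbitMap_liftMk ρ).isOpenQuotientMap.surjective x
  refine (avg_apply (isOrbitMap_liftMk ρ) F (p.1 * geo t, p.2)).trans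
    (Eq.trans ?_ (avg_apply (isOrbitMap_liftMk ρ) (fun p => F (p.1 * geo t, p.2)) p).symm)
  refine tsum_congr fun γ => congrArg F (Prod.ext ?_ rfl)
  exact (mul_assoc (γ : SL(2, ℝ)) p.1 (geo t)).symm

lemma avgBase_proj (F : ℍ × S3 → ℝ) (x : Lift ρ) :
    avgBase ρ F (proj ρ x) = avgLift ρ (fun p => F (smulI p)) x := by
  obtain ⟨p, rfl⟩ := (isOrbitMap_liftMk ρ).isOpenQuotientMap.surjective x
  refine (avg_apply (isOrbitMap_baseMk ρ) F (p.1 • I, p.2)).trans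
    (Eq.trans ?_ (avg_apply (isOrbitMap_liftMk ρ) (fun p => F (smulI p)) p).symm)
  refine tsum_congr fun γ => congrArg F (Prod.ext ?_ rfl)
  exact smul_smul (γ : SL(2, ℝ)) p.1 I

variable [DiscreteTopology Γ]

/-- The projection is proper, its fibres being circles. -/
lemma isCompact_preimage_proj {K : Set (Base ρ)} (hK : IsCompact K) : IsCompact (proj ρ ⁻¹' K) := by
  obtain ⟨L, hL, hKL⟩ := (isOrbitMap_baseMk ρ).exists_compact_subset_image hK
  refine IsCompact.of_isClosed_subset
    ((isProperMap_smulI.isCompact_preimage hL).image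
      (isOrbitMap_liftMk ρ).isOpenQuotientMap.continuous)
    (hK.isClosed.preimage (continuous_proj ρ)) fun x hx => ?_
  obtain ⟨p, rfl⟩ := (isOrbitMap_liftMk ρ).isOpenQuotientMap.surjective x
  obtain ⟨y, hy, hyp⟩ := hKL hx
  obtain ⟨γ, hγ⟩ := ((isOrbitMap_baseMk ρ).eq_iff (smulI p) y).1 hyp.symm
  refine ⟨((γ : SL(2, ℝ)) * p.1, ρ γ • p.2), ?_, (isOrbitMap_liftMk ρ).smul_eq γ p⟩
  have e : smulI ((γ : SL(2, ℝ)) * p.1, ρ γ • p.2) = y := by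
    rw [← hγ]
    exact Prod.ext (mul_smul (γ : SL(2, ℝ)) p.1 I) rfl
  exact Set.mem_preimage.2 (Set.mem_of_eq_of_mem e hy)

lemma isFiniteMeasureOnCompacts_map_of_isCompact_preimage {α β : Type*} [TopologicalSpace α]
    [TopologicalSpace β] [MeasurableSpace α] [BorelSpace α] [MeasurableSpace β] [BorelSpace β]
    [T2Space β] {f : α → β} (hf : Continuous f) (h : ∀ K, IsCompact K → IsCompact (f ⁻¹' K))
    (μ : Measure α) [IsFiniteMeasureOnCompacts μ] : IsFiniteMeasureOnCompacts (μ.map f) where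
  lt_top_of_isCompact K hK := by
    rw [Measure.map_apply hf.measurable hK.measurableSet]
    exact (h K hK).measure_lt_top

end Quotient

/-! ### Weak-star limits of microlocal lifts -/

section Limits

variable {Γ : Subgroup SL(2, ℝ)} {ρ : Γ →* SU2} {lam : ℕ → ℝ} {u : ℕ → Base ρ → ℂ}

lemma eventually_isLadder (hu : ∀ i, IsMaassForm ρ (lam i) (u i)) (hlam : Tendsto lam atTop atTop) :
    ∀ᶠ j in atTop, IsLadder (specParam (lam j)) (maassLadder (specParam (lam j)) (u j)) := by
  filter_upwards [hlam.eventually_ge_atTop (1 / 4)] with j hj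
  exact (hu j).isLadder (specParam_sq hj)

variable [DiscreteTopology Γ] {μ : Measure (Lift ρ)}

/-- Limits of the measures `|s|² dv` in terms of the normalized ladder integrals. -/
lemma tendsto_re_wignerIntegral (hu : ∀ i, IsMaassForm ρ (lam i) (u i))
    (hlam : Tendsto lam atTop atTop)
    (hμ : WeakStarTendsto (fun j => sqMeasure (microlocalLift (lam j) (u j)) (volLift ρ)) μ)
    {a : Amb → ℂ} (ha : IsTest a) :
    Tendsto (fun j => (wignerIntegral (specParam (lam j))
      (maassLadder (specParam (lam j)) (u j)) a).re) atTop
      (𝓝 (∫ z, avgLift ρ (fun p => (a (emb p)).re) z ∂μ)) := by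
  have hs : HasCompactSupport fun p => (a (emb p)).re :=
    ha.hasCompactSupport.comp_left (g := Complex.re) Complex.zero_re
  have h := hμ (avgLift ρ fun p => (a (emb p)).re)
    (avg_continuous (isOrbitMap_liftMk ρ) hs (Complex.continuous_re.comp ha.continuous))
    (avg_hasCompactSupport (isOrbitMap_liftMk ρ) hs)
  refine h.congr' ?_
  filter_upwards [hlam.eventually_ge_atTop (1 / 4)] with j hj
  exact integral_avgLift_microlocalLift (hu j) hj ha

variable [IsFiniteMeasureOnCompacts μ]

/-- Weak limits of the measures `|s|² dv` are invariant under the geodesic flow. -/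
theorem map_flow_eq
    (hfree : ∀ (γ : Γ) (τ : ℍ) (z : S3), γ • τ = τ → ρ γ • z = z → γ = 1)
    (hu : ∀ i, IsMaassForm ρ (lam i) (u i)) (hlam : Tendsto lam atTop atTop)
    (hμ : WeakStarTendsto (fun j => sqMeasure (microlocalLift (lam j) (u j)) (volLift ρ)) μ)
    (t : ℝ) : μ.map (flow ρ t) = μ := by
  have := countable_of_discreteTopology Γ
  obtain ⟨B, -, hB⟩ := exists_energy_maassLadder_zero_le ρ hfree
  obtain ⟨m, hm, hmμ⟩ : ∃ m : Measure (SL(2, ℝ) × S3), IsFiniteMeasureOnCompacts m ∧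
      ∀ F : SL(2, ℝ) × S3 → ℝ, Continuous F → HasCompactSupport F →
        ∫ p, F p ∂m = ∫ z, avgLift ρ F z ∂μ :=
    exists_measure_integral_eq_integral_avg (isOrbitMap_liftMk ρ) μ
  have hmμ' : ∀ a, IsTest a → ∫ p, (a (emb p)).re ∂m =
      ∫ z, avgLift ρ (fun p => (a (emb p)).re) z ∂μ := fun a ha =>
    hmμ _ (Complex.continuous_re.comp ha.continuous)
      (ha.hasCompactSupport.comp_left (g := Complex.re) Complex.zero_re)
  have hm0 : ∀ a, IsTest a → ∫ p, (lieD fieldH a (emb p)).re ∂m = 0 := by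
    intro a ha
    rw [hmμ' _ (ha.lieD isFlow_geo)]
    refine tendsto_nhds_unique (tendsto_re_wignerIntegral hu hlam hμ (ha.lieD isFlow_geo)) ?_
    have h := tendsto_wignerIntegral_lieD ha (tendsto_specParam hlam)
      (eventually_isLadder hu hlam) (fun j R => hB _ _ _ (hu j) R)
    exact (Complex.continuous_re.tendsto 0).comp h
  have : IsFiniteMeasureOnCompacts (μ.map (flow ρ t)) :=
    isFiniteMeasureOnCompacts_map_of_isCompact_preimage (continuous_flow ρ t)
      (fun K hK => (flowHomeo ρ t).isCompact_preimage.2 hK) μ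
  refine measure_ext_of_integral_avg (isOrbitMap_liftMk ρ) _ _
    (fun G => ∃ a, IsTest a ∧ ∀ p, G p = (a (emb p)).re) ?_ ?_
  · intro F hF hFs ε hε
    obtain ⟨a, ha, haF, has⟩ := exists_isTest_approx hF hFs hε
    exact ⟨fun p => (a (emb p)).re, ⟨a, ha, fun _ => rfl⟩,
      Complex.continuous_re.comp ha.continuous, haF, has⟩
  · rintro G ⟨a, ha, haG⟩ hG hGs
    obtain rfl : G = fun p => (a (emb p)).re := funext haG
    have hc := avg_continuous (isOrbitMap_liftMk ρ) hGs hG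
    refine (integral_map (continuous_flow ρ t).measurable.aemeasurable
      hc.aestronglyMeasurable).trans ?_
    have e : ∀ x, avgLift ρ (fun p => (a (emb p)).re) (flow ρ t x) =
        avgLift ρ (fun p => (a (geoAmb t (emb p))).re) x := by
      intro x
      simp only [geoAmb_emb]
      exact avgLift_flow ρ _ t x
    refine (integral_congr_ae (Eventually.of_forall e)).trans ?_
    refine (hmμ' _ (ha.comp_geoAmb t)).symm.trans (Eq.trans ?_ (hmμ' _ ha))
    refine Eq.trans ?_ (integral_comp_geo_eq m hm0 ha t)
    exact integral_congr_ae (Eventually.of_forall fun p =>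
      congrArg (fun v => (a v).re) (geoAmb_emb t p))

/-- Weak limits of the measures `|s|² dv` project to the weak limit of `|u|² dv`. -/
theorem map_proj_eq
    (hfree : ∀ (γ : Γ) (τ : ℍ) (z : S3), γ • τ = τ → ρ γ • z = z → γ = 1)
    (hu : ∀ i, IsMaassForm ρ (lam i) (u i)) (hlam : Tendsto lam atTop atTop)
    {μM : Measure (Base ρ)} [IsFiniteMeasureOnCompacts μM]
    (hμM : WeakStarTendsto (fun i => sqMeasure (u i) (volBase ρ)) μM)
    (hμ : WeakStarTendsto (fun j => sqMeasure (microlocalLift (lam j) (u j)) (volLift ρ)) μ) :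
    μ.map (proj ρ) = μM := by
  have := countable_of_discreteTopology Γ
  obtain ⟨B, -, hB⟩ := exists_energy_maassLadder_zero_le ρ hfree
  have : IsFiniteMeasureOnCompacts (μ.map (proj ρ)) :=
    isFiniteMeasureOnCompacts_map_of_isCompact_preimage (continuous_proj ρ)
      (fun K hK => isCompact_preimage_proj ρ hK) μ
  refine measure_ext_of_integral_avg (isOrbitMap_baseMk ρ) _ _
    (fun G => ContMDiff (𝓘(ℝ, ℂ).prod (𝓡 3)) 𝓘(ℝ, ℝ) ∞ (M := ℍ × S3) G) ?_ ?_
  · intro F hF hFs ε hε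
    obtain ⟨G, hG, hGF, hGs⟩ := exists_contMDiff_approx hF hε
    exact ⟨G, hG, hG.continuous, hGF, hGs⟩
  · intro F hFd hF hFs
    have hFC : ContMDiff (𝓘(ℝ, ℂ).prod (𝓡 3)) 𝓘(ℝ, ℂ) ∞ fun x : ℍ × S3 => (F x : ℂ) :=
      Complex.ofRealCLM.contDiff.contMDiff.comp hFd
    have hcs : HasCompactSupport fun p : SL(2, ℝ) × S3 => F (smulI p) :=
      HasCompactSupport.intro (isProperMap_smulI.isCompact_preimage hFs)
        fun p hp => image_eq_zero_of_notMem_tsupport hp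
    have ha : IsTest (pull fun x => (F x : ℂ)) :=
      { smooth := contDiffOn_pull hFC
        hasCompactSupport := by
          simp only [pull_emb]
          exact hcs.comp_left (g := fun x : ℝ => (x : ℂ)) Complex.ofReal_zero }
    have hc : Continuous (avgBase ρ F) := avg_continuous (isOrbitMap_baseMk ρ) hFs hF
    refine (integral_map (continuous_proj ρ).measurable.aemeasurable
      hc.aestronglyMeasurable).trans ?_
    have e : ∀ x, avgBase ρ F (proj ρ x) =
        avgLift ρ (fun p => (pull (fun x => (F x : ℂ)) (emb p)).re) x := by
      intro x
      simp only [pull_emb, Complex.ofReal_re]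
      exact avgBase_proj ρ F x
    refine (integral_congr_ae (Eventually.of_forall e)).trans ?_
    have h1 := tendsto_re_wignerIntegral hu hlam hμ ha
    have h2 := (Complex.continuous_re.tendsto 0).comp
      (tendsto_wignerIntegral_sub_coef ha (fun v hv => opW_pull hFC hv) (tendsto_specParam hlam)
        (eventually_isLadder hu hlam) (fun j R => hB _ _ _ (hu j) R))
    have h3 := hμM (avgBase ρ F) hc (avg_hasCompactSupport (isOrbitMap_baseMk ρ) hFs)
    refine tendsto_nhds_unique h1 ?_
    have h4 := h2.add h3
    rw [Complex.zero_re, zero_add] at h4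
    refine h4.congr fun j => ?_
    rw [integral_avgBase_sqMeasure hfree (hu j) hF hFs (r := specParam (lam j)),
      Function.comp_apply, Complex.sub_re, sub_add_cancel]

end Limits

end MicrolocalLift

end

theorem theorem3p1 (Γ : Subgroup SL(2, ℝ)) [DiscreteTopology Γ] (ρ : Γ →* SU2)
    (hfree : ∀ (γ : Γ) (τ : ℍ) (z : S3), γ • τ = τ → ρ γ • z = z → γ = 1)
    (lam : ℕ → ℝ) (u : ℕ → Base ρ → ℂ)
    (hu : ∀ i, IsMaassForm ρ (lam i) (u i))
    (hlam : Tendsto lam atTop atTop)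
    (μM : Measure (Base ρ)) [IsFiniteMeasureOnCompacts μM]
    (hμM : WeakStarTendsto (fun i => sqMeasure (u i) (volBase ρ)) μM)
    (φ : ℕ → ℕ) (hφ : StrictMono φ)
    (μ : Measure (Lift ρ)) [IsFiniteMeasureOnCompacts μ]
    (hμ : WeakStarTendsto
      (fun j => sqMeasure (microlocalLift (lam (φ j)) (u (φ j))) (volLift ρ)) μ) :
    μ.map (proj ρ) = μM ∧ ∀ t : ℝ, μ.map (flow ρ t) = μ := by
  have hlam' : Tendsto (fun j => lam (φ j)) atTop atTop := hlam.comp hφ.tendsto_atTop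
  have hu' : ∀ j, IsMaassForm ρ (lam (φ j)) (u (φ j)) := fun j => hu (φ j)
  exact ⟨map_proj_eq hfree hu' hlam' (fun f hf hfs => (hμM f hf hfs).comp hφ.tendsto_atTop) hμ,
    map_flow_eq hfree hu' hlam' hμ⟩
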